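/- Let $H$ be a real Hilbert space and let $H'=H\oplus H$ with grading $J=\mathrm{diag}(\mathbf 1,-\mathbf 1)$. Let $[0,1]\ni t\mapsto B_t$ be an admissible path, i.e. a norm-continuous path of bounded Fredholm operators on $H$ with $B_0$ and $B_1$ invertible, and put $$T_t=\begin{pmatrix}0&B_t\\-B_t^*&0\end{pmatrix}\quad\text{on } H' .$$ *Parity.* The parity $\sigma(B)\in\{1,-1\}$ is the $\mathbb Z_2$-valued spectral flow of $t\mapsto T_t$, defined as follows. With $Q_a(t)=\chi_{(-a,a)}(\imath T_t)$, choose a partition $0=t_0<\dots<t_N=1$ and $a_1,\dots,a_N>0$ such that on each $[t_{n-1},t_n]$ the projections $Q_{a_n}(t)$ have finite rank, depend norm-continuously on $t$ and satisfy $\|Q_{a_n}(t)-Q_{a_n}(t')\|<1$. Choose skew-adjoint operators $R_n$ ($0\le n\le N$) with range in $\ker T_{t_n}$ such that the operators $T^{(a)}_{t_n}=Q_a(t_n)T_{t_n}Q_a(t_n)+R_n$ are invertible on $\mathrm{Ran}\,Q_a(t_n)$ (for $a=a_n$ and $a=a_{n+1}$, whichever are defined). With $V_n:\mathrm{Ran}\,Q_{a_n}(t_{n-1})\to\mathrm{Ran}\,Q_{a_n}(t_n)$,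 $V_nv=Q_{a_n}(t_n)v$, set $$\sigma(B)=\prod_{n=1}^N \mathrm{SF}_2\big(T^{(a_n)}_{t_{n-1}},\,V_n^*T^{(a_n)}_{t_n}V_n\big),$$ where for invertible skew-adjoint $S_0,S_1$ on a finite-dimensional real inner product space $\mathrm{SF}_2(S_0,S_1)=\mathrm{sgn}\det A$ for any $A$ with $S_1=A^*S_0A$. *Chiral complex structures.* A chiral complex structure on $H'$ is a skew-adjoint unitary $I$ with $JIJ=-I$. Let $\pi$ be the quotient map onto the Calkin algebra (bounded modulo compact operators on $H'$, with the quotient norm). A pair $(I,I')$ of chiral complex structures is a Fredholm pair if $\|\pi(I-I')\|<2$, and its $\mathbb Z_2$-index is $\mathrm{PI}(I,I')=\tfrac12\dim_{\mathbb R}\ker(I+I')\bmod 2$. For every $t\in[0,1]$ let $I_t$ be a chiral complex structure completing the phase $T_t|T_t|^{-1}$ on the kernel of $T_t$, i.e. $I_t|T_t|=T_t$ with $|T_t|=(T_t^*T_t)^{1/2}$. Then choices as above exist and the value of $\sigma(B)$ does not depend on them, and there is $\delta>0$ such that for every partition $0=t_0<t_1<\dots<t_N=1$ with $t_n-t_{n-1}<\delta$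 for all $n$, every $(I_{t_{n-1}},I_{t_n})$ is a Fredholm pair, i.e. $\|\pi(I_{t_n}-I_{t_{n-1}})\|<2$, and $$\sigma(B)=(-1)^{\sum_{n=1}^N \mathrm{PI}(I_{t_{n-1}},I_{t_n})},$$ i.e., identifying $(\{1,-1\},\cdot)$ with $(\mathbb Z/2,+)$, $\sigma(B)=\sum_{n=1}^N\mathrm{PI}(I_{t_{n-1}},I_{t_n})\bmod 2$. -/

import Mathlib

noncomputable section

/-! ### Partitions of the unit interval -/

/-- A finite partition `0 = t₀ < t₁ < ⋯ < t_N = 1` of `[0, 1]`. -/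
structure UnitPartition where
  /-- the number of intervals -/
  N : ℕ
  /-- the partition points -/
  pt : Fin (N + 1) → ℝ
  strictMono : StrictMono pt
  pt_zero : pt 0 = 0
  pt_last : pt (Fin.last N) = 1

namespace UnitPartition

/-- The left endpoint of the `n`-th interval. -/
def left (p : UnitPartition) (n : Fin p.N) : ℝ := p.pt n.castSucc

/-- The right endpoint of the `n`-th interval. -/
def right (p : UnitPartition) (n : Fin p.N) : ℝ := p.pt n.succ

end UnitPartition

section HilbertSpace

variable {E : Type*} [NormedAddCommGroup E] [InnerProductSpace ℝ E] [CompleteSpace E]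

/-! ### Skew-adjoint operators and the spectral projections `χ_{(-a,a)}(ıT)` -/

/-- `T* = -T`. -/
def IsSkewAdjointOp (T : E →L[ℝ] E) : Prop := ContinuousLinearMap.adjoint T = -T

/-- The vectors `v` with `‖Tⁿ v‖ ≤ C bⁿ` for all `n`, for some `0 ≤ b < a` and some `C`.
For skew-adjoint `T` with complex spectral measure `μ_v` of `ıT` at `v` one has
`‖Tⁿ v‖² = ∫ λ²ⁿ dμ_v(λ)`; so these are the vectors whose spectral measure is supported in
`[-b, b]` for some `b < a`. -/
def preSpectralSubspace (T : E →L[ℝ] E) (a : ℝ) : Submodule ℝ E where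
  carrier := {v | ∃ b C : ℝ, 0 ≤ b ∧ b < a ∧ ∀ n : ℕ, ‖(T ^ n) v‖ ≤ C * b ^ n} ∪ {0}
  zero_mem' := Or.inr rfl
  add_mem' := by
    rintro v w (⟨b, C, hb, hba, hv⟩ | rfl) (⟨b', C', hb', hba', hw⟩ | rfl)
    · have hC : 0 ≤ C := by simpa using (norm_nonneg _).trans (hv 0)
      have hC' : 0 ≤ C' := by simpa using (norm_nonneg _).trans (hw 0)
      refine Or.inl ⟨max b b', C + C', le_max_of_le_left hb, max_lt hba hba', fun n => ?_⟩
      rw [map_add, add_mul]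
      refine (norm_add_le _ _).trans (add_le_add ((hv n).trans ?_) ((hw n).trans ?_))
      · exact mul_le_mul_of_nonneg_left (pow_le_pow_left₀ hb (le_max_left _ _) n) hC
      · exact mul_le_mul_of_nonneg_left (pow_le_pow_left₀ hb' (le_max_right _ _) n) hC'
    · rw [add_zero]; exact Or.inl ⟨b, C, hb, hba, hv⟩
    · rw [zero_add]; exact Or.inl ⟨b', C', hb', hba', hw⟩
    · rw [add_zero]; exact Or.inr rfl
  smul_mem' := by
    rintro c v (⟨b, C, hb, hba, hv⟩ | rfl)
    · refine Or.inl ⟨b, ‖c‖ * C, hb, hba, fun n => ?_⟩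
      rw [map_smul, norm_smul, mul_assoc]
      exact mul_le_mul_of_nonneg_left (hv n) (norm_nonneg c)
    · rw [smul_zero]; exact Or.inr rfl

/-- The spectral subspace `𝓔_a = Ran χ_{(-a,a)}(ıT)` of a bounded skew-adjoint operator `T` on a
real Hilbert space: the closure of the union over `b < a` of the ranges of `χ_{[-b,b]}(ıT)`. -/
def spectralSubspace (T : E →L[ℝ] E) (a : ℝ) : Submodule ℝ E :=
  (preSpectralSubspace T a).topologicalClosure

instance spectralSubspace.instCompleteSpace (T : E →L[ℝ] E) (a : ℝ) :
    CompleteSpace (spectralSubspace T a) :=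
  Submodule.topologicalClosure.completeSpace _

/-- The spectral projection `Q_a = χ_{(-a,a)}(ıT)`, as a real operator on `E`. -/
def spectralProj (T : E →L[ℝ] E) (a : ℝ) : E →L[ℝ] E :=
  (spectralSubspace T a).starProjection

/-- The operator `Q_a T Q_a + R` on `𝓔_a = Ran Q_a`, for `R` acting on the kernel of `T`. -/
def compressed (T R : E →L[ℝ] E) (a : ℝ) : spectralSubspace T a →L[ℝ] spectralSubspace T a :=
  (spectralSubspace T a).orthogonalProjectionOnto ∘L (T + R) ∘L (spectralSubspace T a).subtypeL

/-- The map `𝓔_a(T₀) → 𝓔_a(T₁)`, `v ↦ Q_a(T₁) v`. -/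
def spectralTransport (T₀ T₁ : E →L[ℝ] E) (a : ℝ) :
    spectralSubspace T₀ a →L[ℝ] spectralSubspace T₁ a :=
  (spectralSubspace T₁ a).orthogonalProjectionOnto ∘L (spectralSubspace T₀ a).subtypeL

/-! ### The `ℤ₂`-valued spectral flow, with values in `{1, -1} = ℤˣ` -/

open Classical in
/-- The finite-dimensional `ℤ₂`-valued spectral flow `sgn (det A)`, where `S₁ = A* S₀ A`.
It is used for invertible skew-adjoint `S₀`, `S₁`; then such an `A` exists, and all such `A`
have a determinant of the same (non-zero) sign. -/
def finiteSF₂ (S₀ S₁ : E →L[ℝ] E) : ℤˣ :=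
  if ∃ A : E →L[ℝ] E, S₁ = ContinuousLinearMap.adjoint A ∘L S₀ ∘L A ∧ 0 < A.det then 1 else -1

/-- The choices in the construction of the `ℤ₂`-valued spectral flow of a path `T` of skew-adjoint
Fredholm operators: a partition, cut-offs `a_n > 0`, and perturbations `R_n` of the kernel of `T`
at the partition points. -/
structure SpectralFlowData (T : ℝ → E →L[ℝ] E) extends UnitPartition where
  /-- the cut-off on the `n`-th interval -/
  a : Fin N → ℝ
  a_pos : ∀ n, 0 < a n
  finite_rank : ∀ n, ∀ t ∈ Set.Icc (toUnitPartition.left n) (toUnitPartition.right n),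
    FiniteDimensional ℝ (spectralSubspace (T t) (a n))
  continuousOn_proj : ∀ n, ContinuousOn (fun t => spectralProj (T t) (a n))
    (Set.Icc (toUnitPartition.left n) (toUnitPartition.right n))
  /-- the bound which makes `v ↦ Q_{a_n}(t') v` a bijection between the spectral subspaces -/
  proj_close : ∀ n, ∀ t ∈ Set.Icc (toUnitPartition.left n) (toUnitPartition.right n),
    ∀ t' ∈ Set.Icc (toUnitPartition.left n) (toUnitPartition.right n),
      ‖spectralProj (T t) (a n) - spectralProj (T t') (a n)‖ < 1
  /-- the perturbation at the `n`-th partition point -/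
  R : Fin (N + 1) → E →L[ℝ] E
  R_skew : ∀ n, IsSkewAdjointOp (R n)
  /-- `R_n` maps into the kernel of `T_{t_n}` (so, being skew-adjoint, it vanishes on the
  orthogonal complement of this kernel) -/
  R_range : ∀ n x, T (pt n) (R n x) = 0
  isUnit_left : ∀ n : Fin N, IsUnit (compressed (T (pt n.castSucc)) (R n.castSucc) (a n))
  isUnit_right : ∀ n : Fin N, IsUnit (compressed (T (pt n.succ)) (R n.succ) (a n))

/-- The product over the intervals of the finite-dimensional `ℤ₂`-valued spectral flows from
`Q T Q + R` at the left endpoint to the pull-back of `Q T Q + R` at the right endpoint. -/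
def SpectralFlowData.value {T : ℝ → E →L[ℝ] E} (d : SpectralFlowData T) : ℤˣ :=
  ∏ n : Fin d.N,
    finiteSF₂ (compressed (T (d.pt n.castSucc)) (d.R n.castSucc) (d.a n))
      (ContinuousLinearMap.adjoint
          (spectralTransport (T (d.pt n.castSucc)) (T (d.pt n.succ)) (d.a n)) ∘L
        compressed (T (d.pt n.succ)) (d.R n.succ) (d.a n) ∘L
        spectralTransport (T (d.pt n.castSucc)) (T (d.pt n.succ)) (d.a n))

/-- `s` is a value of the `ℤ₂`-valued spectral flow of `T`, for some choice of the data. -/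
def HasSF₂ (T : ℝ → E →L[ℝ] E) (s : ℤˣ) : Prop := ∃ d : SpectralFlowData T, d.value = s

/-- The `ℤ₂`-valued spectral flow: the value given by any choice of the data. -/
def SF₂ (T : ℝ → E →L[ℝ] E) : ℤˣ := Classical.epsilon (HasSF₂ T)

/-- The class `π(X)` of a bounded operator `X` in the Calkin algebra of bounded operators modulo
compact operators, with the quotient norm. -/
def calkinMk (X : E →L[ℝ] E) : (E →L[ℝ] E) ⧸ compactOperator (RingHom.id ℝ) E E :=
  (compactOperator (RingHom.id ℝ) E E).mkQ X

end HilbertSpace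

/-! ### Chiral operators on the doubled space `H ⊕ H` -/

section Chiral

variable {H : Type*} [NormedAddCommGroup H] [InnerProductSpace ℝ H] [CompleteSpace H]

/-- The block operator `(x, y) ↦ (B y, C x)` on the Hilbert space direct sum `H ⊕ H`. -/
def offDiagonal (B C : H →L[ℝ] H) : WithLp 2 (H × H) →L[ℝ] WithLp 2 (H × H) :=
  (WithLp.prodContinuousLinearEquiv 2 ℝ H H).symm.toContinuousLinearMap ∘L
    ((B ∘L ContinuousLinearMap.snd ℝ H H).prod (C ∘L ContinuousLinearMap.fst ℝ H H)) ∘L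
    (WithLp.prodContinuousLinearEquiv 2 ℝ H H).toContinuousLinearMap

/-- The chiral skew-adjoint operator `T = (0, B; -B*, 0)` associated with `B`. -/
def chiralOp (B : H →L[ℝ] H) : WithLp 2 (H × H) →L[ℝ] WithLp 2 (H × H) :=
  offDiagonal B (-ContinuousLinearMap.adjoint B)

variable (H) in
/-- The grading `J = diag(1, -1)` on `H ⊕ H`. -/
def grading : WithLp 2 (H × H) →L[ℝ] WithLp 2 (H × H) :=
  (WithLp.prodContinuousLinearEquiv 2 ℝ H H).symm.toContinuousLinearMap ∘L
    ((ContinuousLinearMap.fst ℝ H H).prod (-ContinuousLinearMap.snd ℝ H H)) ∘L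
    (WithLp.prodContinuousLinearEquiv 2 ℝ H H).toContinuousLinearMap

/-- `B` is, on `[0, 1]`, a norm-continuous path of Fredholm operators with invertible endpoints. -/
structure IsAdmissiblePath (B : ℝ → H →L[ℝ] H) : Prop where
  continuousOn : ContinuousOn B (Set.Icc 0 1)
  isFredholm : ∀ t ∈ Set.Icc (0 : ℝ) 1, (B t).IsFredholm
  isUnit_zero : IsUnit (B 0)
  isUnit_one : IsUnit (B 1)

/-- The parity `σ(B)` of a path: the `ℤ₂`-valued spectral flow of the associated path of chiral
skew-adjoint operators. -/
def parity (B : ℝ → H →L[ℝ] H) : ℤˣ := SF₂ fun t => chiralOp (B t)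

/-- A chiral complex structure: a skew-adjoint unitary `I` on `H ⊕ H` with `J I J = -I`. -/
structure IsChiralComplexStructure (I : WithLp 2 (H × H) →L[ℝ] WithLp 2 (H × H)) : Prop where
  skew : IsSkewAdjointOp I
  unitary : I ∈ unitary (WithLp 2 (H × H) →L[ℝ] WithLp 2 (H × H))
  chiral : grading H ∘L I ∘L grading H = -I

/-- `P = |T|`: the positive square root of `T* T`. -/
def IsModulus (T P : WithLp 2 (H × H) →L[ℝ] WithLp 2 (H × H)) : Prop :=
  P.IsPositive ∧ P ∘L P = ContinuousLinearMap.adjoint T ∘L T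

/-- `I` is a chiral complex structure which completes the phase `T |T|⁻¹` on the kernel of `T`:
`I |T| = T`, i.e. `I` agrees with `T |T|⁻¹` on the range of `|T|`, and there is no further
restriction on `I` on the orthogonal complement `ker T` of this range. -/
def CompletesPhase (T I : WithLp 2 (H × H) →L[ℝ] WithLp 2 (H × H)) : Prop :=
  IsChiralComplexStructure I ∧ ∃ P, IsModulus T P ∧ I ∘L P = T

/-- `(I₀, I₁)` is a Fredholm pair of chiral complex structures: `‖π(I₀ - I₁)‖ < 2`. -/
structure IsFredholmPair (I₀ I₁ : WithLp 2 (H × H) →L[ℝ] WithLp 2 (H × H)) : Prop where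
  left : IsChiralComplexStructure I₀
  right : IsChiralComplexStructure I₁
  norm_lt : ‖calkinMk (I₀ - I₁)‖ < 2

/-- The `ℤ₂`-index `PI(I₀, I₁) = ½ dim ker (I₀ + I₁) mod 2` of a Fredholm pair of chiral complex
structures (the dimension is finite and even for such a pair). -/
def pairIndex (I₀ I₁ : WithLp 2 (H × H) →L[ℝ] WithLp 2 (H × H)) : ZMod 2 :=
  ((Module.finrank ℝ (I₀ + I₁).ker / 2 : ℕ) : ZMod 2)

end Chiral

end

set_option linter.unusedSectionVars false

open Set Filter Topology

/-! ### The determinant of a finite rank perturbation of the identity -/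

/-! Let g_t be the upper right block of `fillKernel (chiralOp (B t)) (I t)`, that is, of T_t with
I_t inserted on its kernel. It is invertible and differs from B_t by a finite rank operator. For
invertible X, Y with Y - X of finite rank, the sign `relSign X Y` of det(Y X⁻¹) is a cocycle
(`relSign_mul_relSign`) and is constant along continuous paths of such pairs
(`relSign_eq_of_preconnected`). By `exists_continuousOn_isUnit_finRank` there is a continuous path
K_t of invertible operators with K_t - B_t of finite rank. Put o(t) = `relSign` of K_t and g_t; both
sides of the formula equal o(0) o(1).

Spectral flow: on one interval the required congruence factors into congruences of the kernels,
which absorb the choices of R, and one of the form diag(1, z), whose sign is o(t_{n-1}) o(t_n)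
(`finiteSF₂_interval`). The kernel signs occur twice at interior points and are trivial at the ends,
where T is invertible. So the product telescopes, whatever the data (`SpectralFlowData.value_eq`).
That data exist follows from a variational argument for spectral gaps (`exists_cutoff`).

Index: modulo finite rank operators the phase depends continuously on T
(`IsPolarPair.exists_finRank_norm_sub_lt`, by a Sylvester equation for |T|), so phases at nearby
parameters form Fredholm pairs. A straight line joins a filled operator to its phase, so g_t may be
replaced by the orthogonal upper right block of I_t. For orthogonal operators u, u' the relative
sign is the parity of dim ker(u + u'), and ker(I + I') is two copies of such a kernel. Hence
(-1)^PI(I_t, I_t') = o(t) o(t') locally (`exists_pairIndex_eq`); a Lebesgue number makes this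
uniform, and the product telescopes again. -/

theorem LinearMap.det_one_add_comp_comm {V W : Type*} [AddCommGroup V] [Module ℝ V]
    [FiniteDimensional ℝ V] [AddCommGroup W] [Module ℝ W] [FiniteDimensional ℝ W]
    (f : V →ₗ[ℝ] W) (g : W →ₗ[ℝ] V) :
    LinearMap.det (1 + f ∘ₗ g) = LinearMap.det (1 + g ∘ₗ f) := by
  classical
  let v := Module.finBasis ℝ V
  let w := Module.finBasis ℝ W
  rw [← LinearMap.det_toMatrix v, ← LinearMap.det_toMatrix w, map_add, map_add,
    LinearMap.toMatrix_comp w v w, LinearMap.toMatrix_comp v w v, LinearMap.toMatrix_one,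
    LinearMap.toMatrix_one, Matrix.det_one_add_mul_comm]

/-- The determinant of `1 + F` for an operator `F` of finite rank, computed on the range of `F`. -/
noncomputable def detOneAdd {V : Type*} [AddCommGroup V] [Module ℝ V] (F : V →ₗ[ℝ] V) : ℝ :=
  LinearMap.det (1 + F.rangeRestrict ∘ₗ F.range.subtype)

section DetOneAdd

variable {V W : Type*} [AddCommGroup V] [Module ℝ V] [AddCommGroup W] [Module ℝ W]

/-- Sylvester's identity det(1 + fg) = det(1 + gf), applied twice: both sides reduce to the
finite-dimensional range of `q`, although `V` may be infinite-dimensional. -/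
theorem detOneAdd_comp [FiniteDimensional ℝ W] (p : W →ₗ[ℝ] V) (q : V →ₗ[ℝ] W) :
    detOneAdd (p ∘ₗ q) = LinearMap.det (1 + q ∘ₗ p) := by
  have hF : FiniteDimensional ℝ (p ∘ₗ q).range := by
    rw [LinearMap.range_comp]; infer_instance
  let p' : q.range →ₗ[ℝ] (p ∘ₗ q).range :=
    (p ∘ₗ q.range.subtype).codRestrict _ (by rintro ⟨_, x, rfl⟩; exact ⟨x, rfl⟩)
  have h1 : (p ∘ₗ q).rangeRestrict = p' ∘ₗ q.rangeRestrict := by ext x; rfl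
  have h2 : (p ∘ₗ q).range.subtype ∘ₗ p' = p ∘ₗ q.range.subtype := by ext x; rfl
  have h3 : q = q.range.subtype ∘ₗ q.rangeRestrict := by ext x; rfl
  unfold detOneAdd
  rw [h1, LinearMap.comp_assoc, LinearMap.det_one_add_comp_comm, LinearMap.comp_assoc, h2]
  conv_rhs => rw [h3, LinearMap.comp_assoc, LinearMap.det_one_add_comp_comm, LinearMap.comp_assoc]

theorem detOneAdd_eq (U : Submodule ℝ V) [FiniteDimensional ℝ U] (F : V →ₗ[ℝ] V)
    (h : ∀ x, F x ∈ U) :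
    detOneAdd F = LinearMap.det (1 + F.codRestrict U h ∘ₗ U.subtype) := by
  rw [← detOneAdd_comp]; rfl

theorem detOneAdd_zero : detOneAdd (0 : V →ₗ[ℝ] V) = 1 := by
  rw [detOneAdd_eq ⊥ 0 (by simp)]
  exact LinearMap.det_eq_one_of_subsingleton _

/-- On the sum of the two ranges this is multiplicativity of the determinant for (1 + F)(1 + G). -/
theorem detOneAdd_mul {F G : V →ₗ[ℝ] V} (hF : F.HasFiniteRange) (hG : G.HasFiniteRange) :
    detOneAdd F * detOneAdd G = detOneAdd (F + G + F ∘ₗ G) := by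
  let U := F.range ⊔ G.range
  have : FiniteDimensional ℝ U := by
    rw [← Submodule.fg_iff_finiteDimensional]; exact Submodule.FG.sup hF hG
  have h1 : ∀ x, F x ∈ U := fun x => (le_sup_left : F.range ≤ U) ⟨x, rfl⟩
  have h2 : ∀ x, G x ∈ U := fun x => (le_sup_right : G.range ≤ U) ⟨x, rfl⟩
  have h3 : ∀ x, (F + G + F ∘ₗ G) x ∈ U := fun x => U.add_mem (U.add_mem (h1 _) (h2 _)) (h1 _)
  rw [detOneAdd_eq U F h1, detOneAdd_eq U G h2, detOneAdd_eq U _ h3, ← LinearMap.det_comp]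
  congr 1
  ext x
  simp
  abel

/-- Only `q ∘ p = id` is needed, so `p` may be the inclusion of a summand; this compares
determinants on `H` and on `H ⊕ H`. -/
theorem detOneAdd_conj {F : V →ₗ[ℝ] V} (hF : F.HasFiniteRange) (p : V →ₗ[ℝ] W) (q : W →ₗ[ℝ] V)
    (h : q ∘ₗ p = LinearMap.id) : detOneAdd (p ∘ₗ F ∘ₗ q) = detOneAdd F := by
  have : FiniteDimensional ℝ F.range := by
    rw [← Submodule.fg_iff_finiteDimensional]; exact hF
  have h3 : F = F.range.subtype ∘ₗ F.rangeRestrict := by ext x; rfl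
  have : p ∘ₗ F ∘ₗ q = (p ∘ₗ F.range.subtype) ∘ₗ (F.rangeRestrict ∘ₗ q) := by
    ext x; rfl
  rw [this, detOneAdd_comp, LinearMap.comp_assoc, ← LinearMap.comp_assoc _ p q, h,
    LinearMap.id_comp]
  rfl

theorem detOneAdd_ne_zero {F : V →ₗ[ℝ] V} (hF : F.HasFiniteRange)
    (h : IsUnit (1 + F)) : detOneAdd F ≠ 0 := by
  obtain ⟨u, hu⟩ := h
  -- 1 + G is the inverse of 1 + F, so the two determinants multiply to 1.
  let G : V →ₗ[ℝ] V := -(↑u⁻¹ ∘ₗ F)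
  have hG : G.HasFiniteRange := (hF.comp_left _).neg
  have hinv : (↑u⁻¹ : V →ₗ[ℝ] V) * (1 + F) = 1 := by rw [← hu]; simp
  have h1 : F + G + G ∘ₗ F + 0 = 0 := by
    have : (↑u⁻¹ : V →ₗ[ℝ] V) * F * (1 + F) = F := by
      have hc : F * (1 + F) = (1 + F) * F := by noncomm_ring
      rw [mul_assoc, hc, ← mul_assoc, hinv, one_mul]
    have h2 : G ∘ₗ F = - (↑u⁻¹ * F * F : V →ₗ[ℝ] V) := by
      change (-(↑u⁻¹ * F)) * F = _
      rw [neg_mul]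
    have h3 : G = -(↑u⁻¹ * F : V →ₗ[ℝ] V) := rfl
    rw [h2, h3]
    nth_rewrite 1 [← this]
    noncomm_ring
  intro h0
  have := detOneAdd_mul hG hF
  rw [h0, mul_zero, add_comm G F, ← add_zero (F + G + _), h1, detOneAdd_zero] at this
  exact zero_ne_one this

end DetOneAdd

/-- The sign of a real number, as a unit of `ℤ` (with value `-1` at `0`). -/
noncomputable def signUnit (x : ℝ) : ℤˣ := if 0 < x then 1 else -1

theorem signUnit_mul {x y : ℝ} (hx : x ≠ 0) (hy : y ≠ 0) :
    signUnit (x * y) = signUnit x * signUnit y := by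
  unfold signUnit
  rcases hx.lt_or_gt with hx | hx <;> rcases hy.lt_or_gt with hy | hy
  · simp [mul_pos_of_neg_of_neg hx hy, hx.le, hy.le, not_lt.2]
  · simp [(mul_neg_of_neg_of_pos hx hy).le, hx.le, hy, not_lt.2]
  · simp [(mul_neg_of_pos_of_neg hx hy).le, hx, hy.le, not_lt.2]
  · simp [hx, hy]

theorem signUnit_one : signUnit 1 = 1 := by simp [signUnit]

theorem continuousAt_signUnit {x : ℝ} (hx : x ≠ 0) : ∀ᶠ y in 𝓝 x, signUnit y = signUnit x := by
  rcases hx.lt_or_gt with h | h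
  · filter_upwards [gt_mem_nhds h] with y hy
    simp [signUnit, not_lt.2 hy.le, not_lt.2 h.le]
  · filter_upwards [lt_mem_nhds h] with y hy
    simp [signUnit, hy, h]

theorem signUnit_eq_of_preconnected {α : Type*} [TopologicalSpace α] {S : Set α}
    (hS : IsPreconnected S) {f : α → ℝ} (hf : ContinuousOn f S) (h0 : ∀ s ∈ S, f s ≠ 0)
    {s s' : α} (hs : s ∈ S) (hs' : s' ∈ S) : signUnit (f s) = signUnit (f s') := by
  refine hS.constant (Y := ℤˣ) (f := fun s => signUnit (f s)) ?_ hs hs'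
  intro x hx
  have := (hf x hx).eventually (continuousAt_signUnit (h0 x hx))
  exact continuousWithinAt_const.congr_of_eventuallyEq this rfl

/-! ### Finite rank perturbations of bounded operators -/

section RelSign

variable {E E' E'' : Type*} [NormedAddCommGroup E] [NormedSpace ℝ E]
  [NormedAddCommGroup E'] [NormedSpace ℝ E'] [NormedAddCommGroup E''] [NormedSpace ℝ E'']

/-- Bounded operators of finite rank. -/
def FinRank (F : E →L[ℝ] E') : Prop := (F : E →ₗ[ℝ] E').HasFiniteRange

namespace FinRank

theorem zero : FinRank (0 : E →L[ℝ] E') := LinearMap.HasFiniteRange.zero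

theorem add {F G : E →L[ℝ] E'} (hF : FinRank F) (hG : FinRank G) : FinRank (F + G) :=
  LinearMap.HasFiniteRange.add hF hG

theorem sub {F G : E →L[ℝ] E'} (hF : FinRank F) (hG : FinRank G) : FinRank (F - G) :=
  LinearMap.HasFiniteRange.sub hF hG

theorem neg {F : E →L[ℝ] E'} (hF : FinRank F) : FinRank (-F) :=
  LinearMap.HasFiniteRange.neg hF

theorem smul {F : E →L[ℝ] E'} (hF : FinRank F) (c : ℝ) : FinRank (c • F) :=
  LinearMap.HasFiniteRange.smul hF c

theorem comp_left {F : E →L[ℝ] E'} (hF : FinRank F) (G : E' →L[ℝ] E'') : FinRank (G ∘L F) :=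
  LinearMap.HasFiniteRange.comp_left hF _

theorem comp_right {F : E' →L[ℝ] E''} (hF : FinRank F) (G : E →L[ℝ] E') : FinRank (F ∘L G) :=
  LinearMap.HasFiniteRange.comp_right hF _

theorem mul_left {F : E →L[ℝ] E} (hF : FinRank F) (G : E →L[ℝ] E) : FinRank (G * F) :=
  hF.comp_left G

theorem mul_right {F : E →L[ℝ] E} (hF : FinRank F) (G : E →L[ℝ] E) : FinRank (F * G) :=
  hF.comp_right G

theorem of_mem {F : E →L[ℝ] E'} (U : Submodule ℝ E') [FiniteDimensional ℝ U]
    (h : ∀ x, F x ∈ U) : FinRank F := by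
  have : F = U.subtypeL ∘L F.codRestrict U h := rfl
  rw [this]
  exact LinearMap.HasFiniteRange.comp_right (V₂ := U) (by
    have : (U.subtype : U →ₗ[ℝ] E').HasFiniteRange := LinearMap.HasFiniteRange.of_finite_dom
    exact this) _

theorem finiteDimensional {F : E →L[ℝ] E'} (hF : FinRank F) : FiniteDimensional ℝ F.range := by
  rw [← Submodule.fg_iff_finiteDimensional]; exact hF

end FinRank

/-- The sign of `det (Y X⁻¹)` for invertible operators which differ by a finite rank operator. -/
noncomputable def relSign (X Y : E →L[ℝ] E) : ℤˣ :=
  signUnit (detOneAdd (((Y - X) * Ring.inverse X : E →L[ℝ] E) : E →ₗ[ℝ] E))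

theorem isUnit_toLinearMap {X : E →L[ℝ] E} (hX : IsUnit X) : IsUnit (X : E →ₗ[ℝ] E) :=
  hX.map (ContinuousLinearMap.toLinearMapRingHom : (E →L[ℝ] E) →+* (E →ₗ[ℝ] E))

theorem detOneAdd_relSign_ne_zero {X Y : E →L[ℝ] E} (hX : IsUnit X) (hY : IsUnit Y)
    (h : FinRank (Y - X)) :
    detOneAdd (((Y - X) * Ring.inverse X : E →L[ℝ] E) : E →ₗ[ℝ] E) ≠ 0 := by
  refine detOneAdd_ne_zero (h.mul_right _) ?_
  have h1 : (1 : E →L[ℝ] E) + (Y - X) * Ring.inverse X = Y * Ring.inverse X := by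
    rw [sub_mul, Ring.mul_inverse_cancel _ hX]; abel
  have := isUnit_toLinearMap (hY.mul (IsUnit.ringInverse hX))
  rw [← h1] at this
  exact this

theorem relSign_self (X : E →L[ℝ] E) : relSign X X = 1 := by
  unfold relSign
  rw [sub_self, zero_mul]
  have : ((0 : E →L[ℝ] E) : E →ₗ[ℝ] E) = 0 := rfl
  rw [this, detOneAdd_zero, signUnit_one]

/-- Multiplicativity of the determinant for Z X⁻¹ = (Z Y⁻¹)(Y X⁻¹). -/
theorem relSign_mul_relSign {X Y Z : E →L[ℝ] E} (hX : IsUnit X) (hY : IsUnit Y) (hZ : IsUnit Z)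
    (h : FinRank (Y - X)) (h' : FinRank (Z - Y)) :
    relSign X Y * relSign Y Z = relSign X Z := by
  unfold relSign
  rw [mul_comm, ← signUnit_mul (detOneAdd_relSign_ne_zero hY hZ h')
    (detOneAdd_relSign_ne_zero hX hY h), detOneAdd_mul (h'.mul_right _) (h.mul_right _)]
  congr 2
  have : (Z - Y) * Ring.inverse Y + (Y - X) * Ring.inverse X
      + ((Z - Y) * Ring.inverse Y) * ((Y - X) * Ring.inverse X) = (Z - X) * Ring.inverse X := by
    have h1 : Ring.inverse Y * Y = 1 := Ring.inverse_mul_cancel _ hY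
    have h2 : X * Ring.inverse X = 1 := Ring.mul_inverse_cancel _ hX
    calc _ = (Z - Y) * Ring.inverse Y + (Y - X) * Ring.inverse X
      + ((Z - Y) * (Ring.inverse Y * Y) * Ring.inverse X
        - (Z - Y) * Ring.inverse Y * (X * Ring.inverse X)) := by noncomm_ring
      _ = _ := by rw [h1, h2]; noncomm_ring
  exact congrArg (fun f : E →L[ℝ] E => (f : E →ₗ[ℝ] E)) this

theorem relSign_comm {X Y : E →L[ℝ] E} (hX : IsUnit X) (hY : IsUnit Y) (h : FinRank (Y - X)) :
    relSign X Y = relSign Y X := by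
  have h' : FinRank (X - Y) := by rw [← neg_sub]; exact h.neg
  have := relSign_mul_relSign hX hY hX h h'
  rw [relSign_self] at this
  rw [← Int.units_inv_eq_self (relSign Y X)]
  exact eq_inv_of_mul_eq_one_left this

/-- Left multiplication by Z conjugates Y X⁻¹, which does not change the determinant. -/
theorem relSign_mul_left {X Y Z : E →L[ℝ] E} (hX : IsUnit X) (h : FinRank (Y - X))
    (hZ : IsUnit Z) : relSign (Z * X) (Z * Y) = relSign X Y := by
  unfold relSign
  obtain ⟨u, rfl⟩ := hZ
  obtain ⟨v, rfl⟩ := hX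
  congr 1
  rw [← Units.val_mul, Ring.inverse_unit, Ring.inverse_unit, mul_inv_rev]
  rw [← detOneAdd_conj (F := (((Y - v) * ↑v⁻¹ : E →L[ℝ] E) : E →ₗ[ℝ] E)) (h.mul_right _)
    ((u : E →L[ℝ] E) : E →ₗ[ℝ] E) ((↑u⁻¹ : E →L[ℝ] E) : E →ₗ[ℝ] E)]
  · congr 1
    ext x
    simp
  · have : (↑u⁻¹ : E →L[ℝ] E) * u = 1 := Units.inv_mul u
    ext x
    exact congrArg (fun f : E →L[ℝ] E => f x) this

/-- The determinant of `1 + F X⁻¹` is continuous as long as the ranges of `F` stay in a fixed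
finite-dimensional subspace. -/
theorem continuousOn_detOneAdd [CompleteSpace E] {α : Type*} [TopologicalSpace α] {S : Set α}
    {X F : α → E →L[ℝ] E} (hX : ContinuousOn X S) (hF : ContinuousOn F S)
    (hu : ∀ s ∈ S, IsUnit (X s)) (U : Submodule ℝ E) [FiniteDimensional ℝ U]
    (hU : ∀ s, ∀ x, F s x ∈ U) :
    ContinuousOn (fun s => detOneAdd ((F s * Ring.inverse (X s) : E →L[ℝ] E) : E →ₗ[ℝ] E)) S := by
  -- A bounded projection onto U turns all these determinants into determinants on one space, where
  -- `det` is continuous.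
  have hc : U.ClosedComplemented := Submodule.ClosedComplemented.of_finiteDimensional U
  obtain ⟨p, hp⟩ := hc
  have key : ∀ s, detOneAdd ((F s * Ring.inverse (X s) : E →L[ℝ] E) : E →ₗ[ℝ] E) =
      ContinuousLinearMap.det (1 + p ∘L (F s * Ring.inverse (X s)) ∘L U.subtypeL) := by
    intro s
    rw [detOneAdd_eq U ((F s * Ring.inverse (X s) : E →L[ℝ] E) : E →ₗ[ℝ] E)
      (fun x => hU s _), ContinuousLinearMap.det]
    congr 1
    ext x
    have := hp ⟨F s (Ring.inverse (X s) x), hU s _⟩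
    change (x : E) + F s (Ring.inverse (X s) x) = x + ((p (F s (Ring.inverse (X s) x)) : U) : E)
    rw [this]
  simp_rw [key]
  refine ContinuousLinearMap.continuous_det.comp_continuousOn (continuousOn_const.add ?_)
  have hinv : ContinuousOn (fun s => Ring.inverse (X s)) S := by
    intro s hs
    obtain ⟨u, hu'⟩ := hu s hs
    have := NormedRing.inverse_continuousAt u
    rw [hu'] at this
    exact this.comp_continuousWithinAt (hX s hs)
  exact continuousOn_const.clm_comp ((hF.mul hinv).clm_comp continuousOn_const)

/-- det(1 + r (Y - X) X⁻¹) is continuous in r, equals 1 at r = 0 and does not vanish on [0, 1]. -/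
theorem relSign_eq_one_of_segment [CompleteSpace E] {X Y : E →L[ℝ] E} (h : FinRank (Y - X))
    (hu : ∀ r ∈ Icc (0 : ℝ) 1, IsUnit (X + r • (Y - X))) : relSign X Y = 1 := by
  have hX : IsUnit X := by simpa using hu 0 (by simp)
  have := h.finiteDimensional
  have hc := continuousOn_detOneAdd (S := Icc (0 : ℝ) 1) (X := fun _ => X)
    (F := fun r => r • (Y - X)) continuousOn_const
    ((continuous_id.smul continuous_const).continuousOn) (fun _ _ => hX) (Y - X).range
    (fun s x => Submodule.smul_mem _ _ ⟨x, rfl⟩)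
  have h2 := signUnit_eq_of_preconnected isPreconnected_Icc hc (fun r hr => by
    have := detOneAdd_relSign_ne_zero hX (hu r hr) (by simpa using h.smul r)
    simpa using this) (s := 1) (s' := 0) (by simp) (by simp)
  have h3 : (((0 : E →L[ℝ] E) : E →ₗ[ℝ] E)) = 0 := rfl
  unfold relSign
  simp only [one_smul, zero_smul, zero_mul, h3, detOneAdd_zero, signUnit_one] at h2
  exact h2

/-- `relSign` is constant along continuous paths of pairs of invertible operators which differ by
finite rank operators. -/
theorem relSign_eq_of_preconnected [CompleteSpace E] {α : Type*} [TopologicalSpace α] {S : Set α}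
    (hS : IsPreconnected S) {X Y : α → E →L[ℝ] E} (hX : ContinuousOn X S) (hY : ContinuousOn Y S)
    (hXu : ∀ s ∈ S, IsUnit (X s)) (hYu : ∀ s ∈ S, IsUnit (Y s))
    (h : ∀ s ∈ S, FinRank (Y s - X s)) {s s' : α} (hs : s ∈ S) (hs' : s' ∈ S) :
    relSign (X s) (Y s) = relSign (X s') (Y s') := by
  refine hS.constant (Y := ℤˣ) (f := fun s => relSign (X s) (Y s)) ?_ hs hs'
  intro x hx
  suffices key : ∀ᶠ s in 𝓝[S] x, relSign (X s) (Y s) = relSign (X x) (Y x) from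
    continuousWithinAt_const.congr_of_eventuallyEq key rfl
  -- The ranges of `Y s - X s` need not lie in a common finite-dimensional space, so the
  -- perturbation is frozen at `x`. The sign of `X s + F` relative to `X s` is then locally
  -- constant, while `X s + F` and `Y s` lie in a ball of invertible operators around `Y x` and so
  -- have relative sign 1.
  set F := Y x - X x with hF
  have hFx := h x hx
  obtain ⟨ε, hε, hball⟩ := Metric.isOpen_iff.1 (Units.isOpen (R := E →L[ℝ] E)) (Y x) (hYu x hx)
  have hXF : ContinuousOn (fun s => X s + F) S := hX.add continuousOn_const
  have e1 : ∀ᶠ s in 𝓝[S] x, X s + F ∈ Metric.ball (Y x) ε := by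
    refine (hXF x hx).eventually_mem ?_
    have : X x + F = Y x := by rw [hF]; abel
    simp only [this]
    exact Metric.ball_mem_nhds _ hε
  have e2 : ∀ᶠ s in 𝓝[S] x, Y s ∈ Metric.ball (Y x) ε :=
    (hY x hx).eventually_mem (Metric.ball_mem_nhds _ hε)
  have := hFx.finiteDimensional
  have hc := continuousOn_detOneAdd (F := fun _ => F) hX continuousOn_const hXu F.range
    (fun s y => ⟨y, rfl⟩)
  have e3 := (hc x hx).eventually
    (continuousAt_signUnit (detOneAdd_relSign_ne_zero (hXu x hx) (hYu x hx) hFx))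
  filter_upwards [e1, e2, e3, self_mem_nhdsWithin] with s h1 h2 h3 hsS
  have hFs : FinRank (Y s - (X s + F)) := by
    rw [← sub_sub]; exact (h s hsS).sub hFx
  rw [← relSign_mul_relSign (Y := X s + F) (hXu s hsS) (hball h1) (hYu s hsS) (by simpa using hFx)
    hFs]
  have h4 : relSign (X s + F) (Y s) = 1 := by
    refine relSign_eq_one_of_segment hFs fun r hr => hball ?_
    have := (convex_ball (Y x) ε).add_smul_sub_mem h1 h2 hr
    exact this
  rw [h4, mul_one]
  unfold relSign
  rw [add_sub_cancel_left]
  exact h3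

/-- An injective finite rank perturbation of an invertible operator is invertible. -/
theorem isUnit_of_finRank_of_injective [CompleteSpace E] {X Y : E →L[ℝ] E} (hY : IsUnit Y)
    (h : FinRank (X - Y)) (hX : Function.Injective X) : IsUnit X := by
  obtain ⟨u, rfl⟩ := hY
  set F : E →L[ℝ] E := ↑u⁻¹ * (X - u) with hF
  have hFr : FinRank F := h.mul_left _
  have hXF : X = u * (1 + F) := by
    rw [hF, mul_add, ← mul_assoc, Units.mul_inv, one_mul, mul_one]; abel
  have hinj : Function.Injective (1 + F : E →L[ℝ] E) := by
    intro x y hxy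
    apply hX
    rw [hXF]
    exact congrArg u.val hxy
  have := hFr.finiteDimensional
  rw [hXF]
  refine u.isUnit.mul ?_
  rw [ContinuousLinearMap.isUnit_iff_bijective]
  refine ⟨hinj, fun y => ?_⟩
  -- Solve (1 + F) z = y by z = y + w with w in the range of F: on this finite-dimensional space 1 +
  -- F is injective, hence onto.
  let G : F.range →ₗ[ℝ] F.range := 1 + (F : E →ₗ[ℝ] E).rangeRestrict ∘ₗ F.range.subtype
  have hG : Function.Injective G := by
    intro x y hxy
    apply Subtype.ext
    apply hinj
    exact congrArg Subtype.val hxy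
  obtain ⟨w, hw⟩ := LinearMap.surjective_of_injective hG ⟨-F y, Submodule.neg_mem _ ⟨y, rfl⟩⟩
  have hw' : (w : E) + F w = -F y := congrArg Subtype.val hw
  refine ⟨y + w, ?_⟩
  change (y + w) + F (y + w) = y
  rw [map_add]
  calc y + ↑w + (F y + F ↑w) = y + (w + F w) + F y := by abel
    _ = y := by rw [hw']; abel

end RelSign

/-! ### Lifting a Fredholm path to invertible operators modulo finite rank -/

section Lift

variable {E : Type*} [NormedAddCommGroup E] [NormedSpace ℝ E] [CompleteSpace E]

/-- The lower bound gives ‖X⁻¹ Y‖ ≤ ‖Y‖ / c < 1, so the Neumann series inverts 1 + X⁻¹ Y. -/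
theorem isUnit_add_of_norm_lt {X Y : E →L[ℝ] E} {c : ℝ} (hX : IsUnit X)
    (hc : ∀ v, c * ‖v‖ ≤ ‖X v‖) (hY : ‖Y‖ < c) : IsUnit (X + Y) := by
  obtain ⟨u, rfl⟩ := hX
  have hc0 : 0 < c := (norm_nonneg Y).trans_lt hY
  have h1 : (u : E →L[ℝ] E) + Y = u * (1 - (-(↑u⁻¹ * Y))) := by
    rw [sub_neg_eq_add, mul_add, ← mul_assoc, Units.mul_inv, one_mul, mul_one]
  have h2 : ‖-((↑u⁻¹ : E →L[ℝ] E) * Y)‖ < 1 := by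
    rw [norm_neg]
    refine lt_of_le_of_lt (ContinuousLinearMap.opNorm_le_bound _ (M := ‖Y‖ / c) (by positivity)
      fun v => ?_) ((div_lt_one hc0).2 hY)
    have h3 := hc (((↑u⁻¹ : E →L[ℝ] E) * Y) v)
    have h4 : (u : E →L[ℝ] E) (((↑u⁻¹ : E →L[ℝ] E) * Y) v) = Y v := by
      change ((u : E →L[ℝ] E) * (↑u⁻¹ * Y)) v = Y v
      rw [← mul_assoc, Units.mul_inv, one_mul]
    rw [h4] at h3
    rw [div_mul_eq_mul_div, le_div_iff₀ hc0, mul_comm]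
    exact h3.trans (Y.le_opNorm v)
  rw [h1]
  exact u.isUnit.mul (Units.oneSub _ h2).isUnit

/-- A continuous path of operators which are invertible up to finite rank perturbations has a
continuous finite rank perturbation by invertible operators. -/
theorem exists_continuousOn_isUnit_finRank {B g : ℝ → E →L[ℝ] E}
    (hB : ContinuousOn B (Icc 0 1))
    (hg : ∀ t ∈ Icc (0 : ℝ) 1, IsUnit (g t) ∧ FinRank (g t - B t)) :
    ∃ h : ℝ → E →L[ℝ] E, ContinuousOn h (Icc 0 1) ∧
      ∀ t ∈ Icc (0 : ℝ) 1, IsUnit (h t) ∧ FinRank (h t - B t) := by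
  -- On the open set `c i` the path `g i + (B t - B i)` is continuous and invertible, and it differs
  -- from `B t` by the fixed finite rank operator `g i - B i`. By compactness finitely many pieces
  -- suffice.
  let c : unitInterval → Set unitInterval := fun i => {t | IsUnit (g i + (B t - B i))}
  have hc1 : ∀ i, IsOpen (c i) := fun i => by
    have h1 : Continuous fun t : unitInterval => B t := continuousOn_iff_continuous_domRestrict.1 hB
    exact (Units.isOpen (R := E →L[ℝ] E)).preimage (f := fun t : unitInterval => g i + (B t - B i))
      (continuous_const.add (h1.sub continuous_const))
  have hc2 : (univ : Set unitInterval) ⊆ ⋃ i, c i := fun i _ => mem_iUnion.2 ⟨i, by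
    change IsUnit _
    rw [sub_self, add_zero]
    exact (hg i i.2).1⟩
  obtain ⟨t, ht0, htm, ⟨N, hN⟩, hcov⟩ := exists_monotone_Icc_subset_open_cover_unitInterval hc1 hc2
  have key : ∀ n, ∃ h : ℝ → E →L[ℝ] E, ContinuousOn h (Icc 0 (t n)) ∧
      ∀ s ∈ Icc (0 : ℝ) (t n), IsUnit (h s) ∧ FinRank (h s - B s) := by
    intro n
    induction n with
    | zero =>
      refine ⟨fun _ => g 0, continuousOn_const, fun s hs => ?_⟩
      rw [ht0] at hs
      have : s = 0 := le_antisymm hs.2 hs.1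
      rw [this]
      exact hg 0 (by simp)
    | succ n ih =>
      obtain ⟨h, hcont, hh⟩ := ih
      obtain ⟨i, hi⟩ := hcov n
      have hle : (t n : ℝ) ≤ t (n + 1) := htm (Nat.le_succ n)
      set C : ℝ → E →L[ℝ] E := fun s => g i + (B s - B i) with hC
      have hCu : ∀ s ∈ Icc (t n : ℝ) (t (n + 1)), IsUnit (C s) := fun s hs =>
        hi (show (⟨s, (t n).2.1.trans hs.1, hs.2.trans (t (n + 1)).2.2⟩ : unitInterval) ∈ _ from
          ⟨hs.1, hs.2⟩)
      have hCF : ∀ s, FinRank (C s - B s) := fun s => by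
        have : C s - B s = g i - B i := by simp only [hC]; abel
        rw [this]
        exact (hg i i.2).2
      have hCt := hCu _ (left_mem_Icc.2 hle)
      have htn := hh _ (right_mem_Icc.2 (t n).2.1)
      -- Right multiplication by a constant invertible operator, equal to 1 modulo finite rank,
      -- makes the new piece agree with `h` at the gluing point.
      set K : ℝ → E →L[ℝ] E := fun s => C s * (Ring.inverse (C (t n)) * h (t n)) with hK
      have hKt : K (t n) = h (t n) := by
        simp only [hK]
        rw [← mul_assoc, Ring.mul_inverse_cancel _ hCt, one_mul]
      let h' : ℝ → E →L[ℝ] E := fun s => if s ≤ t n then h s else K s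
      have e1 : EqOn h' h (Icc 0 (t n)) := fun s hs => if_pos hs.2
      have e2 : EqOn h' K (Icc (t n) (t (n + 1))) := fun s hs => by
        rcases hs.1.eq_or_lt with h1 | h1
        · rw [← h1]
          exact (if_pos le_rfl).trans hKt.symm
        · exact if_neg h1.not_ge
      have hBs : ContinuousOn B (Icc (t n) (t (n + 1))) :=
        hB.mono (Icc_subset_Icc (t n).2.1 (t (n + 1)).2.2)
      have hKc : ContinuousOn K (Icc (t n) (t (n + 1))) :=
        (continuousOn_const.add (hBs.sub continuousOn_const)).mul continuousOn_const
      refine ⟨h', ?_, fun s hs => ?_⟩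
      · have := (hcont.congr e1).union_of_isClosed (hKc.congr e2) isClosed_Icc isClosed_Icc
        rwa [Icc_union_Icc_eq_Icc (t n).2.1 hle] at this
      · rcases le_total s (t n) with h1 | h1
        · rw [e1 ⟨hs.1, h1⟩]
          exact hh s ⟨hs.1, h1⟩
        · rw [e2 ⟨h1, hs.2⟩]
          refine ⟨(hCu s ⟨h1, hs.2⟩).mul ((IsUnit.ringInverse hCt).mul htn.1), ?_⟩
          have : K s - B s = C s * (Ring.inverse (C (t n)) *
              ((h (t n) - B (t n)) - (C (t n) - B (t n)))) + (C s - B s) := by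
            have := Ring.inverse_mul_cancel _ hCt
            simp only [hK]
            rw [sub_sub_sub_cancel_right, mul_sub (Ring.inverse _), this]
            noncomm_ring
          rw [this]
          exact (((htn.2.sub (hCF _)).mul_left _).mul_left _).add (hCF s)
  obtain ⟨h, h1, h2⟩ := key N
  have : (t N : ℝ) = 1 := by rw [hN N le_rfl]; rfl
  rw [this] at h1 h2
  exact ⟨h, h1, h2⟩

end Lift

/-! ### Fredholm estimates on a Hilbert space -/

section FredholmEstimates

variable {E : Type*} [NormedAddCommGroup E] [InnerProductSpace ℝ E] [CompleteSpace E]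

theorem IsSkewAdjointOp.inner_left {T : E →L[ℝ] E} (hT : IsSkewAdjointOp T) (x y : E) :
    inner ℝ (T x) y = -inner ℝ x (T y) := by
  rw [← ContinuousLinearMap.adjoint_inner_right, hT, neg_apply, inner_neg_right]

theorem isSkewAdjointOp_of_inner {T : E →L[ℝ] E}
    (h : ∀ x y, inner ℝ (T x) y = -inner ℝ x (T y)) : IsSkewAdjointOp T := by
  refine (ContinuousLinearMap.eq_adjoint_iff (-T) T).2 (fun x y => ?_) |>.symm
  rw [neg_apply, inner_neg_left, h, neg_neg]

theorem IsSkewAdjointOp.mem_orthogonal {T : E →L[ℝ] E} (hT : IsSkewAdjointOp T)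
    {U : Submodule ℝ E} (hU : ∀ u ∈ U, T u ∈ U) {v : E} (hv : v ∈ Uᗮ) : T v ∈ Uᗮ := by
  rw [Submodule.mem_orthogonal'] at hv ⊢
  intro u hu
  rw [hT.inner_left, hv _ (hU u hu), neg_zero]

theorem FinRank.adjoint {F : E →L[ℝ] E} (hF : FinRank F) :
    FinRank (ContinuousLinearMap.adjoint F) := by
  have := hF.finiteDimensional
  -- F = P F for the projection P onto the range, hence F* = F* P.
  have h : ContinuousLinearMap.adjoint F =
      ContinuousLinearMap.adjoint F ∘L F.range.starProjection := by
    have h1 : F = F.range.starProjection ∘L F := by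
      ext x
      exact (Submodule.starProjection_eq_self_iff.2 (LinearMap.mem_range_self _ x)).symm
    conv_lhs => rw [h1]
    rw [ContinuousLinearMap.adjoint_comp]
    congr 1
    exact (isSelfAdjoint_starProjection F.range).adjoint_eq
  rw [h]
  refine FinRank.comp_left (FinRank.of_mem F.range fun x => ?_) _
  exact Submodule.starProjection_apply_mem _ x

theorem finRank_starProjection (U : Submodule ℝ E) [FiniteDimensional ℝ U] :
    FinRank U.starProjection :=
  FinRank.of_mem U fun x => Submodule.starProjection_apply_mem _ x

theorem starProjection_comm_of_mem (U : Submodule ℝ E) [U.HasOrthogonalProjection] {A : E →L[ℝ] E}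
    (h : ∀ u ∈ U, A u ∈ U) (h' : ∀ u ∈ Uᗮ, A u ∈ Uᗮ) (v : E) :
    U.starProjection (A v) = A (U.starProjection v) := by
  refine Submodule.eq_starProjection_of_mem_orthogonal
    (h _ (Submodule.starProjection_apply_mem _ v)) ?_
  rw [← map_sub]
  exact h' _ (Submodule.sub_starProjection_mem_orthogonal v)

/-- On the kernel of T the operator V T - 1 is -1, so the kernel lies in its range. -/
theorem finiteDimensional_ker_of_finRank {T V : E →L[ℝ] E} (h : FinRank (V * T - 1)) :
    FiniteDimensional ℝ T.ker := by
  have := h.finiteDimensional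
  refine Submodule.finiteDimensional_of_le (S₂ := (V * T - 1).range) fun v hv => ⟨-v, ?_⟩
  have hv' : T v = 0 := hv
  change V (T (-v)) - -v = v
  rw [map_neg, hv']
  simp

/-- A left invertible operator up to finite rank is bounded below on every closed subspace on
which it is injective. -/
theorem exists_lower_bound {T V : E →L[ℝ] E} (h : FinRank (V * T - 1)) (Y : Submodule ℝ E)
    [CompleteSpace Y] (hY : ∀ v ∈ Y, T v = 0 → v = 0) :
    ∃ c > 0, ∀ v ∈ Y, c * ‖v‖ ≤ ‖T v‖ := by
  set F := V * T - 1 with hF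
  let u : Y →L[ℝ] E := T ∘L Y.subtypeL
  have hui : Function.Injective u := by
    rw [injective_iff_map_eq_zero]
    intro v hv
    exact Subtype.ext (hY v v.2 hv)
  have hFY : FinRank (F ∘L Y.subtypeL) := h.comp_right _
  -- On the finite-codimensional subspace A of Y one has V T = 1, so T is bounded below there and
  -- has closed range. Closedness passes from A to Y, and with injectivity it gives the bound.
  let A : Submodule ℝ Y := (F ∘L Y.subtypeL).ker
  have hA : IsClosed (A : Set Y) := (F ∘L Y.subtypeL).isClosed_ker
  have : A.CoFG := LinearMap.HasFiniteRange.cofg_ker hFY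
  have hAbound : AntilipschitzWith (‖V‖₊) (u.domRestrict A) := by
    refine AddMonoidHomClass.antilipschitz_of_bound _ fun v => ?_
    have hv : F (v : Y) = 0 := v.2
    have h1 : V (T (v : Y)) = (v : Y) := by
      rw [hF] at hv
      exact sub_eq_zero.1 hv
    change ‖((v : Y) : E)‖ ≤ ‖V‖ * ‖T (v : Y)‖
    conv_lhs => rw [← h1]
    exact V.le_opNorm _
  have hres := (u.isStrictMap_isClosed_range_iff_restrict A hA).2
    ⟨(hAbound.isClosedEmbedding (u.domRestrict A).uniformContinuous).isEmbedding.isStrictMap,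
      (hAbound.isClosedEmbedding (u.domRestrict A).uniformContinuous).isClosed_range⟩
  obtain ⟨K, hK⟩ := u.antilipschitz_of_injective_of_isClosed_range hui hres.2
  refine ⟨(K + 1 : ℝ)⁻¹, by positivity, fun v hv => ?_⟩
  have h1 := hK.le_mul_norm (map_zero u) (⟨v, hv⟩ : Y)
  have h2 : ‖v‖ ≤ K * ‖T v‖ := h1
  rw [inv_mul_le_iff₀ (by positivity)]
  nlinarith [norm_nonneg (T v)]

/-- The bound gives injectivity and closed range; by skewness the orthogonal complement of the range
lies in the kernel, so the range is dense. -/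
theorem IsSkewAdjointOp.isUnit_of_lower_bound {G : E →L[ℝ] E} (hG : IsSkewAdjointOp G) {c : ℝ}
    (hc : 0 < c) (h : ∀ v, c * ‖v‖ ≤ ‖G v‖) : IsUnit G := by
  rw [ContinuousLinearMap.isUnit_iff_bijective,
    ContinuousLinearMap.bijective_iff_dense_range_and_antilipschitz]
  constructor
  · rw [Submodule.topologicalClosure_eq_top_iff, Submodule.eq_bot_iff]
    intro v hv
    rw [Submodule.mem_orthogonal'] at hv
    have h1 : G v = 0 := by
      rw [← inner_self_eq_zero (𝕜 := ℝ), hG.inner_left,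
        show inner ℝ v (G (G v)) = 0 from hv _ (LinearMap.mem_range_self _ _), neg_zero]
    have h2 := h v
    rw [h1, norm_zero] at h2
    exact norm_le_zero_iff.1 (nonpos_of_mul_nonpos_right h2 hc)
  · refine ⟨⟨c⁻¹, by positivity⟩, AddMonoidHomClass.antilipschitz_of_bound _ fun v => ?_⟩
    change ‖v‖ ≤ c⁻¹ * ‖G v‖
    rw [le_inv_mul_iff₀ hc]
    exact h v

end FredholmEstimates

/-! ### Odd and even operators for the grading -/

section Grading

variable {H : Type*} [NormedAddCommGroup H] [InnerProductSpace ℝ H] [CompleteSpace H]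

variable (H) in
/-- The inclusion of the second summand. -/
def inclSnd : H →L[ℝ] WithLp 2 (H × H) :=
  (WithLp.prodContinuousLinearEquiv 2 ℝ H H).symm.toContinuousLinearMap ∘L
    ContinuousLinearMap.inr ℝ H H

variable (H) in
/-- The inclusion of the first summand. -/
def inclFst : H →L[ℝ] WithLp 2 (H × H) :=
  (WithLp.prodContinuousLinearEquiv 2 ℝ H H).symm.toContinuousLinearMap ∘L
    ContinuousLinearMap.inl ℝ H H

variable (H) in
/-- The projection to the first summand. -/
def projFst : WithLp 2 (H × H) →L[ℝ] H :=
  ContinuousLinearMap.fst ℝ H H ∘L (WithLp.prodContinuousLinearEquiv 2 ℝ H H).toContinuousLinearMap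

variable (H) in
/-- The projection to the second summand. -/
def projSnd : WithLp 2 (H × H) →L[ℝ] H :=
  ContinuousLinearMap.snd ℝ H H ∘L (WithLp.prodContinuousLinearEquiv 2 ℝ H H).toContinuousLinearMap

@[simp] theorem inclSnd_fst (y : H) : (inclSnd H y).fst = 0 := rfl
@[simp] theorem inclSnd_snd (y : H) : (inclSnd H y).snd = y := rfl
@[simp] theorem inclFst_fst (y : H) : (inclFst H y).fst = y := rfl
@[simp] theorem inclFst_snd (y : H) : (inclFst H y).snd = 0 := rfl
@[simp] theorem projFst_apply (v : WithLp 2 (H × H)) : projFst H v = v.fst := rfl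
@[simp] theorem projSnd_apply (v : WithLp 2 (H × H)) : projSnd H v = v.snd := rfl
@[simp] theorem grading_fst (v : WithLp 2 (H × H)) : (grading H v).fst = v.fst := rfl
@[simp] theorem grading_snd (v : WithLp 2 (H × H)) : (grading H v).snd = -v.snd := rfl
@[simp] theorem chiralOp_fst (B : H →L[ℝ] H) (v : WithLp 2 (H × H)) :
    (chiralOp B v).fst = B v.snd := rfl
@[simp] theorem chiralOp_snd (B : H →L[ℝ] H) (v : WithLp 2 (H × H)) :
    (chiralOp B v).snd = -(ContinuousLinearMap.adjoint B v.fst) := rfl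

theorem doubled_ext {v w : WithLp 2 (H × H)} (h1 : v.fst = w.fst) (h2 : v.snd = w.snd) : v = w := by
  apply (WithLp.prodContinuousLinearEquiv 2 ℝ H H).injective
  exact Prod.ext h1 h2

theorem inclFst_add_inclSnd (v : WithLp 2 (H × H)) : inclFst H v.fst + inclSnd H v.snd = v :=
  doubled_ext (by simp) (by simp)

@[simp] theorem grading_grading (v : WithLp 2 (H × H)) : grading H (grading H v) = v :=
  doubled_ext (by simp) (by simp)

@[simp] theorem grading_inclFst (x : H) : grading H (inclFst H x) = inclFst H x :=
  doubled_ext (by simp) (by simp)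

@[simp] theorem grading_inclSnd (x : H) : grading H (inclSnd H x) = -inclSnd H x :=
  doubled_ext (by simp) (by simp)

theorem grading_inner (v w : WithLp 2 (H × H)) :
    inner ℝ (grading H v) w = inner ℝ v (grading H w) := by
  simp [WithLp.prod_inner_apply]

theorem grading_mem_orthogonal {U : Submodule ℝ (WithLp 2 (H × H))} 
    (hU : ∀ u ∈ U, grading H u ∈ U) {v : WithLp 2 (H × H)} (hv : v ∈ Uᗮ) : grading H v ∈ Uᗮ := by
  rw [Submodule.mem_orthogonal'] at hv ⊢
  intro u hu
  rw [grading_inner, hv _ (hU u hu)]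

/-- Operators which anticommute with the grading. -/
def IsOddOp (X : WithLp 2 (H × H) →L[ℝ] WithLp 2 (H × H)) : Prop :=
  ∀ v, grading H (X v) = -X (grading H v)

/-- Operators which commute with the grading. -/
def IsEvenOp (X : WithLp 2 (H × H) →L[ℝ] WithLp 2 (H × H)) : Prop :=
  ∀ v, grading H (X v) = X (grading H v)

theorem eq_zero_of_eq_neg {x : H} (h : x = -x) : x = 0 := by
  have h2 : (2 : ℝ) • x = 0 := by
    rw [two_smul]
    nth_rewrite 1 [h]
    exact neg_add_cancel x
  exact (smul_eq_zero.1 h2).resolve_left two_ne_zero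

namespace IsOddOp

variable {X Y : WithLp 2 (H × H) →L[ℝ] WithLp 2 (H × H)}

theorem add (hX : IsOddOp X) (hY : IsOddOp Y) : IsOddOp (X + Y) := fun v => by
  simp only [add_apply, map_add, hX v, hY v]; abel

theorem mul_even (hX : IsOddOp X) (hY : IsEvenOp Y) : IsOddOp (X * Y) := fun v => by
  rw [mul_apply_eq_comp, mul_apply_eq_comp, hX, hY v]

theorem even_mul (hX : IsOddOp X) (hY : IsEvenOp Y) : IsOddOp (Y * X) := fun v => by
  rw [mul_apply_eq_comp, mul_apply_eq_comp, hY, hX, map_neg]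

theorem inclSnd_fst (hX : IsOddOp X) (y : H) : (X (inclSnd H y)).snd = 0 := by
  have := congrArg (fun v : WithLp 2 (H × H) => v.snd) (hX (inclSnd H y))
  simp only [grading_snd, grading_inclSnd, map_neg, neg_neg] at this
  exact eq_zero_of_eq_neg this.symm

theorem inclFst_snd (hX : IsOddOp X) (y : H) : (X (inclFst H y)).fst = 0 := by
  have := congrArg (fun v : WithLp 2 (H × H) => v.fst) (hX (inclFst H y))
  simp only [grading_fst, grading_inclFst, WithLp.neg_fst] at this
  exact eq_zero_of_eq_neg this

end IsOddOp

namespace IsEvenOp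

variable {X Y : WithLp 2 (H × H) →L[ℝ] WithLp 2 (H × H)}

theorem one : IsEvenOp (1 : WithLp 2 (H × H) →L[ℝ] WithLp 2 (H × H)) := fun _ => rfl

theorem sub (hX : IsEvenOp X) (hY : IsEvenOp Y) : IsEvenOp (X - Y) := fun v => by
  simp only [sub_apply, map_sub, hX v, hY v]

theorem mul (hX : IsEvenOp X) (hY : IsEvenOp Y) : IsEvenOp (X * Y) := fun v => by
  rw [mul_apply_eq_comp, mul_apply_eq_comp, hX, hY]

end IsEvenOp

theorem isEvenOp_starProjection (U : Submodule ℝ (WithLp 2 (H × H))) [U.HasOrthogonalProjection]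
    (hU : ∀ u ∈ U, grading H u ∈ U) : IsEvenOp U.starProjection := fun v =>
  (starProjection_comm_of_mem U hU (fun _ => grading_mem_orthogonal hU) v).symm

/-- The upper right block of an operator on `H ⊕ H`. -/
def upperRight (X : WithLp 2 (H × H) →L[ℝ] WithLp 2 (H × H)) : H →L[ℝ] H :=
  projFst H ∘L X ∘L inclSnd H

@[simp] theorem upperRight_apply (X : WithLp 2 (H × H) →L[ℝ] WithLp 2 (H × H)) (y : H) :
    upperRight X y = (X (inclSnd H y)).fst := rfl

theorem upperRight_add (X Y : WithLp 2 (H × H) →L[ℝ] WithLp 2 (H × H)) :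
    upperRight (X + Y) = upperRight X + upperRight Y := by
  ext y; simp

theorem upperRight_sub (X Y : WithLp 2 (H × H) →L[ℝ] WithLp 2 (H × H)) :
    upperRight (X - Y) = upperRight X - upperRight Y := by
  ext y; simp

theorem upperRight_smul (c : ℝ) (X : WithLp 2 (H × H) →L[ℝ] WithLp 2 (H × H)) :
    upperRight (c • X) = c • upperRight X := by
  ext y; simp

theorem upperRight_chiralOp (B : H →L[ℝ] H) : upperRight (chiralOp B) = B := by
  ext y; simp

theorem norm_inclSnd (y : H) : ‖inclSnd H y‖ = ‖y‖ := by
  rw [← sq_eq_sq₀ (norm_nonneg _) (norm_nonneg _), WithLp.prod_norm_sq_eq_of_L2]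
  simp

theorem norm_fst_le_norm (v : WithLp 2 (H × H)) : ‖v.fst‖ ≤ ‖v‖ := by
  rw [← sq_le_sq₀ (norm_nonneg _) (norm_nonneg _), WithLp.prod_norm_sq_eq_of_L2]
  nlinarith [norm_nonneg v.snd]

theorem norm_upperRight_le (X : WithLp 2 (H × H) →L[ℝ] WithLp 2 (H × H)) :
    ‖upperRight X‖ ≤ ‖X‖ := by
  refine ContinuousLinearMap.opNorm_le_bound _ (norm_nonneg X) fun y => ?_
  rw [← norm_inclSnd y]
  exact (norm_fst_le_norm _).trans (X.le_opNorm _)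

theorem continuous_upperRight :
    Continuous (upperRight : (WithLp 2 (H × H) →L[ℝ] WithLp 2 (H × H)) → (H →L[ℝ] H)) :=
  continuous_const.clm_comp (continuous_id.clm_comp continuous_const)

theorem FinRank.upperRight {X : WithLp 2 (H × H) →L[ℝ] WithLp 2 (H × H)} (hX : FinRank X) :
    FinRank (upperRight X) :=
  (hX.comp_right _).comp_left _

theorem IsOddOp.apply_inclSnd {X : WithLp 2 (H × H) →L[ℝ] WithLp 2 (H × H)}
    (hX : IsOddOp X) (y : H) :
    X (inclSnd H y) = inclFst H (upperRight X y) :=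
  doubled_ext (by simp) (by simp [hX.inclSnd_fst y])

theorem IsOddOp.fst_apply {X : WithLp 2 (H × H) →L[ℝ] WithLp 2 (H × H)}
    (hX : IsOddOp X) (v : WithLp 2 (H × H)) :
    (X v).fst = upperRight X v.snd := by
  conv_lhs => rw [← inclFst_add_inclSnd v]
  simp [hX.inclFst_snd]

/-- An odd operator interchanges the summands, so its bijectivity passes to the off-diagonal blocks.
-/
theorem IsOddOp.isUnit_upperRight {X : WithLp 2 (H × H) →L[ℝ] WithLp 2 (H × H)}
    (hX : IsOddOp X) (hu : IsUnit X) :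
    IsUnit (upperRight X) := by
  rw [ContinuousLinearMap.isUnit_iff_bijective] at hu ⊢
  constructor
  · rw [injective_iff_map_eq_zero]
    intro y hy
    have : X (inclSnd H y) = X 0 := by rw [hX.apply_inclSnd, hy, map_zero, map_zero]
    exact congrArg (fun v : WithLp 2 (H × H) => v.snd) (hu.1 this)
  · intro x
    obtain ⟨v, hv⟩ := hu.2 (inclFst H x)
    exact ⟨v.snd, by rw [← hX.fst_apply, hv, inclFst_fst]⟩

theorem isOddOp_chiralOp (B : H →L[ℝ] H) : IsOddOp (chiralOp B) := fun v =>
  doubled_ext (by simp) (by simp)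

theorem isSkewAdjointOp_chiralOp (B : H →L[ℝ] H) : IsSkewAdjointOp (chiralOp B) :=
  isSkewAdjointOp_of_inner fun x y => by
    simp [WithLp.prod_inner_apply, ContinuousLinearMap.adjoint_inner_left,
      ContinuousLinearMap.adjoint_inner_right]

theorem continuous_chiralOp :
    Continuous (chiralOp : (H →L[ℝ] H) → (WithLp 2 (H × H) →L[ℝ] WithLp 2 (H × H))) := by
  have : (chiralOp : (H →L[ℝ] H) → (WithLp 2 (H × H) →L[ℝ] WithLp 2 (H × H))) = fun B =>
      inclFst H ∘L B ∘L projSnd H - inclSnd H ∘L ContinuousLinearMap.adjoint B ∘L projFst H := by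
    funext B
    ext v
    refine doubled_ext ?_ ?_ <;> simp
  rw [this]
  exact (continuous_const.clm_comp (continuous_id.clm_comp continuous_const)).sub
    (continuous_const.clm_comp
      ((ContinuousLinearMap.adjoint.continuous).clm_comp continuous_const))

/-- A parametrix V of B yields the parametrix (0, -V*; V, 0) of T: the diagonal blocks of the defect
are (B V - 1)* and V B - 1. -/
theorem exists_finRank_mul_chiralOp_sub_one {B : H →L[ℝ] H} (hB : B.IsFredholm) :
    ∃ V : WithLp 2 (H × H) →L[ℝ] WithLp 2 (H × H), FinRank (V * chiralOp B - 1) := by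
  obtain ⟨V, hV1, hV2⟩ := hB.exists_isQuasiInverse
  have h1 : FinRank (V ∘L B - 1) := LinearMap.FiniteRangeSetoid.equiv_iff_hasFiniteRange.1 hV1
  have h2 : FinRank (B ∘L V - 1) := LinearMap.FiniteRangeSetoid.equiv_iff_hasFiniteRange.1 hV2
  have h3 := h2.adjoint
  refine ⟨offDiagonal (-ContinuousLinearMap.adjoint V) V, ?_⟩
  have : offDiagonal (-ContinuousLinearMap.adjoint V) V * chiralOp B - 1 =
      inclFst H ∘L (ContinuousLinearMap.adjoint (B ∘L V - 1)) ∘L projFst H +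
        inclSnd H ∘L (V ∘L B - 1) ∘L projSnd H := by
    ext v
    refine doubled_ext ?_ ?_
    · have e : (offDiagonal (-ContinuousLinearMap.adjoint V) V (chiralOp B v)).fst =
        ContinuousLinearMap.adjoint V (ContinuousLinearMap.adjoint B v.fst) := by
        change (-ContinuousLinearMap.adjoint V) (-(ContinuousLinearMap.adjoint B v.fst)) = _
        simp
      have e1 : ContinuousLinearMap.adjoint (1 : H →L[ℝ] H) = 1 := star_one _
      simp [e, e1, ContinuousLinearMap.adjoint_comp]
    · have e : (offDiagonal (-ContinuousLinearMap.adjoint V) V (chiralOp B v)).snd =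
        V (B v.snd) := rfl
      simp [e]
  rw [this]
  exact ((h3.comp_right _).comp_left _).add ((h1.comp_right _).comp_left _)

end Grading

/-! ### Complex structures completing a phase -/

section Polar

variable {E : Type*} [NormedAddCommGroup E] [InnerProductSpace ℝ E] [CompleteSpace E]
  {T I P : E →L[ℝ] E}

/-- A polar decomposition `T = I P` of a skew-adjoint operator, where `I` is a complex structure
and `P` is positive. -/
structure IsPolarPair (T I P : E →L[ℝ] E) : Prop where
  skew : IsSkewAdjointOp T
  skew_phase : IsSkewAdjointOp I
  mul_self : I * I = -1
  pos : P.IsPositive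
  mul_eq : I * P = T

/-- The operator `T + I Q`, where `Q` is the projection onto the kernel of `T`. -/
noncomputable def fillKernel (T I : E →L[ℝ] E) : E →L[ℝ] E := T + I * T.ker.starProjection

namespace IsPolarPair

theorem apply_apply (h : IsPolarPair T I P) (v : E) : I (I v) = -v :=
  congrArg (fun f : E →L[ℝ] E => f v) h.mul_self

theorem inner_apply (h : IsPolarPair T I P) (v w : E) : inner ℝ (I v) (I w) = inner ℝ v w := by
  rw [h.skew_phase.inner_left, h.apply_apply, inner_neg_right, neg_neg]

theorem norm_apply (h : IsPolarPair T I P) (v : E) : ‖I v‖ = ‖v‖ := by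
  rw [← sq_eq_sq₀ (norm_nonneg _) (norm_nonneg _), ← real_inner_self_eq_norm_sq,
    ← real_inner_self_eq_norm_sq, h.inner_apply]

theorem norm_mul (h : IsPolarPair T I P) (X : E →L[ℝ] E) : ‖I * X‖ ≤ ‖X‖ :=
  ContinuousLinearMap.opNorm_le_bound _ (norm_nonneg X) fun v => by
    rw [mul_apply_eq_comp, h.norm_apply]
    exact X.le_opNorm v

theorem isUnit_phase (h : IsPolarPair T I P) : IsUnit I :=
  h.skew_phase.isUnit_of_lower_bound one_pos fun v => by rw [one_mul, h.norm_apply]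

theorem apply_eq (h : IsPolarPair T I P) (v : E) : I (P v) = T v :=
  congrArg (fun f : E →L[ℝ] E => f v) h.mul_eq

theorem modulus_apply (h : IsPolarPair T I P) (v : E) : P v = -I (T v) := by
  rw [← h.apply_eq, h.apply_apply, neg_neg]

theorem inner_modulus (h : IsPolarPair T I P) (v w : E) :
    inner ℝ (P v) w = inner ℝ v (P w) := h.pos.isSymmetric v w

/-- The adjoint of I P = T. Consequently I commutes with P and with T. -/
theorem modulus_mul (h : IsPolarPair T I P) : P * I = T := by
  ext1 v
  refine ext_inner_right ℝ fun w => ?_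
  rw [mul_apply_eq_comp, h.inner_modulus, h.skew_phase.inner_left, h.apply_eq, h.skew.inner_left]

theorem modulus_apply_apply (h : IsPolarPair T I P) (v : E) : P (I v) = T v :=
  congrArg (fun f : E →L[ℝ] E => f v) h.modulus_mul

theorem apply_comm (h : IsPolarPair T I P) (v : E) : T (I v) = I (T v) := by
  rw [← h.apply_eq (I v), h.modulus_apply_apply]

theorem modulus_eq_zero_iff (h : IsPolarPair T I P) {v : E} :
    P v = 0 ↔ T v = 0 := by
  constructor
  · intro h1
    rw [← h.apply_eq, h1, map_zero]
  · intro h1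
    rw [h.modulus_apply, h1, map_zero, neg_zero]

theorem apply_mem_ker (h : IsPolarPair T I P) {v : E} (hv : v ∈ T.ker) :
    I v ∈ T.ker := by
  have hv' : T v = 0 := hv
  change T (I v) = 0
  rw [h.apply_comm, hv', map_zero]

theorem starProjection_apply (h : IsPolarPair T I P) (v : E) :
    T.ker.starProjection (T v) = 0 := by
  rw [Submodule.starProjection_apply_eq_zero_iff, Submodule.mem_orthogonal']
  intro u hu
  have hu' : T u = 0 := hu
  rw [h.skew.inner_left, hu', inner_zero_right, neg_zero]

theorem starProjection_comm (h : IsPolarPair T I P) (v : E) :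
    T.ker.starProjection (I v) = I (T.ker.starProjection v) :=
  starProjection_comm_of_mem _ (fun _ => h.apply_mem_ker)
    (fun _ => h.skew_phase.mem_orthogonal fun _ => h.apply_mem_ker) v

theorem fillKernel_eq (h : IsPolarPair T I P) :
    fillKernel T I = I * (P + T.ker.starProjection) := by
  rw [fillKernel, mul_add, h.mul_eq]

theorem skew_mul_starProjection (h : IsPolarPair T I P) :
    IsSkewAdjointOp (I * T.ker.starProjection) :=
  isSkewAdjointOp_of_inner fun x y => by
    rw [mul_apply_eq_comp, mul_apply_eq_comp, h.skew_phase.inner_left,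
      Submodule.inner_starProjection_left_eq_right, h.starProjection_comm]

theorem skew_fillKernel (h : IsPolarPair T I P) : IsSkewAdjointOp (fillKernel T I) :=
  isSkewAdjointOp_of_inner fun x y => by
    rw [fillKernel, add_apply, add_apply, inner_add_left, inner_add_right, h.skew.inner_left,
      h.skew_mul_starProjection.inner_left, neg_add]

/-- T maps into the orthogonal complement of its kernel and I preserves the kernel, so the two
summands of `fillKernel T I v` vanish separately. -/
theorem fillKernel_injective (h : IsPolarPair T I P) {v : E}
    (hv : fillKernel T I v = 0) : v = 0 := by
  have h0 : T v + I (T.ker.starProjection v) = 0 := hv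
  have h1 : T.ker.starProjection v = 0 := by
    have := congrArg T.ker.starProjection h0
    rw [map_add, h.starProjection_apply, zero_add, h.starProjection_comm, map_zero,
      Submodule.starProjection_eq_self_iff.2 (Submodule.starProjection_apply_mem _ _)] at this
    rw [← norm_eq_zero, ← h.norm_apply, this, norm_zero]
  rw [h1, map_zero, add_zero] at h0
  rw [← Submodule.starProjection_eq_self_iff.2 (show v ∈ T.ker from h0), h1]

theorem finRank_fillKernel_sub [FiniteDimensional ℝ T.ker] : FinRank (fillKernel T I - T) := by
  rw [fillKernel, add_sub_cancel_left]
  exact (finRank_starProjection _).mul_left I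

theorem exists_lower_bound_fillKernel (h : IsPolarPair T I P)
    {V : E →L[ℝ] E} (hV : FinRank (V * T - 1)) :
    ∃ c > 0, ∀ v, c * ‖v‖ ≤ ‖fillKernel T I v‖ := by
  have := finiteDimensional_ker_of_finRank hV
  have hV' : FinRank (V * fillKernel T I - 1) := by
    have : V * fillKernel T I - 1 = (V * T - 1) + V * (fillKernel T I - T) := by
      rw [mul_sub]; abel
    rw [this]
    exact hV.add (finRank_fillKernel_sub.mul_left V)
  have : CompleteSpace (⊤ : Submodule ℝ (E)) :=
    (isClosed_univ (X := E)).completeSpace_coe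
  obtain ⟨c, hc, hb⟩ := exists_lower_bound hV' ⊤ fun v _ => h.fillKernel_injective
  exact ⟨c, hc, fun v => hb v trivial⟩

theorem isUnit_fillKernel (h : IsPolarPair T I P)
    {V : E →L[ℝ] E} (hV : FinRank (V * T - 1)) :
    IsUnit (fillKernel T I) := by
  obtain ⟨c, hc, hb⟩ := h.exists_lower_bound_fillKernel hV
  exact h.skew_fillKernel.isUnit_of_lower_bound hc hb

theorem norm_fillKernel_apply (h : IsPolarPair T I P) (v : E) :
    ‖fillKernel T I v‖ = ‖(P + T.ker.starProjection) v‖ := by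
  rw [h.fillKernel_eq, mul_apply_eq_comp, h.norm_apply]

end IsPolarPair

end Polar

/-! ### Polar pairs of odd operators -/

section Phase

variable {H : Type*} [NormedAddCommGroup H] [InnerProductSpace ℝ H] [CompleteSpace H]
  {T I P : WithLp 2 (H × H) →L[ℝ] WithLp 2 (H × H)}

theorem IsChiralComplexStructure.isOddOp (hI : IsChiralComplexStructure I) :
    IsOddOp I := fun v => by
  have := congrArg (fun f : WithLp 2 (H × H) →L[ℝ] WithLp 2 (H × H) => f (grading H v)) hI.chiral
  simpa using this

theorem IsChiralComplexStructure.mul_self (hI : IsChiralComplexStructure I) : I * I = -1 := by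
  have h1 : ContinuousLinearMap.adjoint I * I = 1 := (Unitary.mem_iff.1 hI.unitary).1
  have h2 : ContinuousLinearMap.adjoint I = -I := hI.skew
  rw [h2, neg_mul] at h1
  rw [← h1, neg_neg]

theorem CompletesPhase.exists_isPolarPair {B : H →L[ℝ] H} (h : CompletesPhase (chiralOp B) I) :
    ∃ P, IsPolarPair (chiralOp B) I P := by
  obtain ⟨h1, P, h2, h3⟩ := h
  exact ⟨P, isSkewAdjointOp_chiralOp B, h1.skew, h1.mul_self, h2.1, h3⟩

namespace IsPolarPair

theorem grading_mem_ker (hT : IsOddOp T) {v : WithLp 2 (H × H)} (hv : v ∈ T.ker) :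
    grading H v ∈ T.ker := by
  have hv' : T v = 0 := hv
  change T (grading H v) = 0
  rw [← neg_eq_zero, ← hT, hv', map_zero]

theorem even_starProjection (hT : IsOddOp T) : IsEvenOp T.ker.starProjection :=
  isEvenOp_starProjection _ fun _ => grading_mem_ker hT

theorem odd_fillKernel (hT : IsOddOp T) (hI : IsOddOp I) : IsOddOp (fillKernel T I) :=
  hT.add (hI.mul_even (even_starProjection hT))

end IsPolarPair

end Phase

/-! ### Continuity of the phase up to finite rank operators -/

section Essential

variable {E : Type*} [NormedAddCommGroup E] [InnerProductSpace ℝ E] [CompleteSpace E]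

/-- X² ≤ M X, from positivity of X tested on v - M⁻¹ X v. -/
theorem ContinuousLinearMap.IsPositive.norm_apply_sq_le {X : E →L[ℝ] E} (hX : X.IsPositive) {M : ℝ}
    (hM : 0 < M) (hXM : ‖X‖ ≤ M) (v : E) : ‖X v‖ ^ 2 ≤ M * inner ℝ (X v) v := by
  have h1 := hX.inner_nonneg_left (v - M⁻¹ • X v)
  have h2 : inner ℝ (X (X v)) (X v) ≤ M * ‖X v‖ ^ 2 := by
    refine (real_inner_le_norm _ _).trans ?_
    have := (X.le_opNorm (X v)).trans (mul_le_mul_of_nonneg_right hXM (norm_nonneg _))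
    nlinarith [norm_nonneg (X v)]
  have h3 : inner ℝ (X (X v)) v = ‖X v‖ ^ 2 := by
    rw [hX.inner_left_eq_inner_right, real_inner_self_eq_norm_sq]
  simp only [map_sub, map_smul, inner_sub_left, inner_sub_right, inner_smul_left, inner_smul_right,
    conj_trivial, h3, real_inner_self_eq_norm_sq] at h1
  have h4 : M⁻¹ * (M⁻¹ * inner ℝ (X (X v)) (X v)) ≤ M⁻¹ * ‖X v‖ ^ 2 := by
    refine mul_le_mul_of_nonneg_left ?_ (by positivity)
    rw [inv_mul_le_iff₀ hM]
    exact h2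
  have h5 : M⁻¹ * ‖X v‖ ^ 2 ≤ inner ℝ (X v) v := by linarith
  rwa [inv_mul_le_iff₀ hM] at h5

/-- By X² ≤ M X, the squared norm of (v - M⁻¹ X v) / 2 is at most ‖v‖² / 4 - ‖X v‖² / (4 M²). The
point is that the bound is strictly below 1/2 as soon as c > 0. -/
theorem norm_half_sub_le {X : E →L[ℝ] E} (hX : X.IsPositive) {M c : ℝ} (hM : 0 < M)
    (hXM : ‖X‖ ≤ M) (hc : 0 ≤ c) (hcX : ∀ v, c * ‖v‖ ≤ ‖X v‖) :
    ‖(1 / 2 : ℝ) • (1 : E →L[ℝ] E) - (1 / (2 * M)) • X‖ ≤ √(1 / 4 - c ^ 2 / (4 * M ^ 2)) := by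
  refine ContinuousLinearMap.opNorm_le_bound _ (Real.sqrt_nonneg _) fun v => ?_
  have h1 := hX.norm_apply_sq_le hM hXM v
  have h2 : c ^ 2 * ‖v‖ ^ 2 ≤ ‖X v‖ ^ 2 := by
    rw [← mul_pow]
    exact pow_le_pow_left₀ (by positivity) (hcX v) 2
  have h3 : ‖((1 / 2 : ℝ) • (1 : E →L[ℝ] E) - (1 / (2 * M)) • X) v‖ ^ 2 ≤
      (1 / 4 - c ^ 2 / (4 * M ^ 2)) * ‖v‖ ^ 2 := by
    have e : ((1 / 2 : ℝ) • (1 : E →L[ℝ] E) - (1 / (2 * M)) • X) v =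
        (1 / 2 : ℝ) • v - (1 / (2 * M)) • X v := rfl
    rw [e, norm_sub_sq_real, norm_smul, norm_smul, inner_smul_left, inner_smul_right, mul_pow,
      mul_pow, Real.norm_eq_abs, Real.norm_eq_abs, sq_abs, sq_abs, real_inner_comm]
    simp only [conj_trivial]
    have h4 : ‖X v‖ ^ 2 / (2 * M ^ 2) ≤ inner ℝ (X v) v / (2 * M) := by
      rw [div_le_div_iff₀ (by positivity) (by positivity)]
      nlinarith
    have h5 : c ^ 2 * ‖v‖ ^ 2 / (4 * M ^ 2) ≤ ‖X v‖ ^ 2 / (4 * M ^ 2) :=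
      div_le_div_of_nonneg_right h2 (by positivity)
    have h6 : (1 / (2 * M)) ^ 2 * ‖X v‖ ^ 2 = ‖X v‖ ^ 2 / (2 * M ^ 2) - ‖X v‖ ^ 2 / (4 * M ^ 2) := by
      field_simp; ring
    have h7 : 2 * (1 / 2 * (1 / (2 * M) * inner ℝ (X v) v)) = inner ℝ (X v) v / (2 * M) := by
      field_simp
    have h8 : (1 / 4 - c ^ 2 / (4 * M ^ 2)) * ‖v‖ ^ 2 =
        1 / 4 * ‖v‖ ^ 2 - c ^ 2 * ‖v‖ ^ 2 / (4 * M ^ 2) := by ring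
    rw [h6, h7, h8]
    linarith
  have h4 := Real.sqrt_le_sqrt h3
  rwa [Real.sqrt_sq (norm_nonneg _), Real.sqrt_mul' _ (sq_nonneg _),
    Real.sqrt_sq (norm_nonneg _)] at h4

/-- A quantitative Sylvester equation: if `X D + D Y` is small up to finite rank and `X`, `Y` are
positive with `X` bounded below, then `D` is small up to finite rank. -/
theorem exists_finRank_norm_sub_lt {M c ε : ℝ} (hM : 0 < M) (hc : 0 < c) (hε : 0 < ε) :
    ∃ η > 0, ∀ X Y D S F : E →L[ℝ] E, X.IsPositive → Y.IsPositive → ‖X‖ ≤ M → ‖Y‖ ≤ M →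
      (∀ v, c * ‖v‖ ≤ ‖X v‖) → X * D + D * Y = S + F → FinRank F → ‖S‖ < η →
      ∃ F', FinRank F' ∧ ‖D - F'‖ < ε := by
  set κ := √(1 / 4 - c ^ 2 / (4 * M ^ 2)) with hκ
  have hκ2 : κ < 1 / 2 := by
    rw [hκ, Real.sqrt_lt' (by norm_num)]
    have : 0 < c ^ 2 / (4 * M ^ 2) := by positivity
    linarith
  refine ⟨M * (1 / 2 - κ) * ε, mul_pos (mul_pos hM (by linarith)) hε, ?_⟩
  intro X Y D S F hX hY hXM hYM hcX hD hF hS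
  have hA := norm_half_sub_le hX hM hXM hc.le hcX
  have hB := norm_half_sub_le hY hM hYM le_rfl fun v => by simp
  rw [← hκ] at hA
  have h14 : √(1 / 4 - (0 : ℝ) ^ 2 / (4 * M ^ 2)) = 1 / 2 := by
    rw [show (1 / 4 - (0 : ℝ) ^ 2 / (4 * M ^ 2)) = (1 / 2) ^ 2 by ring]
    exact Real.sqrt_sq (by norm_num)
  rw [h14] at hB
  set A := (1 / 2 : ℝ) • (1 : E →L[ℝ] E) - (1 / (2 * M)) • X with hAdef
  set B := (1 / 2 : ℝ) • (1 : E →L[ℝ] E) - (1 / (2 * M)) • Y with hBdef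
  -- The Sylvester equation as a fixed point equation for D, with ‖A‖ ≤ κ < 1/2 and ‖B‖ ≤ 1/2.
  have hDeq : D = A * D + D * B + (1 / (2 * M)) • (S + F) := by
    rw [← hD, hAdef, hBdef]
    simp only [sub_mul, mul_sub, smul_mul_assoc, mul_smul_comm, one_mul, mul_one, smul_add]
    have : (1 / 2 : ℝ) • D + (1 / 2 : ℝ) • D = D := by rw [← add_smul]; norm_num
    nth_rewrite 1 [← this]
    abel
  clear_value A B
  -- q is the distance from D to the finite rank operators. Inserting an almost optimal D - F' into
  -- the fixed point equation gives q ≤ (κ + 1/2) q + ‖S‖ / (2 M) up to an arbitrarily small error,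
  -- the infimum possibly not being attained; the choice of η then forces q < ε.
  let N : Set ℝ := (fun F' => ‖D - F'‖) '' {F' | FinRank F'}
  have hN : N.Nonempty := ⟨_, 0, FinRank.zero, rfl⟩
  have hNb : BddBelow N := ⟨0, by rintro _ ⟨F', _, rfl⟩; exact norm_nonneg _⟩
  set q := sInf N with hq
  have hq0 : 0 ≤ q := le_csInf hN (by rintro _ ⟨F', _, rfl⟩; exact norm_nonneg _)
  have hstep : ∀ r, q < r → q ≤ (κ + 1 / 2) * r + 1 / (2 * M) * ‖S‖ := by
    intro r hr
    obtain ⟨_, ⟨F', hF', rfl⟩, hlt⟩ := exists_lt_of_csInf_lt hN hr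
    have hF'' : FinRank (A * F' + F' * B + (1 / (2 * M)) • F) :=
      ((hF'.mul_left A).add (hF'.mul_right B)).add (hF.smul _)
    refine (csInf_le hNb ⟨_, hF'', rfl⟩).trans ?_
    have e : D - (A * F' + F' * B + (1 / (2 * M)) • F) =
        A * (D - F') + (D - F') * B + (1 / (2 * M)) • S := by
      conv_lhs => rw [hDeq]
      rw [mul_sub, sub_mul, smul_add]
      abel
    simp only [e]
    refine (norm_add_le _ _).trans (add_le_add ((norm_add_le _ _).trans ?_) ?_)
    · have h1 : ‖A * (D - F')‖ ≤ κ * r :=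
        (norm_mul_le _ _).trans (mul_le_mul hA hlt.le (norm_nonneg _) (Real.sqrt_nonneg _))
      have h2 : ‖(D - F') * B‖ ≤ r * (1 / 2) :=
        (norm_mul_le _ _).trans (mul_le_mul hlt.le hB (norm_nonneg _) (hq0.trans hr.le))
      linarith
    · rw [norm_smul, Real.norm_eq_abs, abs_of_pos (by positivity)]
  have hqε : q < ε := by
    by_contra hcon
    push Not at hcon
    have hS' : 1 / (2 * M) * ‖S‖ < (1 / 2 - κ) * ε / 2 := by
      rw [one_div, inv_mul_lt_iff₀ (by positivity)]
      calc ‖S‖ < M * (1 / 2 - κ) * ε := hS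
        _ = _ := by ring
    have hκ0 : 0 ≤ κ := Real.sqrt_nonneg _
    have hpos : 0 < (1 / 2 - κ) * ε := mul_pos (by linarith) hε
    have := hstep (q + (1 / 2 - κ) * ε / 2) (by linarith)
    nlinarith
  obtain ⟨_, ⟨F', hF', rfl⟩, hlt⟩ := exists_lt_of_csInf_lt hN hqε
  exact ⟨F', hF', hlt⟩

theorem FinRank.isCompactOperator {F : E →L[ℝ] E} (hF : FinRank F) : IsCompactOperator F := by
  have := hF.finiteDimensional
  have h1 : IsCompactOperator (_root_.id : F.range → F.range) :=
    (isCompactOperator_id_iff_finiteDimensional (𝕜 := ℝ)).2 this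
  have h2 := (h1.comp_clm (F.codRestrict F.range fun x => LinearMap.mem_range_self _ x)).clm_comp
    F.range.subtypeL
  exact h2

theorem norm_calkinMk_le {X F : E →L[ℝ] E} (hF : FinRank F) : ‖calkinMk X‖ ≤ ‖X - F‖ := by
  have h : calkinMk X = Submodule.Quotient.mk (X - F) := by
    unfold calkinMk
    rw [Submodule.mkQ_apply, Submodule.Quotient.eq, sub_sub_cancel]
    exact hF.isCompactOperator
  rw [h]
  exact Submodule.Quotient.norm_mk_le _ _

end Essential

/-! ### Essential continuity of the phase -/

section EssentialPhase

variable {E : Type*} [NormedAddCommGroup E] [InnerProductSpace ℝ E] [CompleteSpace E]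
  {T I P : E →L[ℝ] E}

namespace IsPolarPair

theorem norm_modulus_le (h : IsPolarPair T I P) : ‖P‖ ≤ ‖T‖ :=
  ContinuousLinearMap.opNorm_le_bound _ (norm_nonneg T) fun v => by
    rw [h.modulus_apply, norm_neg, h.norm_apply]
    exact T.le_opNorm v

theorem isPositive_modulus_add (h : IsPolarPair T I P) :
    (P + T.ker.starProjection).IsPositive :=
  h.pos.add (ContinuousLinearMap.IsPositive.of_isStarProjection
    (isStarProjection_starProjection))

theorem modulus_mul_modulus (h : IsPolarPair T I P) : P * P = -(T * T) := by
  ext1 v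
  change P (P v) = -T (T v)
  rw [← h.modulus_apply_apply (T v), h.modulus_apply v, map_neg]

/-- The phase is continuous up to finite rank operators. -/
theorem exists_finRank_norm_sub_lt {V : E →L[ℝ] E}
    (h : IsPolarPair T I P) (hV : FinRank (V * T - 1)) {ε : ℝ} (hε : 0 < ε) :
    ∃ η > 0, ∀ T' I' P', IsPolarPair T' I' P' → ‖T' - T‖ < η →
      ∃ F, FinRank F ∧ ‖I' - I - F‖ < ε := by
  obtain ⟨c, hc, hcb⟩ := h.exists_lower_bound_fillKernel hV
  have hfin := finiteDimensional_ker_of_finRank hV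
  set Q := T.ker.starProjection with hQdef
  have hQ : FinRank Q := finRank_starProjection _
  obtain ⟨R, hR⟩ : ∃ R, (P + Q) * R = 1 := by
    have h1 := h.isUnit_fillKernel hV
    rw [h.fillKernel_eq] at h1
    obtain ⟨u, hu⟩ := h1
    refine ⟨↑u⁻¹ * I, ?_⟩
    have h2 : I * (P + Q) * ↑u⁻¹ = 1 := by rw [← hu, Units.mul_inv]
    have h3 : (P + Q) * ↑u⁻¹ = -I := by
      have := congrArg (fun X => -(I * X)) h2
      simp only [← mul_assoc, h.mul_self, mul_one] at this
      rw [← this]; noncomm_ring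
    rw [← mul_assoc, h3, neg_mul, h.mul_self, neg_neg]
  set M := ‖P + Q‖ + ‖T‖ + 1 with hMdef
  have hM : 0 < M := by positivity
  set ρ := ‖R‖ + 1 with hρdef
  have hρ : 0 < ρ := by positivity
  obtain ⟨η, hη, hD⟩ := _root_.exists_finRank_norm_sub_lt (E := E) hM hc
    (show 0 < ε / (2 * ρ) by positivity)
  have hη' : 0 < η / (2 * M + 1) := by positivity
  refine ⟨min (min 1 (ε / (2 * ρ))) (η / (2 * M + 1)), by positivity, fun T' I' P' h' hT' => ?_⟩
  obtain ⟨⟨hT1, hT2⟩, hT3⟩ : (‖T' - T‖ < 1 ∧ ‖T' - T‖ < ε / (2 * ρ)) ∧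
    ‖T' - T‖ < η / (2 * M + 1) := by simpa only [lt_min_iff] using hT'
  have hTM : ‖T'‖ ≤ M := by
    have : T' = (T' - T) + T := by abel
    rw [this]
    refine (norm_add_le _ _).trans ?_
    have := norm_nonneg (P + Q)
    linarith
  have hTM0 : ‖T‖ ≤ M := by
    have := norm_nonneg (P + Q)
    linarith
  have hPQ : P * Q = 0 := by
    ext1 v
    exact h.modulus_eq_zero_iff.2 (Submodule.starProjection_apply_mem T.ker v)
  have hQP : Q * P = 0 := by
    ext1 v
    rw [mul_apply_eq_comp, h.modulus_apply, map_neg, h.starProjection_comm,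
      h.starProjection_apply, map_zero, neg_zero]
    rfl
  have hQQ : Q * Q = Q := by
    ext1 v
    exact Submodule.starProjection_eq_self_iff.2 (Submodule.starProjection_apply_mem _ _)
  have hS : ‖T' * T' - T * T‖ < η := by
    have e : T' * T' - T * T = T' * (T' - T) + (T' - T) * T := by noncomm_ring
    rw [e]
    calc _ ≤ ‖T'‖ * ‖T' - T‖ + ‖T' - T‖ * ‖T‖ :=
          (norm_add_le _ _).trans (add_le_add (norm_mul_le _ _) (norm_mul_le _ _))
      _ ≤ (2 * M + 1) * ‖T' - T‖ := by nlinarith [norm_nonneg (T' - T)]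
      _ < η := by rwa [lt_div_iff₀' (by positivity)] at hT3
  -- For D = P + Q - P' one has (P + Q) D + D P' = (P + Q)² - P'² = (T'² - T²) + Q: small plus
  -- finite rank.
  obtain ⟨F', hF', hDF⟩ := hD (P + Q) P' (P + Q - P') (T' * T' - T * T) Q
    h.isPositive_modulus_add h'.pos (by have := norm_nonneg T; linarith)
    (h'.norm_modulus_le.trans hTM) (fun v => by rw [← h.norm_fillKernel_apply]; exact hcb v)
    (by
      have h1 := h.modulus_mul_modulus
      have h2 := h'.modulus_mul_modulus
      calc (P + Q) * (P + Q - P') + (P + Q - P') * P'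
          = P * P + P * Q + Q * P + Q * Q - P' * P' := by noncomm_ring
        _ = _ := by rw [h1, h2, hPQ, hQP, hQQ]; abel) hQ hS
  refine ⟨(I' * F' - I * Q) * R, ((hF'.mul_left _).sub (hQ.mul_left _)).mul_right _, ?_⟩
  -- (I' - I)(P + Q) = I' (P + Q - P') + (T' - T) - I Q, multiplied by R from the right.
  have e : I' - I - (I' * F' - I * Q) * R =
      (I' * (P + Q - P' - F') + (T' - T)) * R := by
    have h1 : (I' - I) = (I' - I) * ((P + Q) * R) := by rw [hR, mul_one]
    rw [h1]
    calc _ = (I' * (P + Q - P' - F') + (I' * P' - I * P)) * R := by noncomm_ring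
      _ = _ := by rw [h.mul_eq, h'.mul_eq]
  rw [e]
  calc _ ≤ ‖I' * (P + Q - P' - F') + (T' - T)‖ * ‖R‖ := norm_mul_le _ _
    _ ≤ (‖P + Q - P' - F'‖ + ‖T' - T‖) * ‖R‖ :=
        mul_le_mul_of_nonneg_right ((norm_add_le _ _).trans
          (add_le_add (h'.norm_mul _) le_rfl)) (norm_nonneg _)
    _ ≤ (ε / (2 * ρ) + ε / (2 * ρ)) * ‖R‖ :=
        mul_le_mul_of_nonneg_right (add_le_add hDF.le hT2.le) (norm_nonneg _)
    _ = ε * (‖R‖ / ρ) := by field_simp; ring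
    _ < ε * 1 := by
        refine mul_lt_mul_of_pos_left ?_ hε
        rw [div_lt_one hρ, hρdef]
        linarith
    _ = ε := mul_one ε

end IsPolarPair

end EssentialPhase

/-! ### The relative sign of orthogonal operators -/

section Orthogonal

variable {E : Type*} [NormedAddCommGroup E] [InnerProductSpace ℝ E] [CompleteSpace E]

/-- The operator is -1 on N and 1 on its complement. -/
theorem relSign_sub_two_smul_starProjection (N : Submodule ℝ E) [FiniteDimensional ℝ N] :
    relSign 1 (1 - (2 : ℝ) • N.starProjection) = (-1) ^ Module.finrank ℝ N := by
  have h : detOneAdd (((1 - (2 : ℝ) • N.starProjection - 1) * Ring.inverse (1 : E →L[ℝ] E) :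
      E →L[ℝ] E) : E →ₗ[ℝ] E) = (-1) ^ Module.finrank ℝ N := by
    rw [Ring.inverse_one, mul_one, sub_sub_cancel_left, detOneAdd_eq N _ (fun x => by
      change -((2 : ℝ) • N.starProjection x) ∈ N
      exact N.neg_mem (N.smul_mem _ (Submodule.starProjection_apply_mem _ _)))]
    have : (1 + LinearMap.codRestrict N ((-((2 : ℝ) • N.starProjection) : E →L[ℝ] E) : E →ₗ[ℝ] E)
        (fun x => by
          change -((2 : ℝ) • N.starProjection x) ∈ N
          exact N.neg_mem (N.smul_mem _ (Submodule.starProjection_apply_mem _ _))) ∘ₗ N.subtype) =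
        (-1 : ℝ) • LinearMap.id := by
      ext x
      change (x : E) + -((2 : ℝ) • N.starProjection x) = (-1 : ℝ) • (x : E)
      rw [Submodule.starProjection_eq_self_iff.2 x.2, two_smul]
      simp
    rw [this, LinearMap.det_smul, LinearMap.det_id, mul_one]
  unfold relSign
  rw [h]
  rcases Nat.even_or_odd (Module.finrank ℝ N) with h1 | h1
  · rw [h1.neg_one_pow, h1.neg_one_pow, signUnit_one]
  · rw [h1.neg_one_pow, h1.neg_one_pow]
    simp [signUnit]

theorem isUnit_add_of_inner {u d : E →L[ℝ] E} (hu : IsUnit u)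
    (hi : ∀ x y, inner ℝ (u x) (u y) = inner ℝ x y) (hd : ‖d‖ < 1) : IsUnit (u + d) := by
  refine isUnit_add_of_norm_lt hu (fun v => ?_) hd
  rw [one_mul, ← sq_le_sq₀ (norm_nonneg _) (norm_nonneg _), ← real_inner_self_eq_norm_sq,
    ← real_inner_self_eq_norm_sq, hi]

/-- For d = 0 this says that the orthogonal operator u⁻¹ u' has determinant (-1)^m, with m the
multiplicity of the eigenvalue -1. Composing u' with the reflection that is -1 on this eigenspace N
removes the eigenvalue, and the resulting w is joined to u by a segment of invertible operators. -/
theorem relSign_of_inner {u u' d : E →L[ℝ] E} (hu : IsUnit u) (hu' : IsUnit u')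
    (hi : ∀ x y, inner ℝ (u x) (u y) = inner ℝ x y)
    (hi' : ∀ x y, inner ℝ (u' x) (u' y) = inner ℝ x y) (hd : ‖d‖ < 1)
    (hF : FinRank (u' - (u + d))) :
    relSign (u + d) u' = (-1) ^ Module.finrank ℝ (u + u').ker := by
  have hnorm : ∀ v, ‖u v‖ = ‖v‖ := fun v => by
    rw [← sq_eq_sq₀ (norm_nonneg _) (norm_nonneg _), ← real_inner_self_eq_norm_sq,
      ← real_inner_self_eq_norm_sq, hi]
  have hfin : FiniteDimensional ℝ (u + u').ker := by
    -- u + u' is a finite rank perturbation of the invertible operator 2 u + d, so its kernel is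
    -- finite-dimensional.
    have h1 : IsUnit ((2 : ℝ) • u + d) := by
      refine isUnit_add_of_norm_lt (c := 2) ?_ (fun v => ?_) (hd.trans one_lt_two)
      · exact hu.smul (Units.mk0 (2 : ℝ) two_ne_zero)
      · rw [smul_apply, norm_smul, hnorm]
        simp
    obtain ⟨w, hw⟩ := h1
    refine finiteDimensional_ker_of_finRank (V := ↑w⁻¹) ?_
    have : (↑w⁻¹ : E →L[ℝ] E) * (u + u') - 1 = ↑w⁻¹ * (u' - (u + d)) := by
      have h2 : u + u' = w + (u' - (u + d)) := by rw [hw, two_smul]; abel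
      rw [h2, mul_add, Units.inv_mul]; abel
    rw [this]
    exact hF.mul_left _
  set N := (u + u').ker with hN
  have hNu : ∀ n ∈ N, u' n = -u n := fun n hn => by
    have : u n + u' n = 0 := hn
    exact eq_neg_of_add_eq_zero_right this
  set Q := N.starProjection with hQ
  have hQN : ∀ v, Q v ∈ N := fun v => Submodule.starProjection_apply_mem _ _
  set ρ : E →L[ℝ] E := 1 - (2 : ℝ) • Q with hρ
  have hQQ : Q * Q = Q := by
    ext1 v
    exact Submodule.starProjection_eq_self_iff.2 (hQN v)
  have hρρ : ρ * ρ = 1 := by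
    have h1 : ρ * ρ = 1 - (2 : ℝ) • Q - (2 : ℝ) • Q + ((2 : ℝ) • Q) * ((2 : ℝ) • Q) := by
      rw [hρ, mul_sub, mul_one, sub_mul, one_mul]; abel
    rw [h1, smul_mul_smul_comm, hQQ]
    module
  have hρu : IsUnit ρ := ⟨⟨ρ, ρ, hρρ, hρρ⟩, rfl⟩
  have hρF : FinRank (ρ - 1) := by
    rw [hρ, sub_sub_cancel_left]
    exact ((finRank_starProjection N).smul 2).neg
  set w := u' * ρ with hw
  have hwu : IsUnit w := hu'.mul hρu
  have hwF : FinRank (w - u') := by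
    have : w - u' = u' * (ρ - 1) := by rw [mul_sub, mul_one]
    rw [this]
    exact hρF.mul_left _
  have hwF' : FinRank (w - (u + d)) := by
    have : w - (u + d) = (w - u') + (u' - (u + d)) := by abel
    rw [this]
    exact hwF.add hF
  have hwv : ∀ v, w v = u' v + (2 : ℝ) • u (Q v) := fun v => by
    change u' (v - (2 : ℝ) • Q v) = _
    rw [map_sub, map_smul, hNu _ (hQN v), smul_neg, sub_neg_eq_add]
  have hwnorm : ∀ v, ‖w v‖ = ‖v‖ := fun v => by
    have h1 : inner ℝ (u' v) (u (Q v)) = -inner ℝ (Q v) (Q v) := by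
      have h2 : u (Q v) = -u' (Q v) := by rw [hNu _ (hQN v), neg_neg]
      rw [h2, inner_neg_right, hi', Submodule.inner_starProjection_left_eq_right,
        Submodule.starProjection_eq_self_iff.2 (hQN v)]
    rw [← sq_eq_sq₀ (norm_nonneg _) (norm_nonneg _), ← real_inner_self_eq_norm_sq, hwv,
      inner_add_left, inner_add_right, inner_add_right, inner_smul_left, inner_smul_right,
      inner_smul_left, inner_smul_right, hi, hi', real_inner_comm (u' v), h1,
      real_inner_self_eq_norm_sq v]
    simp only [conj_trivial]
    ring
  -- On N the operator u + w is 2 u, on the complement it is u + u'; both are injective there and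
  -- their images are orthogonal.
  have hker : ∀ v, u v + w v = 0 → v = 0 := by
    intro v hv
    set m := v - Q v with hm
    have hmN : m ∈ Nᗮ := Submodule.sub_starProjection_mem_orthogonal v
    have h1 : (2 : ℝ) • u (Q v) + (u m + u' m) = 0 := by
      rw [← hv, hwv, hm, map_sub, map_sub, hNu _ (hQN v), two_smul]
      abel_nf
    have h2 : inner ℝ (u (Q v)) (u m + u' m) = 0 := by
      have h3 : u (Q v) = -u' (Q v) := by rw [hNu _ (hQN v), neg_neg]
      rw [inner_add_right, hi]
      conv_lhs => enter [2]; rw [h3, inner_neg_left, hi']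
      rw [add_neg_cancel]
    have h3 : u (Q v) = 0 := by
      have := congrArg (fun x => inner ℝ (u (Q v)) x) h1
      simp only [inner_add_right, inner_smul_right, inner_zero_right] at this
      rw [← inner_add_right, h2, add_zero] at this
      simpa using this
    have h4 : Q v = 0 := by rw [← norm_eq_zero, ← hnorm, h3, norm_zero]
    have h5 : m = v := by rw [hm, h4, sub_zero]
    have h6 : v ∈ N := by
      rw [h3, smul_zero, zero_add, h5] at h1
      exact h1
    rw [← Submodule.starProjection_eq_self_iff.2 h6]
    exact h4
  have hYu : ∀ s ∈ Icc (0 : ℝ) 1, IsUnit (u + s • d) := fun s hs => by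
    refine isUnit_add_of_inner hu hi (lt_of_le_of_lt ?_ hd)
    rw [norm_smul, Real.norm_eq_abs, abs_of_nonneg hs.1]
    exact mul_le_of_le_one_left (norm_nonneg _) hs.2
  have hFs : ∀ s : ℝ, FinRank (((1 - s) • u + s • w) - (u + s • d)) := fun s => by
    have : ((1 - s) • u + s • w) - (u + s • d) = s • (w - (u + d)) := by module
    rw [this]
    exact hwF'.smul s
  have hXu : ∀ s ∈ Icc (0 : ℝ) 1, IsUnit ((1 - s) • u + s • w) := fun s hs => by
    refine isUnit_of_finRank_of_injective (hYu s hs) (hFs s) ?_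
    rw [injective_iff_map_eq_zero]
    intro v hv
    have h1 : (1 - s) • u v + s • w v = 0 := hv
    -- As u and w are isometric, a nonzero null vector forces s = 1/2, which `hker` excludes.
    have h2 : (1 - s) * ‖v‖ = s * ‖v‖ := by
      have h3 := congrArg norm (eq_neg_of_add_eq_zero_left h1)
      rw [norm_neg, norm_smul, norm_smul, hnorm, hwnorm, Real.norm_eq_abs, Real.norm_eq_abs,
        abs_of_nonneg hs.1, abs_of_nonneg (by linarith [hs.2])] at h3
      exact h3
    by_contra hv0
    have h3 : 1 - s = s := mul_right_cancel₀ (norm_ne_zero_iff.2 hv0) h2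
    rw [h3, ← smul_add] at h1
    have hs0 : s ≠ 0 := by intro h; rw [h] at h3; norm_num at h3
    exact hv0 (hker v ((smul_eq_zero.1 h1).resolve_left hs0))
  have hone : relSign (u + d) w = 1 := by
    have := relSign_eq_of_preconnected (S := Icc (0 : ℝ) 1) isPreconnected_Icc
      (X := fun s => u + s • d) (Y := fun s => (1 - s) • u + s • w)
      (by fun_prop) (by fun_prop) hYu hXu (fun s _ => hFs s) (s := 1) (s' := 0) (by simp) (by simp)
    simp only [one_smul, zero_smul, add_zero, sub_self, zero_add, sub_zero] at this
    rw [this, relSign_self]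
  have hud : IsUnit (u + d) := isUnit_add_of_inner hu hi hd
  have hF' : FinRank (u' - w) := by rw [← neg_sub]; exact hwF.neg
  rw [← relSign_mul_relSign hud hwu hu' hwF' hF', hone, one_mul,
    relSign_comm hwu hu' hF', hw]
  have := relSign_mul_left (X := 1) (Y := ρ) (Z := u') isUnit_one hρF hu'
  rw [mul_one] at this
  rw [this, hρ, relSign_sub_two_smul_starProjection]

/-- Adding r (s' - s) to both members of the first pair keeps their difference, hence the finite
rank condition, and moves u₀ + s to u₀ + s'. The bounds 1/2 give ‖s' - s‖ < 1, which keeps u + r (s'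
- s) invertible; `relSign_of_inner` then compares u + (s' - s) with u'. -/
theorem relSign_mul_relSign_of_inner {u₀ u u' s s' : E →L[ℝ] E} (hu₀ : IsUnit u₀) (hu : IsUnit u)
    (hu' : IsUnit u') (hi₀ : ∀ x y, inner ℝ (u₀ x) (u₀ y) = inner ℝ x y)
    (hi : ∀ x y, inner ℝ (u x) (u y) = inner ℝ x y)
    (hi' : ∀ x y, inner ℝ (u' x) (u' y) = inner ℝ x y) (hs : ‖s‖ < 1 / 2) (hs' : ‖s'‖ < 1 / 2)
    (hF : FinRank (u - (u₀ + s))) (hF' : FinRank (u' - (u₀ + s'))) :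
    relSign (u₀ + s) u * relSign (u₀ + s') u' = (-1) ^ Module.finrank ℝ (u + u').ker := by
  have hd : ‖s' - s‖ < 1 := (norm_sub_le _ _).trans_lt (by linarith)
  have hFd : FinRank (u + (s' - s) - (u₀ + s')) := by
    have : u + (s' - s) - (u₀ + s') = u - (u₀ + s) := by abel
    rwa [this]
  have h1 : relSign (u₀ + s) u = relSign (u₀ + s') (u + (s' - s)) := by
    have := relSign_eq_of_preconnected (S := Icc (0 : ℝ) 1) isPreconnected_Icc
      (X := fun r => u₀ + (s + r • (s' - s))) (Y := fun r => u + r • (s' - s))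
      (by fun_prop) (by fun_prop) (fun r hr => isUnit_add_of_inner hu₀ hi₀ ?_)
      (fun r hr => isUnit_add_of_inner hu hi ?_) (fun r _ => ?_) (s := 0) (s' := 1)
      (by simp) (by simp)
    · simpa using this
    · have e : s + r • (s' - s) = (1 - r) • s + r • s' := by module
      rw [e]
      refine (norm_add_le _ _).trans_lt ?_
      rw [norm_smul, norm_smul, Real.norm_eq_abs, Real.norm_eq_abs, abs_of_nonneg hr.1,
        abs_of_nonneg (by linarith [hr.2])]
      nlinarith [norm_nonneg s, norm_nonneg s', hr.1, hr.2]
    · refine lt_of_le_of_lt ?_ hd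
      rw [norm_smul, Real.norm_eq_abs, abs_of_nonneg hr.1]
      exact mul_le_of_le_one_left (norm_nonneg _) hr.2
    · have : u + r • (s' - s) - (u₀ + (s + r • (s' - s))) = u - (u₀ + s) := by abel
      rwa [this]
  have hU1 : IsUnit (u₀ + s') := isUnit_add_of_inner hu₀ hi₀ (by linarith)
  have hU2 : IsUnit (u + (s' - s)) := isUnit_add_of_inner hu hi hd
  have hFF : FinRank (u' - (u + (s' - s))) := by
    have : u' - (u + (s' - s)) = (u' - (u₀ + s')) - (u + (s' - s) - (u₀ + s')) := by abel
    rw [this]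
    exact hF'.sub hFd
  rw [h1, relSign_comm hU1 hU2 hFd, relSign_mul_relSign hU2 hU1 hu'
    (by rw [← neg_sub]; exact hFd.neg) hF', relSign_of_inner hu hu' hi hi' hd hFF]

end Orthogonal

/-! ### The index of a pair of chiral complex structures -/

section Polar

variable {E : Type*} [NormedAddCommGroup E] [InnerProductSpace ℝ E] [CompleteSpace E]
  {T I P : E →L[ℝ] E}

/-- `fillKernel T I` is I A with A positive, so the interpolation is I ((1 - r) A + r). Its cross
term is nonnegative and (1 - r)² + r² ≥ 1/4. -/
theorem IsPolarPair.lower_bound_interpolation (h : IsPolarPair T I P) {c : ℝ} (hc0 : 0 < c)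
    (hc1 : c ≤ 1) (hc : ∀ v, c * ‖v‖ ≤ ‖fillKernel T I v‖) {r : ℝ} (hr : r ∈ Icc (0 : ℝ) 1)
    (v : E) : c / 2 * ‖v‖ ≤ ‖((1 - r) • fillKernel T I + r • I) v‖ := by
  set A := P + T.ker.starProjection with hA
  have e : ((1 - r) • fillKernel T I + r • I) v = I ((1 - r) • A v + r • v) := by
    rw [h.fillKernel_eq, map_add, map_smul, map_smul]
    rfl
  rw [e, h.norm_apply]
  have h1 := hc v
  rw [h.norm_fillKernel_apply, ← hA] at h1
  have h2 := h.isPositive_modulus_add.inner_nonneg_left v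
  rw [← hA] at h2
  rw [← sq_le_sq₀ (by positivity) (norm_nonneg _), norm_add_sq_real, norm_smul, norm_smul,
    inner_smul_left, inner_smul_right, Real.norm_eq_abs, Real.norm_eq_abs, mul_pow, mul_pow,
    mul_pow, sq_abs, sq_abs]
  simp only [conj_trivial]
  have h3 : (c * ‖v‖) ^ 2 ≤ ‖A v‖ ^ 2 := pow_le_pow_left₀ (by positivity) h1 2
  have hr0 := hr.1
  have hr1 : 0 ≤ 1 - r := by linarith [hr.2]
  have h4 : 0 ≤ 2 * ((1 - r) * (r * inner ℝ (A v) v)) := by positivity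
  have h5 : (1 - r) ^ 2 * (c * ‖v‖) ^ 2 ≤ (1 - r) ^ 2 * ‖A v‖ ^ 2 :=
    mul_le_mul_of_nonneg_left h3 (sq_nonneg _)
  have h6 : r ^ 2 * (c * ‖v‖) ^ 2 ≤ r ^ 2 * ‖v‖ ^ 2 := by
    refine mul_le_mul_of_nonneg_left ?_ (sq_nonneg _)
    exact pow_le_pow_left₀ (by positivity) (mul_le_of_le_one_left (norm_nonneg _) hc1) 2
  have h7 : (c / 2) ^ 2 * ‖v‖ ^ 2 ≤ ((1 - r) ^ 2 + r ^ 2) * (c * ‖v‖) ^ 2 := by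
    rw [← mul_pow, show c / 2 * ‖v‖ = 1 / 2 * (c * ‖v‖) by ring, mul_pow]
    refine mul_le_mul_of_nonneg_right ?_ (sq_nonneg _)
    nlinarith [sq_nonneg (1 - 2 * r)]
  linarith

theorem IsPolarPair.skew_interpolation (h : IsPolarPair T I P) (r : ℝ) :
    IsSkewAdjointOp ((1 - r) • fillKernel T I + r • I) :=
  isSkewAdjointOp_of_inner fun x y => by
    simp only [add_apply, smul_apply, inner_add_left, inner_add_right, inner_smul_left,
      inner_smul_right, h.skew_fillKernel.inner_left, h.skew_phase.inner_left, conj_trivial]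
    ring

end Polar

/-! ### The pair index as a product of relative signs -/

section LocalIndex

variable {H : Type*} [NormedAddCommGroup H] [InnerProductSpace ℝ H] [CompleteSpace H]
  {T I P T₀ I₀ P₀ : WithLp 2 (H × H) →L[ℝ] WithLp 2 (H × H)}

theorem IsOddOp.smul (hT : IsOddOp T) (c : ℝ) : IsOddOp (c • T) := fun v => by
  simp only [smul_apply, map_smul, hT v, smul_neg]

theorem norm_inclFst (y : H) : ‖inclFst H y‖ = ‖y‖ := by
  rw [← sq_eq_sq₀ (norm_nonneg _) (norm_nonneg _), WithLp.prod_norm_sq_eq_of_L2]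
  simp

theorem IsOddOp.lower_bound_upperRight (hT : IsOddOp T) {c : ℝ} (hc : ∀ v, c * ‖v‖ ≤ ‖T v‖)
    (y : H) : c * ‖y‖ ≤ ‖upperRight T y‖ := by
  have := hc (inclSnd H y)
  rwa [hT.apply_inclSnd, norm_inclFst, norm_inclSnd] at this

theorem IsOddOp.inner_upperRight (hT : IsOddOp T) (hi : ∀ v w, inner ℝ (T v) (T w) = inner ℝ v w)
    (x y : H) : inner ℝ (upperRight T x) (upperRight T y) = inner ℝ x y := by
  have := hi (inclSnd H x) (inclSnd H y)
  rw [hT.apply_inclSnd, hT.apply_inclSnd] at this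
  simpa [WithLp.prod_inner_apply] using this

/-- Homotopy from filled operators to their phases. The corrections T - T₀ and I - I₀ - F are
interpolated as well: they keep the two paths equal modulo finite rank, and they are small enough
not to destroy invertibility. -/
theorem relSign_upperRight_fillKernel (h₀ : IsPolarPair T₀ I₀ P₀) (h : IsPolarPair T I P)
    (hT₀ : IsOddOp T₀) (hI₀ : IsOddOp I₀) (hT : IsOddOp T) (hI : IsOddOp I)
    {V : WithLp 2 (H × H) →L[ℝ] WithLp 2 (H × H)} (hV : FinRank (V * T - 1))
    [FiniteDimensional ℝ T₀.ker] {c : ℝ} (hc1 : c ≤ 1) (hc0 : 0 < c)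
    (hc : ∀ v, c * ‖v‖ ≤ ‖fillKernel T₀ I₀ v‖) {F : WithLp 2 (H × H) →L[ℝ] WithLp 2 (H × H)}
    (hF : FinRank F) (h1 : ‖upperRight (T - T₀)‖ < c / 2) (h2 : ‖upperRight (I - I₀ - F)‖ < c / 2) :
    relSign (upperRight (fillKernel T₀ I₀) + upperRight (T - T₀)) (upperRight (fillKernel T I)) =
      relSign (upperRight I₀ + upperRight (I - I₀ - F)) (upperRight I) := by
  have := finiteDimensional_ker_of_finRank hV
  obtain ⟨c', hc'0, hc'⟩ := h.exists_lower_bound_fillKernel hV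
  set a := upperRight (T - T₀) with ha
  set s := upperRight (I - I₀ - F) with hs
  set g₀ := upperRight (fillKernel T₀ I₀) with hg₀
  set g := upperRight (fillKernel T I) with hg
  have hX : ∀ r ∈ Icc (0 : ℝ) 1,
      IsUnit (((1 - r) • g₀ + r • upperRight I₀) + ((1 - r) • a + r • s)) := fun r hr => by
    have hodd : IsOddOp ((1 - r) • fillKernel T₀ I₀ + r • I₀) :=
      ((IsPolarPair.odd_fillKernel hT₀ hI₀).smul _).add (hI₀.smul _)
    have hlow := h₀.lower_bound_interpolation hc0 hc1 hc hr
    have hun := (h₀.skew_interpolation r).isUnit_of_lower_bound (half_pos hc0) hlow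
    have e : (1 - r) • g₀ + r • upperRight I₀ =
        upperRight ((1 - r) • fillKernel T₀ I₀ + r • I₀) := by
      rw [upperRight_add, upperRight_smul, upperRight_smul]
    rw [e]
    refine isUnit_add_of_norm_lt (hodd.isUnit_upperRight hun) (hodd.lower_bound_upperRight hlow) ?_
    refine (norm_add_le _ _).trans_lt ?_
    rw [norm_smul, norm_smul, Real.norm_eq_abs, Real.norm_eq_abs, abs_of_nonneg hr.1,
      abs_of_nonneg (by linarith [hr.2])]
    rcases hr.1.eq_or_lt with h3 | h3
    · rw [← h3]; simpa using h1
    · nlinarith [mul_lt_mul_of_pos_left h2 h3, mul_le_mul_of_nonneg_left h1.le (sub_nonneg.2 hr.2)]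
  have hY : ∀ r ∈ Icc (0 : ℝ) 1, IsUnit ((1 - r) • g + r • upperRight I) := fun r hr => by
    have hodd : IsOddOp ((1 - r) • fillKernel T I + r • I) :=
      ((IsPolarPair.odd_fillKernel hT hI).smul _).add (hI.smul _)
    have hlow := h.lower_bound_interpolation (c := min c' 1) (by positivity) (min_le_right _ _)
      (fun v => (mul_le_mul_of_nonneg_right (min_le_left _ _) (norm_nonneg v)).trans (hc' v)) hr
    have hun := (h.skew_interpolation r).isUnit_of_lower_bound (half_pos (by positivity)) hlow
    have e : (1 - r) • g + r • upperRight I = upperRight ((1 - r) • fillKernel T I + r • I) := by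
      rw [upperRight_add, upperRight_smul, upperRight_smul]
    rw [e]
    exact hodd.isUnit_upperRight hun
  have hFr : ∀ r : ℝ, FinRank (((1 - r) • g + r • upperRight I) -
      (((1 - r) • g₀ + r • upperRight I₀) + ((1 - r) • a + r • s))) := fun r => by
    have e : ((1 - r) • g + r • upperRight I) -
        (((1 - r) • g₀ + r • upperRight I₀) + ((1 - r) • a + r • s)) =
        (1 - r) • (upperRight (fillKernel T I - T) - upperRight (fillKernel T₀ I₀ - T₀)) +
          r • upperRight F := by
      simp only [ha, hs, hg, hg₀, upperRight_sub]
      module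
    rw [e]
    exact ((IsPolarPair.finRank_fillKernel_sub.upperRight.sub
      IsPolarPair.finRank_fillKernel_sub.upperRight).smul _).add
      (hF.upperRight.smul _)
  have := relSign_eq_of_preconnected (S := Icc (0 : ℝ) 1) isPreconnected_Icc
    (X := fun r => ((1 - r) • g₀ + r • upperRight I₀) + ((1 - r) • a + r • s))
    (Y := fun r => (1 - r) • g + r • upperRight I) (by fun_prop) (by fun_prop) hX hY
    (fun r _ => hFr r) (s := 0) (s' := 1) (by simp) (by simp)
  simpa using this

/-- I preserves ker(I + I') and interchanges its two graded parts, so this kernel is two copies of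
its part in the second summand. This accounts for the factor 1/2 in `pairIndex`. -/
theorem finrank_ker_add_eq {I' : WithLp 2 (H × H) →L[ℝ] WithLp 2 (H × H)}
    (hI : IsChiralComplexStructure I) (hI' : IsChiralComplexStructure I') :
    Module.finrank ℝ (I + I').ker =
      Module.finrank ℝ ((upperRight I + upperRight I').ker × (upperRight I + upperRight I').ker) := by
  have hii : ∀ v, I (I v) = -v := fun v =>
    congrArg (fun f : WithLp 2 (H × H) →L[ℝ] WithLp 2 (H × H) => f v) hI.mul_self
  have hii' : ∀ v, I' (I' v) = -v := fun v =>
    congrArg (fun f : WithLp 2 (H × H) →L[ℝ] WithLp 2 (H × H) => f v) hI'.mul_self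
  have hinv : ∀ v ∈ (I + I').ker, I v ∈ (I + I').ker := fun v hv => by
    have h1 : I v + I' v = 0 := hv
    change I (I v) + I' (I v) = 0
    rw [eq_neg_of_add_eq_zero_left h1, map_neg, map_neg, hii', ← neg_eq_iff_eq_neg.2
      (eq_neg_of_add_eq_zero_left h1), map_neg, hii]
    simp
  have hsnd : ∀ v ∈ (I + I').ker, v.snd ∈ (upperRight I + upperRight I').ker := fun v hv => by
    have h1 : I v + I' v = 0 := hv
    change upperRight I v.snd + upperRight I' v.snd = 0
    rw [← hI.isOddOp.fst_apply, ← hI'.isOddOp.fst_apply]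
    exact congrArg (fun v : WithLp 2 (H × H) => v.fst) h1
  have hincl : ∀ y ∈ (upperRight I + upperRight I').ker, inclSnd H y ∈ (I + I').ker := fun y hy => by
    have h1 : upperRight I y + upperRight I' y = 0 := hy
    change I (inclSnd H y) + I' (inclSnd H y) = 0
    rw [hI.isOddOp.apply_inclSnd, hI'.isOddOp.apply_inclSnd, ← map_add, h1, map_zero]
  let f : ((upperRight I + upperRight I').ker × (upperRight I + upperRight I').ker) →ₗ[ℝ]
      (I + I').ker :=
    { toFun := fun p => ⟨inclSnd H p.1 + I (inclSnd H p.2),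
        Submodule.add_mem _ (hincl _ p.1.2) (hinv _ (hincl _ p.2.2))⟩
      map_add' := fun p q => by
        apply Subtype.ext
        simp only [Prod.fst_add, Prod.snd_add, Submodule.coe_add, map_add]
        abel
      map_smul' := fun c p => by
        apply Subtype.ext
        simp only [Prod.smul_fst, Prod.smul_snd, Submodule.coe_smul, map_smul, RingHom.id_apply,
          smul_add] }
  refine (LinearEquiv.ofBijective f ⟨?_, ?_⟩).finrank_eq.symm
  · rw [injective_iff_map_eq_zero]
    rintro ⟨a, b⟩ hab
    have h1 : inclSnd H (a : H) + I (inclSnd H (b : H)) = 0 := congrArg Subtype.val hab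
    have h2 : (a : H) = 0 := by
      have := congrArg (fun v : WithLp 2 (H × H) => v.snd) h1
      rw [hI.isOddOp.apply_inclSnd] at this
      simpa using this
    have h3 : (b : H) = 0 := by
      rw [h2, map_zero, zero_add] at h1
      have h4 := hii (inclSnd H (b : H))
      rw [h1, map_zero] at h4
      have := congrArg (fun v : WithLp 2 (H × H) => v.snd) h4
      simpa using this.symm
    exact Prod.ext (Subtype.ext h2) (Subtype.ext h3)
  · rintro ⟨v, hv⟩
    have hw : -I v ∈ (I + I').ker := Submodule.neg_mem _ (hinv v hv)
    refine ⟨(⟨v.snd, hsnd v hv⟩, ⟨(-I v).snd, hsnd _ hw⟩), Subtype.ext ?_⟩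
    change inclSnd H v.snd + I (inclSnd H (-I v).snd) = v
    have h1 : upperRight I (-I v).snd = v.fst := by
      rw [← hI.isOddOp.fst_apply, map_neg, hii, neg_neg]
    rw [hI.isOddOp.apply_inclSnd, h1, add_comm, inclFst_add_inclSnd]

theorem neg_one_pow_pairIndex {I' : WithLp 2 (H × H) →L[ℝ] WithLp 2 (H × H)}
    (hI : IsChiralComplexStructure I) (hI' : IsChiralComplexStructure I') :
    (-1 : ℤˣ) ^ pairIndex I I' = (-1) ^ Module.finrank ℝ (upperRight I + upperRight I').ker := by
  unfold pairIndex
  rw [uzpow_natCast, finrank_ker_add_eq hI hI']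
  by_cases hfin : Module.Finite ℝ (upperRight I + upperRight I').ker
  · rw [Module.finrank_prod, ← two_mul, Nat.mul_div_cancel_left _ two_pos]
  -- In infinite dimension both sides use the default value 0 of `finrank`.
  · rw [Module.finrank_of_not_finite hfin, Module.finrank_of_not_finite fun h => hfin ?_]
    exact Module.Finite.of_surjective (LinearMap.fst ℝ (upperRight I + upperRight I').ker
      (upperRight I + upperRight I').ker) LinearMap.fst_surjective

theorem exists_norm_sub_lt_of_continuousOn {E : Type*} [NormedAddCommGroup E]
    [InnerProductSpace ℝ E] {X : ℝ → E →L[ℝ] E} {S : Set ℝ} (hX : ContinuousOn X S) {t₀ ε : ℝ}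
    (ht₀ : t₀ ∈ S) (hε : 0 < ε) : ∃ δ > 0, ∀ t ∈ S, |t - t₀| < δ → ‖X t - X t₀‖ < ε := by
  obtain ⟨δ, hδ, h⟩ := Metric.continuousOn_iff.1 hX t₀ ht₀ ε hε
  refine ⟨δ, hδ, fun t ht hd => ?_⟩
  rw [← dist_eq_norm]
  exact h t ht hd

/-- Near every parameter value, the pairs of phases are Fredholm pairs, and their index is the
product of the relative signs to a continuous path of invertible operators. -/
theorem exists_pairIndex_eq {B : ℝ → H →L[ℝ] H} (hB : IsAdmissiblePath B)
    {I : ℝ → WithLp 2 (H × H) →L[ℝ] WithLp 2 (H × H)}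
    (hI : ∀ t ∈ Icc (0 : ℝ) 1, CompletesPhase (chiralOp (B t)) (I t)) {K : ℝ → H →L[ℝ] H}
    (hKc : ContinuousOn K (Icc 0 1))
    (hK : ∀ t ∈ Icc (0 : ℝ) 1, IsUnit (K t) ∧ FinRank (K t - B t)) {t₀ : ℝ}
    (ht₀ : t₀ ∈ Icc (0 : ℝ) 1) :
    ∃ δ > 0, ∀ t ∈ Icc (0 : ℝ) 1, ∀ t' ∈ Icc (0 : ℝ) 1, |t - t₀| < δ → |t' - t₀| < δ →
      ‖calkinMk (I t - I t')‖ < 2 ∧ (-1 : ℤˣ) ^ pairIndex (I t) (I t') =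
        relSign (K t) (upperRight (fillKernel (chiralOp (B t)) (I t))) *
        relSign (K t') (upperRight (fillKernel (chiralOp (B t')) (I t'))) := by
  obtain ⟨P₀, h₀⟩ := (hI t₀ ht₀).exists_isPolarPair
  obtain ⟨V₀, hV₀⟩ := exists_finRank_mul_chiralOp_sub_one (hB.isFredholm t₀ ht₀)
  have hfin := finiteDimensional_ker_of_finRank hV₀
  obtain ⟨c₁, hc₁0, hc₁⟩ := h₀.exists_lower_bound_fillKernel hV₀
  -- The interpolation bound requires a constant at most 1.
  set c := min c₁ 1 with hc
  have hc0 : 0 < c := by positivity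
  have hc1 : c ≤ 1 := min_le_right _ _
  have hcb : ∀ v, c * ‖v‖ ≤ ‖fillKernel (chiralOp (B t₀)) (I t₀) v‖ := fun v =>
    (mul_le_mul_of_nonneg_right (min_le_left _ _) (norm_nonneg v)).trans (hc₁ v)
  obtain ⟨η, hη, hess⟩ := h₀.exists_finRank_norm_sub_lt hV₀ (show 0 < c / 2 by positivity)
  have hTc : ContinuousOn (fun t => chiralOp (B t)) (Icc 0 1) :=
    continuous_chiralOp.comp_continuousOn hB.continuousOn
  obtain ⟨δ, hδ, hT⟩ := exists_norm_sub_lt_of_continuousOn hTc ht₀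
    (show 0 < min η (c / 2) by positivity)
  set g : ℝ → H →L[ℝ] H := fun t => upperRight (fillKernel (chiralOp (B t)) (I t)) with hg
  have hodd : ∀ t ∈ Icc (0 : ℝ) 1, IsOddOp (I t) := fun t ht => (hI t ht).1.isOddOp
  have hgu : ∀ t ∈ Icc (0 : ℝ) 1, IsUnit (g t) ∧ FinRank (g t - B t) := fun t ht => by
    obtain ⟨P, h⟩ := (hI t ht).exists_isPolarPair
    obtain ⟨V, hV⟩ := exists_finRank_mul_chiralOp_sub_one (hB.isFredholm t ht)
    have := finiteDimensional_ker_of_finRank hV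
    refine ⟨(IsPolarPair.odd_fillKernel (isOddOp_chiralOp _) (hodd t ht)).isUnit_upperRight
      (h.isUnit_fillKernel hV), ?_⟩
    have e : g t - B t = upperRight (fillKernel (chiralOp (B t)) (I t) - chiralOp (B t)) := by
      rw [upperRight_sub, upperRight_chiralOp]
    rw [e]
    exact IsPolarPair.finRank_fillKernel_sub.upperRight
  have key : ∀ t ∈ Icc (0 : ℝ) 1, |t - t₀| < δ → ∃ F, FinRank F ∧ ‖I t - I t₀ - F‖ < c / 2 ∧
      relSign (g t₀ + (B t - B t₀)) (g t) =
        relSign (upperRight (I t₀) + upperRight (I t - I t₀ - F)) (upperRight (I t)) := by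
    intro t ht hd
    obtain ⟨P, h⟩ := (hI t ht).exists_isPolarPair
    obtain ⟨V, hV⟩ := exists_finRank_mul_chiralOp_sub_one (hB.isFredholm t ht)
    have h1 := hT t ht hd
    obtain ⟨F, hF, hFn⟩ := hess _ _ _ h (h1.trans_le (min_le_left _ _))
    refine ⟨F, hF, hFn, ?_⟩
    have e : B t - B t₀ = upperRight (chiralOp (B t) - chiralOp (B t₀)) := by
      rw [upperRight_sub, upperRight_chiralOp, upperRight_chiralOp]
    rw [e]
    exact relSign_upperRight_fillKernel h₀ h (isOddOp_chiralOp _) (hodd t₀ ht₀)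
      (isOddOp_chiralOp _) (hodd t ht) hV hc1 hc0 hcb hF
      ((norm_upperRight_le _).trans_lt (h1.trans_le (min_le_right _ _)))
      ((norm_upperRight_le _).trans_lt hFn)
  have hCu : ∀ t ∈ Icc (0 : ℝ) 1, |t - t₀| < δ → IsUnit (g t₀ + (B t - B t₀)) := fun t ht hd => by
    have e : B t - B t₀ = upperRight (chiralOp (B t) - chiralOp (B t₀)) := by
      rw [upperRight_sub, upperRight_chiralOp, upperRight_chiralOp]
    refine isUnit_add_of_norm_lt (c := c) (hgu t₀ ht₀).1
      ((IsPolarPair.odd_fillKernel (isOddOp_chiralOp _) (hodd t₀ ht₀)).lower_bound_upperRight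
        hcb) ?_
    rw [e]
    refine (norm_upperRight_le _).trans_lt ((hT t ht hd).trans_le ((min_le_right _ _).trans ?_))
    linarith
  have hCF : ∀ t, FinRank (g t₀ + (B t - B t₀) - B t) := fun t => by
    have e : g t₀ + (B t - B t₀) - B t = g t₀ - B t₀ := by abel
    rw [e]
    exact (hgu t₀ ht₀).2
  have hKC : ∀ t ∈ Icc (0 : ℝ) 1, FinRank (g t₀ + (B t - B t₀) - K t) := fun t ht => by
    have e : g t₀ + (B t - B t₀) - K t = (g t₀ + (B t - B t₀) - B t) - (K t - B t) := by abel
    rw [e]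
    exact (hCF t).sub (hK t ht).2
  -- `g t₀ + (B t - B t₀)` is a continuous path of invertible operators near `t₀`. Its sign relative
  -- to K is constant there and cancels in the product over t and t'.
  have hsplit : ∀ t ∈ Icc (0 : ℝ) 1, |t - t₀| < δ → relSign (K t) (g t) =
      relSign (K t) (g t₀ + (B t - B t₀)) * relSign (g t₀ + (B t - B t₀)) (g t) := fun t ht hd => by
    refine (relSign_mul_relSign (hK t ht).1 (hCu t ht hd) (hgu t ht).1 (hKC t ht) ?_).symm
    have e : g t - (g t₀ + (B t - B t₀)) = (g t - B t) - (g t₀ + (B t - B t₀) - B t) := by abel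
    rw [e]
    exact (hgu t ht).2.sub (hCF t)
  refine ⟨δ, hδ, fun t ht t' ht' hd hd' => ?_⟩
  obtain ⟨F, hF, hFn, hrel⟩ := key t ht hd
  obtain ⟨F', hF', hFn', hrel'⟩ := key t' ht' hd'
  constructor
  · refine (norm_calkinMk_le (hF.sub hF')).trans_lt ?_
    have e : I t - I t' - (F - F') = (I t - I t₀ - F) - (I t' - I t₀ - F') := by abel
    rw [e]
    calc ‖(I t - I t₀ - F) - (I t' - I t₀ - F')‖ ≤ ‖I t - I t₀ - F‖ + ‖I t' - I t₀ - F'‖ :=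
          norm_sub_le (E := WithLp 2 (H × H) →L[ℝ] WithLp 2 (H × H)) _ _
      _ < 2 := by linarith
  · have hS : IsPreconnected (Icc (0 : ℝ) 1 ∩ Metric.ball t₀ δ) :=
      ((convex_Icc 0 1).inter (convex_ball t₀ δ)).isPreconnected
    have hconst := relSign_eq_of_preconnected hS (X := K) (Y := fun t => g t₀ + (B t - B t₀))
      (hKc.mono inter_subset_left)
      ((continuousOn_const.add (hB.continuousOn.sub continuousOn_const)).mono inter_subset_left)
      (fun s hs => (hK s hs.1).1) (fun s hs => hCu s hs.1 hs.2) (fun s hs => hKC s hs.1)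
      (s := t) (s' := t') ⟨ht, hd⟩ ⟨ht', hd'⟩
    have hu : ∀ s ∈ Icc (0 : ℝ) 1, IsUnit (upperRight (I s)) ∧
        ∀ x y, inner ℝ (upperRight (I s) x) (upperRight (I s) y) = inner ℝ x y := fun s hs => by
      obtain ⟨P, h⟩ := (hI s hs).exists_isPolarPair
      exact ⟨(hodd s hs).isUnit_upperRight h.isUnit_phase,
        (hodd s hs).inner_upperRight h.inner_apply⟩
    have hFin : ∀ s F, FinRank F → FinRank (upperRight (I s) -
        (upperRight (I t₀) + upperRight (I s - I t₀ - F))) := fun s F hF => by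
      have e : upperRight (I s) - (upperRight (I t₀) + upperRight (I s - I t₀ - F)) =
          upperRight F := by
        rw [upperRight_sub, upperRight_sub]; abel
      rw [e]
      exact hF.upperRight
    have hprod := relSign_mul_relSign_of_inner (hu t₀ ht₀).1 (hu t ht).1 (hu t' ht').1
      (hu t₀ ht₀).2 (hu t ht).2 (hu t' ht').2
      ((norm_upperRight_le _).trans_lt (hFn.trans_le (by linarith)))
      ((norm_upperRight_le _).trans_lt (hFn'.trans_le (by linarith)))
      (hFin t F hF) (hFin t' F' hF')
    rw [neg_one_pow_pairIndex (hI t ht).1 (hI t' ht').1, ← hprod, ← hrel, ← hrel',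
      hsplit t ht hd, hsplit t' ht' hd', hconst, mul_mul_mul_comm, Int.units_mul_self, one_mul]

end LocalIndex

/-! ### Invariance of the spectral subspaces -/

section SpectralSubspace

variable {E : Type*} [NormedAddCommGroup E] [InnerProductSpace ℝ E] [CompleteSpace E]

theorem ker_le_spectralSubspace (T : E →L[ℝ] E) {a : ℝ} (ha : 0 < a) :
    T.ker ≤ spectralSubspace T a := by
  refine le_trans ?_ (Submodule.le_topologicalClosure _)
  intro v hv
  have hv' : T v = 0 := hv
  refine Or.inl ⟨0, ‖v‖, le_rfl, ha, fun n => ?_⟩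
  cases n with
  | zero => simp
  | succ n => rw [pow_succ, mul_apply_eq_comp, hv', map_zero]; simp

/-- F preserves the growth condition that defines the spectral subspace, and continuity handles the
closure. Used for T itself and for the grading. -/
theorem mem_spectralSubspace_of_norm_pow_le {T F : E →L[ℝ] E}
    (h : ∀ (n : ℕ) v, ‖(T ^ n) (F v)‖ ≤ ‖F‖ * ‖(T ^ n) v‖) {a : ℝ} {v : E}
    (hv : v ∈ spectralSubspace T a) : F v ∈ spectralSubspace T a := by
  have hmap : MapsTo F (preSpectralSubspace T a) (preSpectralSubspace T a) := by
    rintro w (⟨b, C, hb, hba, hw⟩ | hw)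
    · refine Or.inl ⟨b, ‖F‖ * C, hb, hba, fun n => (h n w).trans ?_⟩
      rw [mul_assoc]
      exact mul_le_mul_of_nonneg_left (hw n) (norm_nonneg _)
    · rw [mem_singleton_iff.1 hw, map_zero]; exact Or.inr rfl
  exact hmap.closure F.continuous hv

theorem apply_mem_spectralSubspace (T : E →L[ℝ] E) {a : ℝ} {v : E}
    (hv : v ∈ spectralSubspace T a) : T v ∈ spectralSubspace T a := by
  refine mem_spectralSubspace_of_norm_pow_le (fun n v => ?_) hv
  rw [← mul_apply_eq_comp, ← pow_succ, pow_succ', mul_apply_eq_comp]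
  exact T.le_opNorm _

theorem mem_spectralSubspace_of_anticommute {T F : E →L[ℝ] E} (h : ∀ v, T (F v) = -F (T v))
    {a : ℝ} {v : E} (hv : v ∈ spectralSubspace T a) : F v ∈ spectralSubspace T a := by
  refine mem_spectralSubspace_of_norm_pow_le (fun n v => ?_) hv
  have e : ∀ v, (T ^ n) (F v) = (-1 : ℝ) ^ n • F ((T ^ n) v) := by
    induction n with
    | zero => simp
    | succ n ih =>
      intro v
      rw [pow_succ, mul_apply_eq_comp, h, map_neg, ih, mul_apply_eq_comp,
        pow_succ]
      simp
  rw [e, norm_smul]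
  simpa using F.le_opNorm ((T ^ n) v)

end SpectralSubspace

/-! ### Symplectic bases and the finite-dimensional `ℤ₂`-valued spectral flow -/

section Symplectic

variable {W : Type*} [NormedAddCommGroup W] [InnerProductSpace ℝ W] [FiniteDimensional ℝ W]
  [CompleteSpace W]

theorem IsSkewAdjointOp.inner_self_eq_zero {S : W →L[ℝ] W} (hS : IsSkewAdjointOp S) (v : W) :
    inner ℝ (S v) v = 0 := by
  have h := hS.inner_left v v
  rw [real_inner_comm] at h
  rw [real_inner_comm]
  linarith

/-- The form `⟪S x, y⟫`. -/
noncomputable def skewForm (S : W →L[ℝ] W) : LinearMap.BilinForm ℝ W :=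
  (innerₗ W) ∘ₗ S.toLinearMap

theorem skewForm_apply (S : W →L[ℝ] W) (x y : W) : skewForm S x y = inner ℝ (S x) y := rfl

/-- A family spanning a symplectic subspace. -/
def IsSymplecticFamily (S : W →L[ℝ] W) {n : ℕ} (p q : Fin n → W) : Prop :=
  (∀ i j, inner ℝ (S (p i)) (p j) = (0 : ℝ)) ∧ (∀ i j, inner ℝ (S (q i)) (q j) = (0 : ℝ)) ∧
    ∀ i j, inner ℝ (S (q i)) (p j) = if i = j then (1 : ℝ) else 0

theorem IsSymplecticFamily.skewForm_eq {S : W →L[ℝ] W} (hS : IsSkewAdjointOp S) {n : ℕ}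
    {p q : Fin n → W} (h : IsSymplecticFamily S p q) (i j : Fin n ⊕ Fin n) :
    skewForm S (Sum.elim p q i) (Sum.elim p q j) = Matrix.J (Fin n) ℝ i j := by
  rw [skewForm_apply]
  rcases i with i | i <;> rcases j with j | j
  · simpa [Matrix.J] using h.1 i j
  · have := h.2.2 j i
    simp only [Sum.elim_inl, Sum.elim_inr, Matrix.J, Matrix.fromBlocks_apply₁₂, Matrix.neg_apply,
      Matrix.one_apply]
    rw [hS.inner_left, real_inner_comm, this]
    simp [eq_comm]
  · simpa [Matrix.J, Matrix.one_apply] using h.2.2 i j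
  · simpa [Matrix.J] using h.2.1 i j

theorem IsSymplecticFamily.linearIndependent {S : W →L[ℝ] W} (hS : IsSkewAdjointOp S) {n : ℕ}
    {p q : Fin n → W} (h : IsSymplecticFamily S p q) : LinearIndependent ℝ (Sum.elim p q) := by
  rw [Fintype.linearIndependent_iff]
  intro c hc
  have hJ : Matrix.vecMul c (Matrix.J (Fin n) ℝ) = 0 := by
    funext j
    have := congrArg (fun v => skewForm S v (Sum.elim p q j)) hc
    simp only [map_sum, map_smul, LinearMap.sum_apply, LinearMap.smul_apply, h.skewForm_eq hS,
      map_zero, LinearMap.zero_apply] at this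
    exact this
  have h2 : Matrix.vecMul (Matrix.vecMul c (Matrix.J (Fin n) ℝ)) (Matrix.J (Fin n) ℝ) = -c := by
    rw [Matrix.vecMul_vecMul, Matrix.J_squared, Matrix.vecMul_neg, Matrix.vecMul_one]
  rw [hJ, Matrix.zero_vecMul] at h2
  intro i
  have := congrFun h2 i
  simpa using this

theorem IsSymplecticFamily.exists_cons {S : W →L[ℝ] W} (hS : IsSkewAdjointOp S) (hu : IsUnit S)
    {n : ℕ} {p q : Fin n → W} (h : IsSymplecticFamily S p q)
    (hn : 2 * n < Module.finrank ℝ W) :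
    ∃ v w, IsSymplecticFamily S (Fin.cons v p : Fin (n + 1) → W) (Fin.cons w q) := by
  let L : W →ₗ[ℝ] (Fin n ⊕ Fin n → ℝ) := LinearMap.pi fun i => skewForm S (Sum.elim p q i)
  have hL : L.ker ≠ ⊥ := LinearMap.ker_ne_bot_of_finrank_lt (by simpa [two_mul] using hn)
  obtain ⟨v, hv, hv0⟩ := Submodule.exists_mem_ne_zero_of_ne_bot hL
  have hvL : ∀ i, inner ℝ (S (Sum.elim p q i)) v = (0 : ℝ) := fun i => congrFun hv i
  obtain ⟨u, hu⟩ := hu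
  have hSv : S v ≠ 0 := fun h0 => hv0 (by
    have : (↑u⁻¹ * ↑u : W →L[ℝ] W) v = 0 := by
      rw [mul_apply_eq_comp, hu, h0, map_zero]
    simpa using this)
  -- w₀ pairs with v to -1; w is w₀ corrected by symplectic Gram–Schmidt against the given family.
  set w₀ : W := -(‖S v‖ ^ 2)⁻¹ • S v with hw₀
  have hvw₀ : inner ℝ (S v) w₀ = (-1 : ℝ) := by
    rw [hw₀, inner_smul_right, real_inner_self_eq_norm_sq]
    have : ‖S v‖ ^ 2 ≠ 0 := by positivity
    field_simp
  set w : W := w₀ - ∑ i, (inner ℝ (S (q i)) w₀ : ℝ) • p i + ∑ i, (inner ℝ (S (p i)) w₀ : ℝ) • q i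
    with hw
  have hpv : ∀ i, inner ℝ (S (p i)) v = (0 : ℝ) := fun i => hvL (Sum.inl i)
  have hqv : ∀ i, inner ℝ (S (q i)) v = (0 : ℝ) := fun i => hvL (Sum.inr i)
  have hsw : ∀ x y : W, inner ℝ (S x) y = -(inner ℝ (S y) x : ℝ) := fun x y => by
    rw [hS.inner_left, real_inner_comm]
  have hpq : ∀ i j, inner ℝ (S (p i)) (q j) = if i = j then (-1 : ℝ) else 0 := fun i j => by
    rw [hsw, h.2.2]
    by_cases hij : i = j
    · simp [hij]
    · simp [hij, Ne.symm hij]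
  have hqw : ∀ j, inner ℝ (S (q j)) w = (0 : ℝ) := fun j => by
    simp only [hw, inner_add_right, inner_sub_right, inner_sum, inner_smul_right, h.2.2, h.2.1]
    simp
  have hpw : ∀ j, inner ℝ (S (p j)) w = (0 : ℝ) := fun j => by
    simp only [hw, inner_add_right, inner_sub_right, inner_sum, inner_smul_right, hpq, h.1]
    simp
  have hvw : inner ℝ (S v) w = (-1 : ℝ) := by
    simp only [hw, inner_add_right, inner_sub_right, inner_sum, inner_smul_right]
    simp [hvw₀, hsw v, hpv, hqv]
  refine ⟨v, w, ?_, ?_, ?_⟩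
  · intro i j
    refine Fin.cases ?_ (fun i => ?_) i <;> refine Fin.cases ?_ (fun j => ?_) j
    · simpa using hS.inner_self_eq_zero v
    · simpa [hsw v] using hpv j
    · simpa using hpv i
    · simpa using h.1 i j
  · intro i j
    refine Fin.cases ?_ (fun i => ?_) i <;> refine Fin.cases ?_ (fun j => ?_) j
    · simpa using hS.inner_self_eq_zero w
    · simpa [hsw w] using hqw j
    · simpa using hqw i
    · simpa using h.2.1 i j
  · intro i j
    refine Fin.cases ?_ (fun i => ?_) i <;> refine Fin.cases ?_ (fun j => ?_) j
    · simp [hsw w, hvw]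
    · simpa [hsw w, (Fin.succ_ne_zero j).symm] using hpw j
    · simpa [Fin.succ_ne_zero i] using hqv i
    · simpa using h.2.2 i j

/-- An invertible skew-adjoint operator has a symplectic basis. -/
theorem IsSkewAdjointOp.exists_basis {S : W →L[ℝ] W} (hS : IsSkewAdjointOp S) (hu : IsUnit S) :
    ∃ n, ∃ b : Module.Basis (Fin n ⊕ Fin n) ℝ W,
      LinearMap.BilinForm.toMatrix b (skewForm S) = Matrix.J (Fin n) ℝ := by
  have hcard : ∀ n (p q : Fin n → W), IsSymplecticFamily S p q →
      2 * n ≤ Module.finrank ℝ W := fun n p q h => by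
    simpa [two_mul] using (h.linearIndependent hS).fintype_card_le_finrank
  have key : ∃ n, ∃ p q : Fin n → W, IsSymplecticFamily S p q ∧ Module.finrank ℝ W = 2 * n := by
    -- If no symplectic family had exactly dim W members, each could be enlarged, and eventually the
    -- dimension bound `hcard` would fail.
    by_contra! hno
    have hall : ∀ n, ∃ p q : Fin n → W, IsSymplecticFamily S p q := by
      intro n
      induction n with
      | zero => exact ⟨Fin.elim0, Fin.elim0, fun i => i.elim0, fun i => i.elim0, fun i => i.elim0⟩
      | succ n ih =>
        obtain ⟨p, q, h⟩ := ih
        obtain ⟨v, w, hvw⟩ := h.exists_cons hS hu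
          (lt_of_le_of_ne (hcard n p q h) (Ne.symm (hno n p q h)))
        exact ⟨_, _, hvw⟩
    obtain ⟨p, q, h⟩ := hall (Module.finrank ℝ W + 1)
    have := hcard _ p q h
    omega
  obtain ⟨n, p, q, h, hn⟩ := key
  refine ⟨n, basisOfLinearIndependentOfCardEqFinrank' _ (h.linearIndependent hS)
    (by simp [hn, two_mul]), ?_⟩
  ext i j
  rw [LinearMap.BilinForm.toMatrix_apply]
  simpa using h.skewForm_eq hS i j

theorem skewForm_conj (S A : W →L[ℝ] W) :
    skewForm (ContinuousLinearMap.adjoint A ∘L S ∘L A) =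
      (skewForm S).comp A.toLinearMap A.toLinearMap := by
  ext x y
  simp [skewForm_apply, ContinuousLinearMap.adjoint_inner_left]

theorem skewForm_injective {S S' : W →L[ℝ] W} (h : skewForm S = skewForm S') : S = S' := by
  ext x
  refine ext_inner_right ℝ fun y => ?_
  exact LinearMap.congr_fun (LinearMap.congr_fun h x) y

/-- A linear map preserving an invertible skew-adjoint form has determinant one. -/
theorem IsSkewAdjointOp.det_eq_one {S A : W →L[ℝ] W} (hS : IsSkewAdjointOp S) (hu : IsUnit S)
    (hA : ContinuousLinearMap.adjoint A ∘L S ∘L A = S) : A.det = 1 := by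
  -- In a symplectic basis A becomes a symplectic matrix.
  obtain ⟨n, b, hb⟩ := hS.exists_basis hu
  have h := congrArg (fun S => LinearMap.BilinForm.toMatrix b (skewForm S)) hA
  simp only [skewForm_conj] at h
  rw [LinearMap.BilinForm.toMatrix_comp b b, hb] at h
  have := SymplecticGroup.det_eq_one (SymplecticGroup.mem_iff'.2 h)
  rwa [LinearMap.det_toMatrix] at this

/-- Any two invertible skew-adjoint operators are congruent. -/
theorem IsSkewAdjointOp.exists_congruence {S₀ S₁ : W →L[ℝ] W} (h₀ : IsSkewAdjointOp S₀)
    (hu₀ : IsUnit S₀) (h₁ : IsSkewAdjointOp S₁) (hu₁ : IsUnit S₁) :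
    ∃ A : W ≃L[ℝ] W,
      S₁ = ContinuousLinearMap.adjoint (A : W →L[ℝ] W) ∘L S₀ ∘L (A : W →L[ℝ] W) := by
  obtain ⟨n, b, hb⟩ := h₀.exists_basis hu₀
  obtain ⟨m, b', hb'⟩ := h₁.exists_basis hu₁
  have e1 := Module.finrank_eq_card_basis b
  have e2 := Module.finrank_eq_card_basis b'
  have hnm : n = m := by
    rw [e1] at e2
    simp at e2
    omega
  subst hnm
  refine ⟨(b'.equiv b (Equiv.refl _)).toContinuousLinearEquiv, skewForm_injective ?_⟩
  rw [skewForm_conj]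
  refine b'.ext fun i => b'.ext fun j => ?_
  have h1 := congrFun (congrFun hb i) j
  have h2 := congrFun (congrFun hb' i) j
  rw [LinearMap.BilinForm.toMatrix_apply] at h1 h2
  rw [h2, ← h1]
  simp

/-- Two congruences A, A' from S₀ to S₁ differ by A' A⁻¹, which preserves S₀ and hence has
determinant 1. So any single invertible A decides the existential in `finiteSF₂`. -/
theorem finiteSF₂_eq {S₀ S₁ A : W →L[ℝ] W} (h₀ : IsSkewAdjointOp S₀) (hu₀ : IsUnit S₀)
    (hA : S₁ = ContinuousLinearMap.adjoint A ∘L S₀ ∘L A) (hdet : A.det ≠ 0) :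
    finiteSF₂ S₀ S₁ = signUnit A.det := by
  classical
  unfold finiteSF₂ signUnit
  refine if_congr ⟨?_, fun h => ⟨A, hA, h⟩⟩ rfl rfl
  rintro ⟨A', hA', hpos⟩
  obtain ⟨e, he⟩ : ∃ e : W ≃L[ℝ] W, (e : W →L[ℝ] W) = A :=
    ⟨A.toContinuousLinearEquivOfDetNeZero hdet,
      ContinuousLinearMap.coe_toContinuousLinearEquivOfDetNeZero A hdet⟩
  have h1 : (A' ∘L (e.symm : W →L[ℝ] W)).det = 1 := by
    refine h₀.det_eq_one hu₀ (skewForm_injective ?_)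
    have h2 : (skewForm S₀).comp A'.toLinearMap A'.toLinearMap =
        (skewForm S₀).comp A.toLinearMap A.toLinearMap := by
      rw [← skewForm_conj, ← skewForm_conj, ← hA, ← hA']
    rw [skewForm_conj]
    ext x y
    have h3 := LinearMap.congr_fun (LinearMap.congr_fun h2 (e.symm x)) (e.symm y)
    rw [← he] at h3
    simpa using h3
  have h2 : A' = (A' ∘L (e.symm : W →L[ℝ] W)) * A := by
    ext x
    simp [← he]
  have h3 : A'.det = A.det := by
    have : A'.det = (A' ∘L (e.symm : W →L[ℝ] W)).det * A.det := by
      conv_lhs => rw [h2]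
      exact LinearMap.det_comp _ _
    rw [this, h1, one_mul]
  rwa [h3] at hpos

end Symplectic

/-! ### Compressions to finite-dimensional subspaces -/

section Compress

variable {E : Type*} [NormedAddCommGroup E] [InnerProductSpace ℝ E] [CompleteSpace E]

/-- The compression of an operator to a subspace. -/
noncomputable def compress (X : Submodule ℝ E) [X.HasOrthogonalProjection] (F : E →L[ℝ] E) :
    X →L[ℝ] X :=
  X.orthogonalProjectionOnto ∘L F ∘L X.subtypeL

variable (X : Submodule ℝ E) [X.HasOrthogonalProjection]

theorem coe_compress_apply (F : E →L[ℝ] E) (v : X) :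
    (compress X F v : E) = X.starProjection (F v) := rfl

theorem coe_compress_apply_of_mem {F : E →L[ℝ] E} {v : X} (h : F v ∈ X) :
    (compress X F v : E) = F v :=
  Submodule.starProjection_eq_self_iff.2 h

theorem inner_compress (F : E →L[ℝ] E) (v w : X) :
    inner ℝ (compress X F v) w = inner ℝ (F v) (w : E) := by
  rw [Submodule.coe_inner, coe_compress_apply, Submodule.inner_starProjection_left_eq_right,
    Submodule.starProjection_eq_self_iff.2 w.2]

theorem IsSkewAdjointOp.skew_compress [CompleteSpace X] {F : E →L[ℝ] E} (hF : IsSkewAdjointOp F) :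
    IsSkewAdjointOp (compress X F) :=
  isSkewAdjointOp_of_inner fun v w => by
    rw [inner_compress, hF.inner_left, real_inner_comm _ v, inner_compress, real_inner_comm]

theorem mem_of_sub_mem {F : E →L[ℝ] E} (h : ∀ v, F v - v ∈ X) {v : E} (hv : v ∈ X) : F v ∈ X := by
  have := X.add_mem (h v) hv
  rwa [sub_add_cancel] at this

/-- Makes the determinant of a congruence independent of the spectral subspace on which it is
computed. -/
theorem det_compress [FiniteDimensional ℝ X] {F : E →L[ℝ] E} (h : ∀ v, F v - v ∈ X) :
    (compress X F).det = detOneAdd ((F - 1 : E →L[ℝ] E) : E →ₗ[ℝ] E) := by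
  rw [detOneAdd_eq X _ h]
  unfold ContinuousLinearMap.det
  congr 1
  ext v
  change (compress X F v : E) = v + (F v - v)
  rw [coe_compress_apply_of_mem X (mem_of_sub_mem X h v.2), add_sub_cancel]

theorem det_compress_ne_zero [FiniteDimensional ℝ X] {F : E →L[ℝ] E} (h : ∀ v, F v - v ∈ X)
    (hF : IsUnit F) : (compress X F).det ≠ 0 := by
  rw [det_compress X h]
  refine detOneAdd_ne_zero (FinRank.of_mem X h) ?_
  have := isUnit_toLinearMap hF
  convert this using 1
  ext v
  change v + (F v - v) = F v
  abel

end Compress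

/-! ### Congruence of kernel perturbations -/

section KernelCongruence

variable {E : Type*} [NormedAddCommGroup E] [InnerProductSpace ℝ E] [CompleteSpace E]
  {T I P R : E →L[ℝ] E}

theorem isUnit_of_eq_zero {W : Type*} [NormedAddCommGroup W] [NormedSpace ℝ W]
    [FiniteDimensional ℝ W] {S : W →L[ℝ] W} (h : ∀ v, S v = 0 → v = 0) : IsUnit S := by
  have : CompleteSpace W := FiniteDimensional.complete ℝ W
  have hi : Function.Injective S := (injective_iff_map_eq_zero S).2 h
  rw [ContinuousLinearMap.isUnit_iff_bijective]
  exact ⟨hi, LinearMap.surjective_of_injective (f := (S : W →ₗ[ℝ] W)) hi⟩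

/-- An invertible perturbation of the kernel is congruent to `fillKernel T I`, by an operator
which acts on the kernel of `T` only. -/
theorem IsPolarPair.exists_kernel_congruence (h : IsPolarPair T I P)
    [FiniteDimensional ℝ T.ker] (hR : IsSkewAdjointOp R) (hTR : ∀ v, T (R v) = 0)
    (hinj : ∀ v, T v = 0 → R v = 0 → v = 0) :
    ∃ A : E →L[ℝ] E, IsUnit A ∧ (∀ v, A v - v ∈ T.ker) ∧
      ∀ v w, inner ℝ ((T + R) v) w = (inner ℝ (fillKernel T I (A v)) (A w) : ℝ) := by
  set N := T.ker with hN
  have hRN : ∀ v, R v ∈ N := hTR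
  have hIu : IsUnit (compress N I) := isUnit_of_eq_zero fun v hv => by
    have h1 := congrArg (Subtype.val) hv
    rw [coe_compress_apply_of_mem N (h.apply_mem_ker v.2)] at h1
    apply Subtype.ext
    have h2 := h.apply_apply (v : E)
    rw [h1] at h2
    simpa using h2.symm
  have hRu : IsUnit (compress N R) := isUnit_of_eq_zero fun v hv => by
    have h1 := congrArg (Subtype.val) hv
    rw [coe_compress_apply_of_mem N (hRN v)] at h1
    exact Subtype.ext (hinj v v.2 h1)
  obtain ⟨A', hA'⟩ := (h.skew_phase.skew_compress N).exists_congruence hIu (hR.skew_compress N) hRu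
  let p := N.orthogonalProjectionOnto
  -- The congruence A' between I and R on ker T, extended by the identity on the orthogonal
  -- complement.
  let A : E →L[ℝ] E := N.subtypeL ∘L (A' : N →L[ℝ] N) ∘L p + (1 - N.starProjection)
  have hA : ∀ v, A v = (A' (p v) : E) + (v - N.starProjection v) := fun v => rfl
  have hAN : ∀ v, A v - v ∈ N := fun v => by
    have e : A v - v = (A' (p v) : E) - N.starProjection v := by rw [hA]; abel
    rw [e]
    exact N.sub_mem (A' (p v)).2 (Submodule.starProjection_apply_mem _ _)
  have hTN : ∀ v : N, T v = 0 := fun v => v.2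
  have hQA : ∀ v, N.starProjection (A v) = A' (p v) := fun v => by
    rw [hA, map_add, map_sub, Submodule.starProjection_eq_self_iff.2 (A' (p v)).2,
      Submodule.starProjection_eq_self_iff.2 (Submodule.starProjection_apply_mem N v), sub_self,
      add_zero]
  have hTA : ∀ v, T (A v) = T v := fun v => by
    rw [hA, map_add, map_sub, hTN, hTN (p v) |> fun h => (h : T (N.starProjection v) = 0)]
    abel
  have hcong : ∀ v w, inner ℝ ((T + R) v) w = (inner ℝ (fillKernel T I (A v)) (A w) : ℝ) := by
    intro v w
    have h1 : fillKernel T I (A v) = T v + I (A' (p v)) := by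
      change T (A v) + I (N.starProjection (A v)) = _
      rw [hTA, hQA]
    have h2 : inner ℝ (T v) (A w) = (inner ℝ (T v) w : ℝ) := by
      rw [h.skew.inner_left, hTA, ← h.skew.inner_left]
    have h3 : inner ℝ (I (A' (p v))) (A w) = (inner ℝ (I (A' (p v))) (A' (p w) : E) : ℝ) := by
      rw [← hQA w, ← Submodule.inner_starProjection_left_eq_right,
        Submodule.starProjection_eq_self_iff.2 (h.apply_mem_ker (A' (p v)).2)]
    have h4 : inner ℝ (I (A' (p v))) (A' (p w) : E) = (inner ℝ (compress N R (p v)) (p w) : ℝ) := by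
      rw [hA', ContinuousLinearMap.comp_apply, ContinuousLinearMap.adjoint_inner_left,
        ContinuousLinearMap.comp_apply, inner_compress]
      rfl
    have h5 : inner ℝ (compress N R (p v)) (p w) = (inner ℝ (R v) w : ℝ) := by
      rw [inner_compress]
      change inner ℝ (R (N.starProjection v)) (N.starProjection w) = _
      rw [← Submodule.inner_starProjection_left_eq_right,
        Submodule.starProjection_eq_self_iff.2 (hRN _), hR.inner_left,
        Submodule.inner_starProjection_left_eq_right,
        Submodule.starProjection_eq_self_iff.2 (hRN _), ← hR.inner_left]
    rw [h1, add_apply, inner_add_left, inner_add_left, h2, h3, h4, h5]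
  refine ⟨A, ?_, hAN, hcong⟩
  refine isUnit_of_finRank_of_injective isUnit_one (FinRank.of_mem N hAN) ?_
  rw [injective_iff_map_eq_zero]
  intro v hv
  have h1 : T v + R v = 0 := by
    refine ext_inner_right ℝ fun w => ?_
    have := hcong v w
    rw [hv, map_zero, inner_zero_left] at this
    rw [inner_zero_left]
    exact this
  have h2 : R v = 0 := by
    have := congrArg N.starProjection h1
    rwa [map_add, h.starProjection_apply, zero_add, map_zero,
      Submodule.starProjection_eq_self_iff.2 (hRN v)] at this
  rw [h2, add_zero] at h1
  exact hinj v h1 h2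

end KernelCongruence

/-! ### The `ℤ₂`-valued spectral flow between two nearby spectral subspaces -/

section Transport

variable {E : Type*} [NormedAddCommGroup E] [InnerProductSpace ℝ E] [CompleteSpace E]

/-- Otherwise the difference of the projections would fix the nonzero vector v. -/
theorem eq_zero_of_starProjection_eq_zero {X Y : Submodule ℝ E} [X.HasOrthogonalProjection]
    [Y.HasOrthogonalProjection] (hXY : ‖X.starProjection - Y.starProjection‖ < 1) {v : E}
    (hv : v ∈ X) (h : Y.starProjection v = 0) : v = 0 := by
  by_contra hv0
  have h1 := (X.starProjection - Y.starProjection).le_opNorm v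
  rw [sub_apply, h, sub_zero, Submodule.starProjection_eq_self_iff.2 hv] at h1
  have := norm_pos_iff.2 hv0
  nlinarith

theorem exists_equiv_of_norm_sub_lt {X Y : Submodule ℝ E} [FiniteDimensional ℝ X]
    [FiniteDimensional ℝ Y] [X.HasOrthogonalProjection]
    [Y.HasOrthogonalProjection] (hXY : ‖X.starProjection - Y.starProjection‖ < 1) :
    ∃ e : X ≃L[ℝ] Y, (e : X →L[ℝ] Y) = Y.orthogonalProjectionOnto ∘L X.subtypeL := by
  have hi : ∀ (X Y : Submodule ℝ E) [FiniteDimensional ℝ X]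
      [FiniteDimensional ℝ Y] [X.HasOrthogonalProjection]
      [Y.HasOrthogonalProjection], ‖X.starProjection - Y.starProjection‖ < 1 →
      Function.Injective ((Y.orthogonalProjectionOnto ∘L X.subtypeL : X →L[ℝ] Y) : X →ₗ[ℝ] Y) := by
    intro X Y _ _ _ _ hXY
    rw [injective_iff_map_eq_zero]
    intro v hv
    exact Subtype.ext (eq_zero_of_starProjection_eq_zero hXY v.2 (congrArg Subtype.val hv))
  have h1 := hi X Y hXY
  have h2 := hi Y X (by rwa [norm_sub_rev])
  have hdim : Module.finrank ℝ X = Module.finrank ℝ Y :=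
    le_antisymm (LinearMap.finrank_le_finrank_of_injective h1)
      (LinearMap.finrank_le_finrank_of_injective h2)
  exact ⟨(LinearMap.linearEquivOfInjective _ h1 hdim).toContinuousLinearEquiv, by ext v; rfl⟩

/-- With e : X₀ → X₁ the projection, A₀⁻¹ Z (e⁻¹ A₁ e) is a congruence from S₀ to the pull-back of
S₁: A₀ and A₁ pass between the S's and the G's, and Z passes from G₀ to the pull-back of G₁.
Conjugation by e leaves the determinant unchanged. -/
theorem finiteSF₂_transport {X₀ X₁ : Submodule ℝ E} [FiniteDimensional ℝ X₀]
    [FiniteDimensional ℝ X₁] [CompleteSpace X₀] [CompleteSpace X₁]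
    (hXY : ‖X₀.starProjection - X₁.starProjection‖ < 1)
    {S₀ S₁ G₀ G₁ A₀ A₁ Z : E →L[ℝ] E}
    (hA₀ : ∀ v, A₀ v - v ∈ X₀) (hA₀u : IsUnit A₀)
    (hS₀ : ∀ v w, inner ℝ (S₀ v) w = (inner ℝ (G₀ (A₀ v)) (A₀ w) : ℝ))
    (hA₁ : ∀ v, A₁ v - v ∈ X₁) (hA₁u : IsUnit A₁)
    (hS₁ : ∀ v w, inner ℝ (S₁ v) w = (inner ℝ (G₁ (A₁ v)) (A₁ w) : ℝ))
    (hZ : ∀ v, Z v - v ∈ X₀) (hZu : IsUnit Z)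
    (hG : ∀ v ∈ X₀, ∀ w ∈ X₀, inner ℝ (G₀ (Z v)) (Z w) =
      (inner ℝ (G₁ (X₁.starProjection v)) (X₁.starProjection w) : ℝ))
    (hS₀s : IsSkewAdjointOp S₀) (hS₀u : IsUnit (compress X₀ S₀)) :
    finiteSF₂ (compress X₀ S₀)
        (ContinuousLinearMap.adjoint (X₁.orthogonalProjectionOnto ∘L X₀.subtypeL) ∘L
          compress X₁ S₁ ∘L (X₁.orthogonalProjectionOnto ∘L X₀.subtypeL)) =
      signUnit (detOneAdd ((A₀ - 1 : E →L[ℝ] E) : E →ₗ[ℝ] E)) *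
        signUnit (detOneAdd ((Z - 1 : E →L[ℝ] E) : E →ₗ[ℝ] E)) *
        signUnit (detOneAdd ((A₁ - 1 : E →L[ℝ] E) : E →ₗ[ℝ] E)) := by
  obtain ⟨e, he⟩ := exists_equiv_of_norm_sub_lt hXY
  have he' : ∀ v : X₀, (e v : E) = X₁.starProjection v := fun v =>
    congrArg (fun f : X₀ →L[ℝ] X₁ => (f v : E)) he
  rw [← he]
  obtain ⟨u, rfl⟩ := hA₀u
  set B₀ : E →L[ℝ] E := ↑u⁻¹ with hB₀
  have hAB : ∀ v, (u : E →L[ℝ] E) (B₀ v) = v := fun v => by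
    rw [← mul_apply_eq_comp, hB₀, Units.mul_inv, one_apply_eq_self]
  have hBm : ∀ v, B₀ v - v ∈ X₀ := fun v => by
    have := X₀.neg_mem (hA₀ (B₀ v))
    rwa [hAB, neg_sub] at this
  let D : X₀ →L[ℝ] X₀ := (e.symm : X₁ →L[ℝ] X₀) ∘L compress X₁ A₁ ∘L (e : X₀ →L[ℝ] X₁)
  let C : X₀ →L[ℝ] X₀ := compress X₀ B₀ ∘L compress X₀ Z ∘L D
  have hD : ∀ v, X₁.starProjection (D v : E) = A₁ (e v) := fun v => by
    rw [← he']
    change ((e (e.symm (compress X₁ A₁ (e v)))) : E) = _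
    rw [e.apply_symm_apply, coe_compress_apply_of_mem X₁ (mem_of_sub_mem X₁ hA₁ (e v).2)]
  have hC : ∀ v, (C v : E) = B₀ (Z (D v)) := fun v => by
    have h1 : (compress X₀ Z (D v) : E) = Z (D v) :=
      coe_compress_apply_of_mem X₀ (mem_of_sub_mem X₀ hZ (D v).2)
    change (compress X₀ B₀ (compress X₀ Z (D v)) : E) = _
    rw [coe_compress_apply_of_mem X₀ (mem_of_sub_mem X₀ hBm (compress X₀ Z (D v)).2), h1]
  have hdetD : D.det = (compress X₁ A₁).det :=
    LinearMap.det_conj (compress X₁ A₁ : X₁ →ₗ[ℝ] X₁) e.symm.toLinearEquiv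
  have hdet : C.det = (compress X₀ B₀).det * ((compress X₀ Z).det * (compress X₁ A₁).det) := by
    rw [← hdetD]
    exact (LinearMap.det_comp _ _).trans (congrArg _ (LinearMap.det_comp _ _))
  have hB0 := det_compress_ne_zero X₀ hBm (Units.isUnit u⁻¹)
  have hA0 := det_compress_ne_zero X₀ hA₀ (Units.isUnit u)
  have hZ0 := det_compress_ne_zero X₀ hZ hZu
  have hA10 := det_compress_ne_zero X₁ hA₁ hA₁u
  have hBA : (compress X₀ (u : E →L[ℝ] E)).det * (compress X₀ B₀).det = 1 := by
    refine (LinearMap.det_comp _ _).symm.trans ?_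
    refine (congrArg LinearMap.det (?_ : _ = LinearMap.id)).trans LinearMap.det_id
    ext v
    change (compress X₀ (u : E →L[ℝ] E) (compress X₀ B₀ v) : E) = v
    rw [coe_compress_apply_of_mem X₀ (mem_of_sub_mem X₀ hA₀ (compress X₀ B₀ v).2),
      coe_compress_apply_of_mem X₀ (mem_of_sub_mem X₀ hBm v.2), hAB]
  have hsB : signUnit (compress X₀ B₀).det = signUnit (compress X₀ (u : E →L[ℝ] E)).det := by
    have := signUnit_mul hA0 hB0
    rw [hBA, signUnit_one] at this
    rw [← Int.units_inv_eq_self (signUnit (compress X₀ (u : E →L[ℝ] E)).det)]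
    exact (inv_eq_of_mul_eq_one_right this.symm).symm
  rw [finiteSF₂_eq (A := C) (hS₀s.skew_compress X₀) hS₀u ?_ ?_, hdet,
    signUnit_mul hB0 (mul_ne_zero hZ0 hA10), signUnit_mul hZ0 hA10, hsB, det_compress X₀ hA₀,
    det_compress X₀ hZ, det_compress X₁ hA₁, mul_assoc]
  · refine skewForm_injective ?_
    rw [skewForm_conj]
    ext v w
    change inner ℝ ((ContinuousLinearMap.adjoint (e : X₀ →L[ℝ] X₁) ∘L compress X₁ S₁ ∘L
      (e : X₀ →L[ℝ] X₁)) v) w = inner ℝ (compress X₀ S₀ (C v)) (C w)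
    rw [ContinuousLinearMap.comp_apply, ContinuousLinearMap.adjoint_inner_left,
      ContinuousLinearMap.comp_apply, inner_compress, inner_compress, hS₁, hS₀, hC, hC, hAB, hAB,
      hG _ (D v).2 _ (D w).2, hD, hD]
    rfl
  · rw [hdet]
    exact mul_ne_zero hB0 (mul_ne_zero hZ0 hA10)

end Transport

/-! ### Transporting an operator between nearby invariant subspaces -/

section TransportOp

variable {E : Type*} [NormedAddCommGroup E] [InnerProductSpace ℝ E] [CompleteSpace E]

/-- The operator which is `T` on the kernel of `Q` and `Q Q₁ G Q₁ Q` on the range of `Q`. -/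
noncomputable def transportOp (T G Q Q₁ : E →L[ℝ] E) : E →L[ℝ] E :=
  T * (1 - Q) + Q * (Q₁ * (G * (Q₁ * Q)))

variable {T G : E →L[ℝ] E} {X X₁ : Submodule ℝ E} [X.HasOrthogonalProjection]
  [X₁.HasOrthogonalProjection]

theorem transportOp_apply (T G Q Q₁ : E →L[ℝ] E) (v : E) :
    transportOp T G Q Q₁ v = T (v - Q v) + Q (Q₁ (G (Q₁ (Q v)))) := rfl

theorem transportOp_apply_of_mem {v : E} (hv : v ∈ X) :
    transportOp T G X.starProjection X₁.starProjection v =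
      X.starProjection (X₁.starProjection (G (X₁.starProjection v))) := by
  rw [transportOp_apply, Submodule.starProjection_eq_self_iff.2 hv, sub_self, map_zero, zero_add]

/-- Identifies the end of the path used in `finiteSF₂_interval`, where the two projections coincide.
-/
theorem transportOp_self (hG : ∀ v ∈ X, G v ∈ X) (hGT : ∀ v ∈ Xᗮ, G v = T v) :
    transportOp T G X.starProjection X.starProjection = G := by
  ext v
  have h1 := Submodule.starProjection_apply_mem X v
  rw [transportOp_apply, ← hGT _ (Submodule.sub_starProjection_mem_orthogonal v),
    Submodule.starProjection_eq_self_iff.2 h1, Submodule.starProjection_eq_self_iff.2 (hG _ h1),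
    Submodule.starProjection_eq_self_iff.2 (hG _ h1), ← map_add, sub_add_cancel]

/-- The operator is block diagonal for X ⊕ X⊥. On X⊥ it is T, injective because ker T ≤ X; on X it
is a chain of injective maps X → X₁ → X₁ → X, as the projections have distance less than 1. -/
theorem transportOp_eq_zero (hT : IsSkewAdjointOp T) (hTX : ∀ v ∈ X, T v ∈ X) (hker : T.ker ≤ X)
    (hG : ∀ v ∈ X₁, G v ∈ X₁) (hGi : ∀ v, G v = 0 → v = 0)
    (hX : ‖X.starProjection - X₁.starProjection‖ < 1) {v : E}
    (hv : transportOp T G X.starProjection X₁.starProjection v = 0) : v = 0 := by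
  have hX' : ‖X₁.starProjection - X.starProjection‖ < 1 := by rwa [norm_sub_rev]
  rw [transportOp_apply] at hv
  have h1 : T (v - X.starProjection v) ∈ Xᗮ :=
    hT.mem_orthogonal hTX (Submodule.sub_starProjection_mem_orthogonal v)
  have h2 : X.starProjection (T (v - X.starProjection v)) = 0 :=
    (Submodule.starProjection_apply_eq_zero_iff X).2 h1
  have h3 : X.starProjection
      (X₁.starProjection (G (X₁.starProjection (X.starProjection v)))) = 0 := by
    have := congrArg X.starProjection hv
    rwa [map_add, h2, zero_add, map_zero, Submodule.starProjection_eq_self_iff.2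
      (Submodule.starProjection_apply_mem X _)] at this
  rw [h3, add_zero] at hv
  have h4 : v - X.starProjection v = 0 := by
    have h5 : v - X.starProjection v ∈ X := hker hv
    rw [← Submodule.starProjection_eq_self_iff.2 h5, Submodule.starProjection_apply_eq_zero_iff]
    exact Submodule.sub_starProjection_mem_orthogonal v
  have h6 := eq_zero_of_starProjection_eq_zero hX' (Submodule.starProjection_apply_mem X₁ _) h3
  rw [Submodule.starProjection_eq_self_iff.2 (hG _ (Submodule.starProjection_apply_mem X₁ _))]
    at h6
  have h7 := eq_zero_of_starProjection_eq_zero hX (Submodule.starProjection_apply_mem X _)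
    (hGi _ h6)
  rw [← sub_add_cancel v (X.starProjection v), h4, h7, add_zero]

theorem finRank_transportOp_sub [FiniteDimensional ℝ X] :
    FinRank (transportOp T G X.starProjection X₁.starProjection - T) := by
  have e : transportOp T G X.starProjection X₁.starProjection - T =
      X.starProjection * (X₁.starProjection * (G * (X₁.starProjection * X.starProjection))) -
        T * X.starProjection := by
    rw [transportOp, mul_sub, mul_one]; abel
  rw [e]
  have h := finRank_starProjection X
  exact (h.mul_right _).sub (h.mul_left _)

theorem IsSkewAdjointOp.transportOp (hT : IsSkewAdjointOp T) (hTX : ∀ v ∈ X, T v ∈ X)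
    (hG : IsSkewAdjointOp G) :
    IsSkewAdjointOp (transportOp T G X.starProjection X₁.starProjection) :=
  isSkewAdjointOp_of_inner fun v w => by
    have hc := starProjection_comm_of_mem X hTX fun _ => hT.mem_orthogonal hTX
    have h1 : inner ℝ (T (v - X.starProjection v)) w =
        -(inner ℝ v (T (w - X.starProjection w)) : ℝ) := by
      rw [map_sub, map_sub, inner_sub_left, inner_sub_right, hT.inner_left, hT.inner_left,
        Submodule.inner_starProjection_left_eq_right, hc]
      ring
    rw [transportOp_apply, transportOp_apply, inner_add_left, inner_add_right, h1]
    simp only [Submodule.inner_starProjection_left_eq_right, hG.inner_left]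
    ring

theorem continuousOn_transportOp {T Q : ℝ → E →L[ℝ] E} {S : Set ℝ} (hT : ContinuousOn T S)
    (hQ : ContinuousOn Q S) (G Q₁ : E →L[ℝ] E) :
    ContinuousOn (fun t => transportOp (T t) G (Q t) Q₁) S := by
  unfold transportOp
  fun_prop

/-- G also preserves X⊥, so it maps the X⊥-component of v into X ∩ X⊥ = 0. -/
theorem IsSkewAdjointOp.mem_of_apply_mem (hG : IsSkewAdjointOp G) (hGX : ∀ v ∈ X, G v ∈ X)
    (hGi : ∀ v, G v = 0 → v = 0) {v : E} (hv : G v ∈ X) : v ∈ X := by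
  have h1 := hG.mem_orthogonal hGX (Submodule.sub_starProjection_mem_orthogonal (K := X) v)
  have h2 : G (v - X.starProjection v) ∈ X := by
    rw [map_sub]
    exact X.sub_mem hv (hGX _ (Submodule.starProjection_apply_mem X v))
  have h3 := hGi _ (Submodule.disjoint_def.1 X.orthogonal_disjoint _ h2 h1)
  rw [sub_eq_zero.1 h3]
  exact Submodule.starProjection_apply_mem X v

theorem fillKernel_mem {I P : E →L[ℝ] E} (h : IsPolarPair T I P)
    (hTX : ∀ v ∈ X, T v ∈ X) (hker : T.ker ≤ X) {v : E} (hv : v ∈ X) : fillKernel T I v ∈ X :=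
  X.add_mem (hTX v hv) (hker (h.apply_mem_ker (Submodule.starProjection_apply_mem _ _)))

theorem fillKernel_apply_of_mem_orthogonal (I : E →L[ℝ] E) (hker : T.ker ≤ X) {v : E}
    (hv : v ∈ Xᗮ) : fillKernel T I v = T v := by
  change T v + I (T.ker.starProjection v) = T v
  rw [(Submodule.starProjection_apply_eq_zero_iff _).2 (Submodule.orthogonal_le hker hv),
    map_zero, add_zero]

end TransportOp

/-! ### Congruence of odd skew-adjoint operators -/

section EvenCongruence

variable {H : Type*} [NormedAddCommGroup H] [InnerProductSpace ℝ H] [CompleteSpace H]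
  {G K : WithLp 2 (H × H) →L[ℝ] WithLp 2 (H × H)}

theorem IsOddOp.inner_apply (hG : IsOddOp G) (hGs : IsSkewAdjointOp G) (v w : WithLp 2 (H × H)) :
    inner ℝ (G v) w =
      (inner ℝ (upperRight G v.snd) w.fst : ℝ) - inner ℝ v.fst (upperRight G w.snd) := by
  conv_lhs => rw [← inclFst_add_inclSnd w, inner_add_right, hGs.inner_left v (inclSnd H w.snd),
    hG.apply_inclSnd]
  rw [WithLp.prod_inner_apply, WithLp.prod_inner_apply, ← hG.fst_apply v]
  have e : ∀ y : H, (WithLp.ofLp (inclFst H y)) = (y, 0) := fun _ => rfl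
  simp only [e, inner_zero_right, add_zero, sub_eq_add_neg]
  rfl

/-- Two odd skew-adjoint operators which differ by a finite rank operator are congruent by an
operator of the form `diag(1, z)`. -/
theorem IsOddOp.exists_congruence {X : Submodule ℝ (WithLp 2 (H × H))} [FiniteDimensional ℝ X]
    (hG : IsOddOp G) (hGs : IsSkewAdjointOp G) (hGu : IsUnit G) (hGX : ∀ v ∈ X, G v ∈ X)
    (hK : IsOddOp K) (hKs : IsSkewAdjointOp K) (hKu : IsUnit K) (hKG : ∀ v, K v - G v ∈ X) :
    ∃ Z : WithLp 2 (H × H) →L[ℝ] WithLp 2 (H × H), IsUnit Z ∧ (∀ v, Z v - v ∈ X) ∧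
      (∀ v w, inner ℝ (G (Z v)) (Z w) = (inner ℝ (K v) w : ℝ)) ∧
      signUnit (detOneAdd ((Z - 1 : WithLp 2 (H × H) →L[ℝ] WithLp 2 (H × H)) :
        WithLp 2 (H × H) →ₗ[ℝ] WithLp 2 (H × H))) = relSign (upperRight G) (upperRight K) := by
  have hgu := hG.isUnit_upperRight hGu
  set g := upperRight G with hg
  set k := upperRight K with hk
  -- The form of an odd skew-adjoint operator is ⟪g y, x'⟫ - ⟪x, g y'⟫. Substituting z y for y,
  -- where g z = k, turns the form of G into that of K.
  set z : H →L[ℝ] H := Ring.inverse g * k with hz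
  have hgz : ∀ y, g (z y) = k y := fun y => by
    rw [← mul_apply_eq_comp, hz, ← mul_assoc, Ring.mul_inverse_cancel _ hgu, one_mul]
  have hGi : ∀ v, G v = 0 → v = 0 := fun v =>
    (injective_iff_map_eq_zero G).1 ((ContinuousLinearMap.isUnit_iff_bijective.1 hGu).1) v
  have hKi : ∀ v, K v = 0 → v = 0 := fun v =>
    (injective_iff_map_eq_zero K).1 ((ContinuousLinearMap.isUnit_iff_bijective.1 hKu).1) v
  let Z : WithLp 2 (H × H) →L[ℝ] WithLp 2 (H × H) := 1 + inclSnd H ∘L (z - 1) ∘L projSnd H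
  have hZ : ∀ v, Z v = v + inclSnd H (z v.snd - v.snd) := fun v => rfl
  have hZX : ∀ v, Z v - v ∈ X := fun v => by
    rw [hZ, add_sub_cancel_left]
    refine hGs.mem_of_apply_mem hGX hGi ?_
    rw [hG.apply_inclSnd, map_sub, ← hg, hgz, map_sub, hk, hg, ← hK.apply_inclSnd,
      ← hG.apply_inclSnd]
    exact hKG _
  have hcong : ∀ v w, inner ℝ (G (Z v)) (Z w) = (inner ℝ (K v) w : ℝ) := fun v w => by
    have h1 : ∀ v, (Z v).fst = v.fst := fun v => by rw [hZ]; simp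
    have h2 : ∀ v, (Z v).snd = z v.snd := fun v => by rw [hZ]; simp
    rw [hG.inner_apply hGs, hK.inner_apply hKs, h1, h1, h2, h2, ← hg, ← hk, hgz, hgz]
  refine ⟨Z, ?_, hZX, hcong, ?_⟩
  · refine isUnit_of_finRank_of_injective isUnit_one (FinRank.of_mem X hZX) ?_
    rw [injective_iff_map_eq_zero]
    intro v hv
    refine hKi v (ext_inner_right ℝ fun w => ?_)
    rw [← hcong, hv, map_zero, inner_zero_left, inner_zero_left]
  · have hkg : FinRank (k - g) := by
      rw [hk, hg, ← upperRight_sub]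
      exact (FinRank.of_mem X hKG).upperRight
    have hz1 : FinRank (z - 1) := by
      have : z - 1 = Ring.inverse g * (k - g) := by
        rw [mul_sub, Ring.inverse_mul_cancel _ hgu]
      rw [this]
      exact hkg.mul_left _
    -- The relative sign of g and k is that of 1 and z = g⁻¹ k, and diag(1, z) has the same
    -- determinant as z.
    rw [← relSign_mul_left hgu hkg hgu.ringInverse, Ring.inverse_mul_cancel _ hgu]
    unfold relSign
    rw [Ring.inverse_one, mul_one]
    congr 1
    refine Eq.trans ?_ (detOneAdd_conj hz1 (inclSnd H : H →ₗ[ℝ] WithLp 2 (H × H))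
      (projSnd H : WithLp 2 (H × H) →ₗ[ℝ] H) (by ext y; rfl))
    congr 1
    ext1 v
    change Z v - v = inclSnd H (z v.snd - v.snd)
    rw [hZ, add_sub_cancel_left]

end EvenCongruence

/-! ### The value of the `ℤ₂`-valued spectral flow -/

section Generic

variable {E : Type*} [NormedAddCommGroup E] [InnerProductSpace ℝ E] [CompleteSpace E]

theorem eq_zero_of_isUnit_compressed {T R : E →L[ℝ] E} {a : ℝ} (ha : 0 < a)
    (h : IsUnit (compressed T R a)) {v : E} (hT : T v = 0) (hR : R v = 0) : v = 0 := by
  have hv : v ∈ spectralSubspace T a := ker_le_spectralSubspace T ha hT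
  have hi := (ContinuousLinearMap.isUnit_iff_bijective.1 h).1
  have h1 : compressed T R a ⟨v, hv⟩ = 0 := by
    change (spectralSubspace T a).orthogonalProjectionOnto (T v + R v) = 0
    rw [hT, hR, add_zero, map_zero]
  exact congrArg Subtype.val ((injective_iff_map_eq_zero _).1 hi _ h1)

theorem sub_mem_of_transportOp {T I P G : E →L[ℝ] E} (h : IsPolarPair T I P)
    {X X₁ : Submodule ℝ E} [X.HasOrthogonalProjection] [X₁.HasOrthogonalProjection]
    (hTX : ∀ v ∈ X, T v ∈ X) (hker : T.ker ≤ X) (v : E) :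
    transportOp T G X.starProjection X₁.starProjection v - fillKernel T I v ∈ X := by
  have hp := Submodule.starProjection_apply_mem X v
  have h1 := fillKernel_apply_of_mem_orthogonal I hker
    (Submodule.sub_starProjection_mem_orthogonal (K := X) v)
  have h2 : fillKernel T I v =
      T (v - X.starProjection v) + fillKernel T I (X.starProjection v) := by
    rw [← h1, ← map_add, sub_add_cancel]
  rw [transportOp_apply, h2, add_sub_add_left_eq_sub]
  exact X.sub_mem (Submodule.starProjection_apply_mem X _) (fillKernel_mem h hTX hker hp)

theorem inner_transportOp {T G : E →L[ℝ] E} {X X₁ : Submodule ℝ E} [X.HasOrthogonalProjection]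
    [X₁.HasOrthogonalProjection] {v w : E} (hv : v ∈ X) (hw : w ∈ X) :
    inner ℝ (transportOp T G X.starProjection X₁.starProjection v) w =
      (inner ℝ (G (X₁.starProjection v)) (X₁.starProjection w) : ℝ) := by
  rw [transportOp_apply_of_mem hv, Submodule.inner_starProjection_left_eq_right,
    Submodule.starProjection_eq_self_iff.2 hw, Submodule.inner_starProjection_left_eq_right]

theorem isUnit_transportOp {T G I P V : E →L[ℝ] E} (h : IsPolarPair T I P)
    (hV : FinRank (V * T - 1)) {X X₁ : Submodule ℝ E} [FiniteDimensional ℝ X]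
    [X.HasOrthogonalProjection] [X₁.HasOrthogonalProjection]
    (hTX : ∀ v ∈ X, T v ∈ X) (hker : T.ker ≤ X) (hG : ∀ v ∈ X₁, G v ∈ X₁) (hGu : IsUnit G)
    (hX : ‖X.starProjection - X₁.starProjection‖ < 1) :
    IsUnit (transportOp T G X.starProjection X₁.starProjection) := by
  have := finiteDimensional_ker_of_finRank hV
  refine isUnit_of_finRank_of_injective (h.isUnit_fillKernel hV) ?_
    ((injective_iff_map_eq_zero _).2 fun v hv => transportOp_eq_zero h.skew hTX hker hG
      ((injective_iff_map_eq_zero G).1 ((ContinuousLinearMap.isUnit_iff_bijective.1 hGu).1)) hX hv)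
  have e : transportOp T G X.starProjection X₁.starProjection - fillKernel T I =
      (transportOp T G X.starProjection X₁.starProjection - T) - (fillKernel T I - T) := by abel
  rw [e]
  exact finRank_transportOp_sub.sub IsPolarPair.finRank_fillKernel_sub

end Generic

section Value

variable {H : Type*} [NormedAddCommGroup H] [InnerProductSpace ℝ H] [CompleteSpace H]

theorem grading_mem_spectralSubspace {T : WithLp 2 (H × H) →L[ℝ] WithLp 2 (H × H)}
    (hT : IsOddOp T) {a : ℝ} {v : WithLp 2 (H × H)} (hv : v ∈ spectralSubspace T a) :
    grading H v ∈ spectralSubspace T a :=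
  mem_spectralSubspace_of_anticommute (fun v => by rw [hT, neg_neg]) hv

theorem isOddOp_transportOp {T G : WithLp 2 (H × H) →L[ℝ] WithLp 2 (H × H)}
    {X X₁ : Submodule ℝ (WithLp 2 (H × H))} [X.HasOrthogonalProjection]
    [X₁.HasOrthogonalProjection] (hT : IsOddOp T) (hG : IsOddOp G)
    (hX : ∀ v ∈ X, grading H v ∈ X) (hX₁ : ∀ v ∈ X₁, grading H v ∈ X₁) :
    IsOddOp (transportOp T G X.starProjection X₁.starProjection) := by
  have h := isEvenOp_starProjection X hX
  have h₁ := isEvenOp_starProjection X₁ hX₁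
  exact (hT.mul_even (IsEvenOp.one.sub h)).add
    (((hG.mul_even (h₁.mul h)).even_mul h₁).even_mul h)

variable {B : ℝ → H →L[ℝ] H} {I : ℝ → WithLp 2 (H × H) →L[ℝ] WithLp 2 (H × H)}

set_option maxHeartbeats 800000 in
/-- The contribution of one interval to the `ℤ₂`-valued spectral flow. -/
theorem finiteSF₂_interval (hB : IsAdmissiblePath B)
    (hI : ∀ t ∈ Icc (0 : ℝ) 1, CompletesPhase (chiralOp (B t)) (I t)) {K : ℝ → H →L[ℝ] H}
    (hKc : ContinuousOn K (Icc 0 1))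
    (hK : ∀ t ∈ Icc (0 : ℝ) 1, IsUnit (K t) ∧ FinRank (K t - B t)) {s₀ s₁ a : ℝ} (ha : 0 < a)
    (h01 : s₀ ≤ s₁) (hsub : Icc s₀ s₁ ⊆ Icc 0 1)
    (hfin : ∀ t ∈ Icc s₀ s₁, FiniteDimensional ℝ (spectralSubspace (chiralOp (B t)) a))
    (hQc : ContinuousOn (fun t => spectralProj (chiralOp (B t)) a) (Icc s₀ s₁))
    (hclose : ∀ t ∈ Icc s₀ s₁, ∀ t' ∈ Icc s₀ s₁,
      ‖spectralProj (chiralOp (B t)) a - spectralProj (chiralOp (B t')) a‖ < 1)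
    {R₀ R₁ A₀ A₁ : WithLp 2 (H × H) →L[ℝ] WithLp 2 (H × H)} (hR₀ : IsSkewAdjointOp R₀)
    (hu₀ : IsUnit (compressed (chiralOp (B s₀)) R₀ a))
    (hA₀u : IsUnit A₀) (hA₀ : ∀ v, A₀ v - v ∈ (chiralOp (B s₀)).ker)
    (hA₀R : ∀ v w, inner ℝ ((chiralOp (B s₀) + R₀) v) w =
      (inner ℝ (fillKernel (chiralOp (B s₀)) (I s₀) (A₀ v)) (A₀ w) : ℝ))
    (hA₁u : IsUnit A₁) (hA₁ : ∀ v, A₁ v - v ∈ (chiralOp (B s₁)).ker)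
    (hA₁R : ∀ v w, inner ℝ ((chiralOp (B s₁) + R₁) v) w =
      (inner ℝ (fillKernel (chiralOp (B s₁)) (I s₁) (A₁ v)) (A₁ w) : ℝ)) :
    finiteSF₂ (compressed (chiralOp (B s₀)) R₀ a)
      (ContinuousLinearMap.adjoint (spectralTransport (chiralOp (B s₀)) (chiralOp (B s₁)) a) ∘L
        compressed (chiralOp (B s₁)) R₁ a ∘L
        spectralTransport (chiralOp (B s₀)) (chiralOp (B s₁)) a) =
    (signUnit (detOneAdd ((A₀ - 1 : WithLp 2 (H × H) →L[ℝ] WithLp 2 (H × H)) :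
        WithLp 2 (H × H) →ₗ[ℝ] WithLp 2 (H × H))) *
      relSign (K s₀) (upperRight (fillKernel (chiralOp (B s₀)) (I s₀)))) *
    (signUnit (detOneAdd ((A₁ - 1 : WithLp 2 (H × H) →L[ℝ] WithLp 2 (H × H)) :
        WithLp 2 (H × H) →ₗ[ℝ] WithLp 2 (H × H))) *
      relSign (K s₁) (upperRight (fillKernel (chiralOp (B s₁)) (I s₁)))) := by
  have hs₀ : s₀ ∈ Icc s₀ s₁ := left_mem_Icc.2 h01
  have hs₁ : s₁ ∈ Icc s₀ s₁ := right_mem_Icc.2 h01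
  obtain ⟨P₀, h₀⟩ := (hI s₀ (hsub hs₀)).exists_isPolarPair
  obtain ⟨P₁, h₁⟩ := (hI s₁ (hsub hs₁)).exists_isPolarPair
  obtain ⟨V₀, hV₀⟩ := exists_finRank_mul_chiralOp_sub_one (hB.isFredholm s₀ (hsub hs₀))
  obtain ⟨V₁, hV₁⟩ := exists_finRank_mul_chiralOp_sub_one (hB.isFredholm s₁ (hsub hs₁))
  have hfin₀ := hfin s₀ hs₀
  have hfin₁ := hfin s₁ hs₁
  have hkfin₀ := finiteDimensional_ker_of_finRank hV₀
  have hkfin₁ := finiteDimensional_ker_of_finRank hV₁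
  set X : ℝ → Submodule ℝ (WithLp 2 (H × H)) := fun t => spectralSubspace (chiralOp (B t)) a with hX
  have hTX : ∀ t, ∀ v ∈ X t, chiralOp (B t) v ∈ X t := fun t v hv => apply_mem_spectralSubspace _ hv
  have hJX : ∀ t, ∀ v ∈ X t, grading H v ∈ X t := fun t v hv =>
    grading_mem_spectralSubspace (isOddOp_chiralOp _) hv
  have hker : ∀ t, (chiralOp (B t)).ker ≤ X t := fun t => ker_le_spectralSubspace _ ha
  set G₀ := fillKernel (chiralOp (B s₀)) (I s₀) with hG₀
  set G₁ := fillKernel (chiralOp (B s₁)) (I s₁) with hG₁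
  have hG₀o : IsOddOp G₀ :=
    IsPolarPair.odd_fillKernel (isOddOp_chiralOp _) (hI s₀ (hsub hs₀)).1.isOddOp
  have hG₁o : IsOddOp G₁ :=
    IsPolarPair.odd_fillKernel (isOddOp_chiralOp _) (hI s₁ (hsub hs₁)).1.isOddOp
  have hG₀u : IsUnit G₀ := h₀.isUnit_fillKernel hV₀
  have hG₁u : IsUnit G₁ := h₁.isUnit_fillKernel hV₁
  have hG₀X : ∀ v ∈ X s₀, G₀ v ∈ X s₀ := fun v hv => fillKernel_mem h₀ (hTX s₀) (hker s₀) hv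
  have hG₁X : ∀ v ∈ X s₁, G₁ v ∈ X s₁ := fun v hv => fillKernel_mem h₁ (hTX s₁) (hker s₁) hv
  -- A path of odd invertible operators that ends in G₁ at s₁; on the spectral subspace at s₀ it
  -- starts with the pull-back of G₁.
  set L : ℝ → WithLp 2 (H × H) →L[ℝ] WithLp 2 (H × H) := fun t =>
    transportOp (chiralOp (B t)) G₁ (spectralProj (chiralOp (B t)) a)
      (spectralProj (chiralOp (B s₁)) a) with hL
  have hLo : ∀ t, IsOddOp (L t) := fun t =>
    isOddOp_transportOp (isOddOp_chiralOp _) hG₁o (hJX t) (hJX s₁)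
  have hLs : ∀ t, IsSkewAdjointOp (L t) := fun t =>
    (isSkewAdjointOp_chiralOp (B t)).transportOp (hTX t) h₁.skew_fillKernel
  have hLu : ∀ t ∈ Icc s₀ s₁, IsUnit (L t) := fun t ht => by
    obtain ⟨P, h⟩ := (hI t (hsub ht)).exists_isPolarPair
    obtain ⟨V, hV⟩ := exists_finRank_mul_chiralOp_sub_one (hB.isFredholm t (hsub ht))
    have := hfin t ht
    exact isUnit_transportOp h hV (hTX t) (hker t) hG₁X hG₁u (hclose t ht s₁ hs₁)
  have hLf : ∀ t ∈ Icc s₀ s₁, FinRank (upperRight (L t) - B t) := fun t ht => by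
    have := hfin t ht
    have e : upperRight (L t) - B t = upperRight (L t - chiralOp (B t)) := by
      rw [upperRight_sub, upperRight_chiralOp]
    rw [e]
    exact finRank_transportOp_sub.upperRight
  have hL₁ : L s₁ = G₁ :=
    transportOp_self hG₁X fun v hv => fillKernel_apply_of_mem_orthogonal _ (hker s₁) hv
  have hLK : ∀ t ∈ Icc s₀ s₁, FinRank (upperRight (L t) - K t) := fun t ht => by
    have e : upperRight (L t) - K t = (upperRight (L t) - B t) - (K t - B t) := by abel
    rw [e]
    exact (hLf t ht).sub (hK t (hsub ht)).2
  have hTc : ContinuousOn (fun t => chiralOp (B t)) (Icc s₀ s₁) :=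
    (continuous_chiralOp.comp_continuousOn hB.continuousOn).mono hsub
  have hLc : ContinuousOn L (Icc s₀ s₁) := continuousOn_transportOp hTc hQc _ _
  -- The sign of the block of `L t` relative to `K t` is the same at s₀ and s₁, and at s₁ it
  -- involves G₁ only.
  have hconst := relSign_eq_of_preconnected (isPreconnected_Icc (a := s₀) (b := s₁)) (X := K)
    (Y := fun t => upperRight (L t)) (hKc.mono hsub) (continuous_upperRight.comp_continuousOn hLc)
    (fun t ht => (hK t (hsub ht)).1) (fun t ht => (hLo t).isUnit_upperRight (hLu t ht)) hLK hs₀ hs₁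
  -- Z carries G₀ to `L s₀`; by the cocycle rule its sign becomes the product of the signs of G₀ and
  -- G₁ relative to K.
  obtain ⟨Z, hZu, hZX, hZ, hZs⟩ := hG₀o.exists_congruence (X := X s₀) h₀.skew_fillKernel hG₀u hG₀X
    (hLo s₀) (hLs s₀) (hLu s₀ hs₀) (sub_mem_of_transportOp h₀ (hTX s₀) (hker s₀))
  have hg₀u := hG₀o.isUnit_upperRight hG₀u
  have hg₀K : FinRank (upperRight G₀ - K s₀) := by
    have e : upperRight G₀ - K s₀ =
        upperRight (G₀ - chiralOp (B s₀)) - (K s₀ - B s₀) := by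
      rw [upperRight_sub, upperRight_chiralOp]; abel
    have h1 : FinRank (G₀ - chiralOp (B s₀)) := IsPolarPair.finRank_fillKernel_sub
    rw [e]
    exact h1.upperRight.sub (hK s₀ (hsub hs₀)).2
  have hLg : FinRank (upperRight (L s₀) - upperRight G₀) := by
    have e : upperRight (L s₀) - upperRight G₀ =
        (upperRight (L s₀) - K s₀) - (upperRight G₀ - K s₀) := by abel
    rw [e]
    exact (hLK s₀ hs₀).sub hg₀K
  have hsplit := relSign_mul_relSign (hK s₀ (hsub hs₀)).1 hg₀u
    ((hLo s₀).isUnit_upperRight (hLu s₀ hs₀)) hg₀K hLg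
  have hZs' : signUnit (detOneAdd ((Z - 1 : WithLp 2 (H × H) →L[ℝ] WithLp 2 (H × H)) :
      WithLp 2 (H × H) →ₗ[ℝ] WithLp 2 (H × H))) =
      relSign (K s₀) (upperRight G₀) * relSign (K s₁) (upperRight G₁) := by
    rw [hZs, ← hL₁, ← hconst, ← hsplit, ← mul_assoc, Int.units_mul_self, one_mul]
  have hmain := finiteSF₂_transport (X₀ := X s₀) (X₁ := X s₁) (hclose s₀ hs₀ s₁ hs₁)
    (fun v => hker s₀ (hA₀ v)) hA₀u hA₀R (fun v => hker s₁ (hA₁ v)) hA₁u hA₁R hZX hZu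
    (fun v hv w hw => (hZ v w).trans (inner_transportOp hv hw))
    (isSkewAdjointOp_of_inner fun v w => by
      rw [add_apply, add_apply, inner_add_left, inner_add_right, h₀.skew.inner_left,
        hR₀.inner_left, neg_add]) hu₀
  refine hmain.trans ?_
  rw [hZs']
  have hcomm : ∀ x y z w : ℤˣ, x * (y * z) * w = x * y * (w * z) := fun x y z w => by
    rw [mul_comm w z, mul_assoc, mul_assoc, mul_assoc]
  exact hcomm _ _ _ _

theorem prod_telescope {M : Type*} [CommMonoid M] (h : ∀ x : M, x * x = 1) :
    ∀ (N : ℕ) (f : Fin (N + 1) → M), ∏ n : Fin N, f n.castSucc * f n.succ = f 0 * f (Fin.last N)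
  | 0, f => by simp [h]
  | N + 1, f => by
    rw [Fin.prod_univ_castSucc]
    simp only [Fin.succ_castSucc]
    rw [prod_telescope h N fun n => f n.castSucc]
    have := h (f (Fin.last N).castSucc)
    simp only [Fin.castSucc_zero, Fin.succ_last]
    rw [mul_assoc, ← mul_assoc (f (Fin.last N).castSucc), this, one_mul]

theorem UnitPartition.N_pos (p : UnitPartition) : 0 < p.N := by
  rcases Nat.eq_zero_or_pos p.N with h | h
  · exfalso
    have e : (0 : Fin (p.N + 1)) = Fin.last p.N := by
      ext; simp [h]
    have h0 := p.pt_zero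
    rw [e, p.pt_last] at h0
    exact one_ne_zero h0
  · exact h

theorem UnitPartition.pt_mem (p : UnitPartition) (n : Fin (p.N + 1)) : p.pt n ∈ Icc (0 : ℝ) 1 := by
  constructor
  · rw [← p.pt_zero]
    exact p.strictMono.monotone (Fin.zero_le n)
  · rw [← p.pt_last]
    exact p.strictMono.monotone (Fin.le_last n)

/-- Where T has trivial kernel A is the identity; so the choice of R does not matter at the ends of
the path. -/
theorem signUnit_detOneAdd_eq_one {T A : WithLp 2 (H × H) →L[ℝ] WithLp 2 (H × H)}
    (hT : ∀ v, T v = 0 → v = 0) (hA : ∀ v, A v - v ∈ T.ker) :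
    signUnit (detOneAdd ((A - 1 : WithLp 2 (H × H) →L[ℝ] WithLp 2 (H × H)) :
      WithLp 2 (H × H) →ₗ[ℝ] WithLp 2 (H × H))) = 1 := by
  have : ((A - 1 : WithLp 2 (H × H) →L[ℝ] WithLp 2 (H × H)) :
      WithLp 2 (H × H) →ₗ[ℝ] WithLp 2 (H × H)) = 0 :=
    LinearMap.ext fun v => hT _ (hA v)
  rw [this, detOneAdd_zero, signUnit_one]

theorem chiralOp_eq_zero {B : H →L[ℝ] H} (hB : IsUnit B) {v : WithLp 2 (H × H)}
    (hv : chiralOp B v = 0) : v = 0 := by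
  have hadj : IsUnit (ContinuousLinearMap.adjoint B) := hB.star
  have h1 : B v.snd = 0 := congrArg (fun v : WithLp 2 (H × H) => v.fst) hv
  have h2 : -ContinuousLinearMap.adjoint B v.fst = 0 :=
    congrArg (fun v : WithLp 2 (H × H) => v.snd) hv
  have hinj : ∀ {C : H →L[ℝ] H}, IsUnit C → ∀ {y}, C y = 0 → y = 0 := fun {C} hC {y} =>
    (injective_iff_map_eq_zero C).1 (ContinuousLinearMap.isUnit_iff_bijective.1 hC).1 y
  exact doubled_ext (hinj hadj (neg_eq_zero.1 h2)) (hinj hB h1)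

/-- Every choice of data for the `ℤ₂`-valued spectral flow gives the same value. -/
theorem SpectralFlowData.value_eq (hB : IsAdmissiblePath B)
    (hI : ∀ t ∈ Icc (0 : ℝ) 1, CompletesPhase (chiralOp (B t)) (I t)) {K : ℝ → H →L[ℝ] H}
    (hKc : ContinuousOn K (Icc 0 1))
    (hK : ∀ t ∈ Icc (0 : ℝ) 1, IsUnit (K t) ∧ FinRank (K t - B t))
    (d : SpectralFlowData fun t => chiralOp (B t)) :
    d.value = relSign (K 0) (upperRight (fillKernel (chiralOp (B 0)) (I 0))) *
      relSign (K 1) (upperRight (fillKernel (chiralOp (B 1)) (I 1))) := by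
  -- Every partition point bounds some interval, the last one only from the right, and invertibility
  -- of the compression there excludes a common null vector of T and R.
  have hinj : ∀ n, ∀ v, chiralOp (B (d.pt n)) v = 0 → d.R n v = 0 → v = 0 := fun n v h1 h2 => by
    obtain ⟨N, hN⟩ : ∃ N, d.N = N + 1 := ⟨d.N - 1, by have := d.N_pos; omega⟩
    induction n using Fin.lastCases with
    | last =>
      have e : Fin.last d.N = (⟨N, by omega⟩ : Fin d.N).succ := by ext; simp [hN]
      rw [e] at h1 h2
      exact eq_zero_of_isUnit_compressed (d.a_pos _) (d.isUnit_right _) h1 h2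
    | cast n => exact eq_zero_of_isUnit_compressed (d.a_pos _) (d.isUnit_left n) h1 h2
  have hA : ∀ n, ∃ A : WithLp 2 (H × H) →L[ℝ] WithLp 2 (H × H), IsUnit A ∧
      (∀ v, A v - v ∈ (chiralOp (B (d.pt n))).ker) ∧
      ∀ v w, inner ℝ ((chiralOp (B (d.pt n)) + d.R n) v) w =
        (inner ℝ (fillKernel (chiralOp (B (d.pt n))) (I (d.pt n)) (A v)) (A w) : ℝ) := fun n => by
    obtain ⟨P, h⟩ := (hI _ (d.pt_mem n)).exists_isPolarPair
    obtain ⟨V, hV⟩ := exists_finRank_mul_chiralOp_sub_one (hB.isFredholm _ (d.pt_mem n))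
    have := finiteDimensional_ker_of_finRank hV
    exact h.exists_kernel_congruence (d.R_skew n) (d.R_range n) (hinj n)
  choose A hAu hAk hAR using hA
  -- The first factor records the choice of `R n`. It enters both adjacent intervals and cancels,
  -- and at the two ends it is 1.
  let f : Fin (d.N + 1) → ℤˣ := fun n =>
    signUnit (detOneAdd ((A n - 1 : WithLp 2 (H × H) →L[ℝ] WithLp 2 (H × H)) :
        WithLp 2 (H × H) →ₗ[ℝ] WithLp 2 (H × H))) *
      relSign (K (d.pt n)) (upperRight (fillKernel (chiralOp (B (d.pt n))) (I (d.pt n))))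
  have hval : d.value = ∏ n : Fin d.N, f n.castSucc * f n.succ := by
    refine Finset.prod_congr rfl fun n _ => ?_
    exact finiteSF₂_interval hB hI hKc hK (d.a_pos n)
      (d.strictMono.monotone (Fin.castSucc_lt_succ (i := n)).le)
      (Icc_subset_Icc (d.pt_mem _).1 (d.pt_mem _).2) (d.finite_rank n) (d.continuousOn_proj n)
      (d.proj_close n) (d.R_skew _) (d.isUnit_left n) (hAu _) (hAk _) (hAR _) (hAu _) (hAk _)
      (hAR _)
  have hend : ∀ n, IsUnit (B (d.pt n)) → f n =
      relSign (K (d.pt n)) (upperRight (fillKernel (chiralOp (B (d.pt n))) (I (d.pt n)))) :=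
    fun n hn => by
      change signUnit _ * _ = _
      rw [signUnit_detOneAdd_eq_one (fun _ => chiralOp_eq_zero hn) (hAk n), one_mul]
  rw [hval, prod_telescope Int.units_mul_self, hend, hend, d.pt_zero, d.pt_last]
  · rw [d.pt_last]; exact hB.isUnit_one
  · rw [d.pt_zero]; exact hB.isUnit_zero

end Value

/-! ### Spectral subspaces in a spectral gap -/

section Gap

variable {E : Type*} [NormedAddCommGroup E] [InnerProductSpace ℝ E] [CompleteSpace E]
  {T : E →L[ℝ] E}

theorem IsSkewAdjointOp.norm_apply_sq_le (hT : IsSkewAdjointOp T) (v : E) :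
    ‖T v‖ ^ 2 ≤ ‖v‖ * ‖T (T v)‖ := by
  rw [← real_inner_self_eq_norm_sq, hT.inner_left]
  exact (neg_le_abs _).trans (abs_real_inner_le_norm _ _)

/-- ‖Tⁿ v‖ is log-convex in n, so its successive ratios do not decrease. A first ratio r > b would
give ‖Tⁿ v‖ ≥ rⁿ ‖v‖, against the growth bound C bⁿ. -/
theorem IsSkewAdjointOp.norm_apply_le_of_pow_le (hT : IsSkewAdjointOp T) {b C : ℝ} (hb : 0 ≤ b)
    {v : E} (h : ∀ n : ℕ, ‖(T ^ n) v‖ ≤ C * b ^ n) : ‖T v‖ ≤ b * ‖v‖ := by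
  by_contra! hlt
  have hv : 0 < ‖v‖ := by
    rcases (norm_nonneg v).eq_or_lt with h0 | h0
    · rw [norm_eq_zero.1 h0.symm] at hlt
      simp at hlt
    · exact h0
  set r := ‖T v‖ / ‖v‖ with hr
  have hbr : b < r := by rwa [hr, lt_div_iff₀ hv]
  have hr0 : 0 < r := hb.trans_lt hbr
  have hsucc : ∀ n, (T ^ (n + 1)) v = T ((T ^ n) v) := fun n => by
    rw [pow_succ', mul_apply_eq_comp]
  have hstep : ∀ n, 0 < ‖(T ^ n) v‖ ∧ r * ‖(T ^ n) v‖ ≤ ‖(T ^ (n + 1)) v‖ := by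
    intro n
    induction n with
    | zero =>
      refine ⟨by simpa using hv, ?_⟩
      rw [hsucc, hr]
      simp only [pow_zero, one_apply_eq_self]
      rw [div_mul_cancel₀ _ hv.ne']
    | succ n ih =>
      obtain ⟨h1, h2⟩ := ih
      have h3 : 0 < ‖(T ^ (n + 1)) v‖ := (mul_pos hr0 h1).trans_le h2
      refine ⟨h3, ?_⟩
      have h4 := hT.norm_apply_sq_le ((T ^ n) v)
      rw [← hsucc, ← hsucc] at h4
      refine le_of_mul_le_mul_left ?_ h1
      nlinarith
  have hpow : ∀ n, r ^ n * ‖v‖ ≤ ‖(T ^ n) v‖ := by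
    intro n
    induction n with
    | zero => simp
    | succ n ih =>
      refine le_trans ?_ (hstep n).2
      rw [pow_succ', mul_assoc]
      exact mul_le_mul_of_nonneg_left ih hr0.le
  have hle : ∀ n, ‖v‖ ≤ C * (b / r) ^ n := fun n => by
    rw [div_pow, mul_div_assoc', le_div_iff₀ (pow_pos hr0 n), mul_comm]
    exact (hpow n).trans (h n)
  have hlim : Tendsto (fun n : ℕ => C * (b / r) ^ n) atTop (𝓝 0) := by
    have := (tendsto_pow_atTop_nhds_zero_of_lt_one (div_nonneg hb hr0.le)
      ((div_lt_one hr0).2 hbr)).const_mul C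
    rwa [mul_zero] at this
  exact absurd (ge_of_tendsto' hlim hle) (not_le.2 hv)

theorem IsSkewAdjointOp.norm_apply_le_of_mem (hT : IsSkewAdjointOp T) {a : ℝ} {v : E}
    (hv : v ∈ spectralSubspace T a) : ‖T v‖ ≤ a * ‖v‖ := by
  have hcl : IsClosed {v : E | ‖T v‖ ≤ a * ‖v‖} := isClosed_le (by fun_prop) (by fun_prop)
  refine closure_minimal (?_ : (preSpectralSubspace T a : Set E) ⊆ _) hcl hv
  rintro w (⟨b, C, hb, hba, hw⟩ | hw)
  · exact (hT.norm_apply_le_of_pow_le hb hw).trans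
      (mul_le_mul_of_nonneg_right hba.le (norm_nonneg w))
  · rw [mem_singleton_iff.1 hw]
    simp

theorem spectralSubspace_mono (T : E →L[ℝ] E) {a a' : ℝ} (h : a ≤ a') :
    spectralSubspace T a ≤ spectralSubspace T a' := by
  refine Submodule.topologicalClosure_mono ?_
  rintro w (⟨b, C, hb, hba, hw⟩ | hw)
  · exact Or.inl ⟨b, C, hb, hba.trans_le h, hw⟩
  · exact Or.inr hw

/-- The eigenvalue equation gives ‖Tⁿ v‖ = √μⁿ ‖v‖. -/
theorem IsSkewAdjointOp.mem_spectralSubspace_of_eigenvector (hT : IsSkewAdjointOp T) {a μ : ℝ}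
    (ha : 0 < a) (hμ : 0 ≤ μ) (hμa : μ < a ^ 2) {v : E} (hv : T (T v) = -(μ • v)) :
    v ∈ spectralSubspace T a := by
  refine Submodule.le_topologicalClosure _ (Or.inl ⟨√μ, ‖v‖, Real.sqrt_nonneg μ, ?_, fun n => ?_⟩)
  · rw [← Real.sqrt_sq ha.le]
    exact Real.sqrt_lt_sqrt hμ hμa
  · have hsucc : ∀ n, (T ^ (n + 1)) v = T ((T ^ n) v) := fun n => by
      rw [pow_succ', mul_apply_eq_comp]
    have heig : ∀ n, T (T ((T ^ n) v)) = -(μ • (T ^ n) v) := by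
      intro n
      induction n with
      | zero => simpa using hv
      | succ n ih => rw [hsucc, ih, map_neg, map_smul]
    induction n with
    | zero => simp
    | succ n ih =>
      have h1 : ‖T ((T ^ n) v)‖ ^ 2 = (√μ * ‖(T ^ n) v‖) ^ 2 := by
        rw [← real_inner_self_eq_norm_sq, hT.inner_left, heig, inner_neg_right, neg_neg,
          inner_smul_right, real_inner_self_eq_norm_sq, mul_pow, Real.sq_sqrt hμ]
      rw [sq_eq_sq₀ (norm_nonneg _) (by positivity)] at h1
      rw [hsucc, h1, pow_succ']
      calc √μ * ‖(T ^ n) v‖ ≤ √μ * (‖v‖ * √μ ^ n) :=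
            mul_le_mul_of_nonneg_left ih (Real.sqrt_nonneg μ)
        _ = ‖v‖ * (√μ * √μ ^ n) := by ring

/-- If `T` is bounded below by `g` on a subspace of finite codimension and `μ < g²`, then
`T* T - μ` has a left inverse modulo operators of finite rank. -/
theorem IsSkewAdjointOp.exists_finRank_mul_sub_one (hT : IsSkewAdjointOp T) {N : Submodule ℝ E}
    [FiniteDimensional ℝ N] {ε g μ : ℝ} (hε : 0 ≤ ε) (hg0 : 0 ≤ g)
    (hN : ∀ v ∈ N, ‖T v‖ ≤ ε * ‖v‖) (hg : ∀ v ∈ Nᗮ, g * ‖v‖ ≤ ‖T v‖) (hμg : μ < g ^ 2) :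
    ∃ V : E →L[ℝ] E, FinRank (V * (-(T * T) - μ • 1) - 1) := by
  set d := g ^ 2 - μ with hd
  have hd0 : 0 < d := sub_pos.2 hμg
  -- This c makes T* T - μ + c Q at least d / 2, where Q projects onto N. Young's inequality splits
  -- the cross term between N⊥, where d / 2 of the available d pays for it, and N, where it costs 2
  -- g² ε² / d.
  set c := μ + 2 * g ^ 2 * ε ^ 2 / d + d / 2 with hc
  set D : E →L[ℝ] E := -(T * T) - μ • 1 with hD
  have hunit : IsUnit (D + c • N.starProjection) := by
    refine ContinuousLinearMap.isUnit_of_forall_le_norm_inner_map _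
      (c := ⟨d / 2, by positivity⟩) (by exact half_pos hd0) fun v => ?_
    set n := N.starProjection v with hn
    set u := v - n with hu
    have hnN : n ∈ N := Submodule.starProjection_apply_mem N v
    have huN : u ∈ Nᗮ := Submodule.sub_starProjection_mem_orthogonal v
    have hvn : v = n + u := by rw [hu]; abel
    have hort : inner ℝ n u = (0 : ℝ) := (Submodule.mem_orthogonal _ _).1 huN n hnN
    have hsq : ‖v‖ ^ 2 = ‖n‖ ^ 2 + ‖u‖ ^ 2 := by
      rw [hvn, norm_add_sq_real, hort]; ring
    have hin : inner ℝ ((D + c • N.starProjection) v) v =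
        ‖T v‖ ^ 2 - μ * ‖v‖ ^ 2 + c * ‖n‖ ^ 2 := by
      have e : (D + c • N.starProjection) v = -T (T v) - μ • v + c • n := rfl
      have e2 : inner ℝ n v = (‖n‖ ^ 2 : ℝ) := by
        rw [hvn, inner_add_right, hort, add_zero, real_inner_self_eq_norm_sq]
      rw [e, inner_add_left, inner_sub_left, inner_neg_left, hT.inner_left, neg_neg,
        inner_smul_left, inner_smul_left, real_inner_self_eq_norm_sq, real_inner_self_eq_norm_sq,
        e2]
      rfl
    have hTv : g * ‖u‖ - ε * ‖n‖ ≤ ‖T v‖ := by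
      have h1 : ‖T u‖ - ‖T n‖ ≤ ‖T v‖ := by
        have := norm_sub_norm_le (T u) (-T n)
        rw [norm_neg, sub_neg_eq_add, ← map_add, add_comm u n, ← hvn] at this
        exact this
      linarith [hN n hnN, hg u huN]
    have hTv2 : g ^ 2 * ‖u‖ ^ 2 - 2 * (g * ‖u‖) * (ε * ‖n‖) ≤ ‖T v‖ ^ 2 := by
      have h1 : 0 ≤ g * ‖u‖ := by positivity
      have h2 : 0 ≤ ε * ‖n‖ := by positivity
      have h3 := norm_nonneg (T v)
      -- In the first case `hTv` cannot be squared, but the left-hand side is already nonpositive.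
      rcases le_total (g * ‖u‖) (ε * ‖n‖) with h | h
      · nlinarith
      · nlinarith
    have hyoung : 2 * (g * ‖u‖) * (ε * ‖n‖) ≤
        d / 2 * ‖u‖ ^ 2 + 2 * g ^ 2 * ε ^ 2 / d * ‖n‖ ^ 2 := by
      have h1 : 0 ≤ d / 2 * (‖u‖ - 2 * g * ε / d * ‖n‖) ^ 2 := by positivity
      have h2 : d / 2 * (‖u‖ - 2 * g * ε / d * ‖n‖) ^ 2 = d / 2 * ‖u‖ ^ 2 +
          2 * g ^ 2 * ε ^ 2 / d * ‖n‖ ^ 2 - 2 * (g * ‖u‖) * (ε * ‖n‖) := by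
        field_simp
        ring
      linarith
    refine le_trans ?_ (le_abs_self _)
    rw [hin]
    change ‖v‖ ^ 2 * (d / 2) ≤ _
    rw [hsq, hc]
    have : g ^ 2 = d + μ := by rw [hd]; ring
    rw [this] at hTv2
    nlinarith
  obtain ⟨w, hw⟩ := hunit
  refine ⟨↑w⁻¹, ?_⟩
  have e : (↑w⁻¹ : E →L[ℝ] E) * D - 1 = -(↑w⁻¹ * (c • N.starProjection)) := by
    have h1 : D = w - c • N.starProjection := by rw [hw]; abel
    rw [h1, mul_sub, Units.inv_mul]; abel
  rw [e]
  exact (((finRank_starProjection N).smul c).mul_left _).neg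

/-- A variational substitute for the spectral theorem. Let μ be the infimum of ‖T w‖² over unit
vectors of the complement Y, and suppose μ < a². Then D = T* T - μ is left invertible modulo finite
rank, and injective on Y because its null vectors lie in the spectral subspace; so it is bounded
below on Y. Being positive on Y as well, it satisfies ⟪D w, w⟫ ≥ (c² / M) ‖w‖² there, which
contradicts the choice of μ. -/
theorem IsSkewAdjointOp.lower_bound_orthogonal (hT : IsSkewAdjointOp T) {N : Submodule ℝ E}
    [FiniteDimensional ℝ N] {ε g a : ℝ} (hε : 0 ≤ ε)
    (hN : ∀ v ∈ N, ‖T v‖ ≤ ε * ‖v‖) (hg : ∀ v ∈ Nᗮ, g * ‖v‖ ≤ ‖T v‖) (ha : 0 < a) (hag : a < g)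
    {v : E} (hv : v ∈ (spectralSubspace T a)ᗮ) : a * ‖v‖ ≤ ‖T v‖ := by
  by_contra! hlt
  set Y := (spectralSubspace T a)ᗮ with hY
  have hv0 : 0 < ‖v‖ := by
    rcases (norm_nonneg v).eq_or_lt with h0 | h0
    · rw [norm_eq_zero.1 h0.symm] at hlt
      simp at hlt
    · exact h0
  have hTY : ∀ w ∈ Y, T w ∈ Y := fun w hw =>
    hT.mem_orthogonal (fun _ h => apply_mem_spectralSubspace T h) hw
  set S : Set ℝ := (fun w => ‖T w‖ ^ 2) '' {w | w ∈ Y ∧ ‖w‖ = 1} with hS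
  have hscale : ∀ w ∈ Y, w ≠ 0 → (‖T w‖ / ‖w‖) ^ 2 ∈ S := fun w hw h0 => by
    refine ⟨‖w‖⁻¹ • w, ⟨Y.smul_mem _ hw, ?_⟩, ?_⟩
    · rw [norm_smul, norm_inv, norm_norm, inv_mul_cancel₀ (norm_ne_zero_iff.2 h0)]
    · change ‖T (‖w‖⁻¹ • w)‖ ^ 2 = _
      rw [map_smul, norm_smul, norm_inv, norm_norm, div_eq_inv_mul]
  have hbdd : BddBelow S := ⟨0, by rintro _ ⟨w, -, rfl⟩; positivity⟩
  have hne : S.Nonempty := ⟨_, hscale v hv (norm_pos_iff.1 hv0)⟩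
  set μ := sInf S with hμ
  have hμ0 : 0 ≤ μ := le_csInf hne (by rintro _ ⟨w, -, rfl⟩; positivity)
  have hμa : μ < a ^ 2 := by
    refine (csInf_le hbdd (hscale v hv (norm_pos_iff.1 hv0))).trans_lt ?_
    exact pow_lt_pow_left₀ ((div_lt_iff₀ hv0).2 hlt) (by positivity) two_ne_zero
  have hμY : ∀ w ∈ Y, μ * ‖w‖ ^ 2 ≤ ‖T w‖ ^ 2 := fun w hw => by
    by_cases h0 : w = 0
    · simp [h0]
    · have := csInf_le hbdd (hscale w hw h0)
      rw [div_pow, le_div_iff₀ (by positivity)] at this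
      exact this
  obtain ⟨V, hV⟩ := hT.exists_finRank_mul_sub_one hε (ha.trans hag).le hN hg
    (hμa.trans (pow_lt_pow_left₀ hag ha.le two_ne_zero))
  set D : E →L[ℝ] E := -(T * T) - μ • 1 with hD
  have hDapp : ∀ w, D w = -T (T w) - μ • w := fun w => rfl
  have hDker : ∀ w ∈ Y, D w = 0 → w = 0 := fun w hw h0 => by
    have h1 : T (T w) = -(μ • w) := by
      rw [hDapp, sub_eq_zero] at h0
      rw [← h0, neg_neg]
    exact Submodule.disjoint_def.1 (Submodule.orthogonal_disjoint _) w
      (hT.mem_spectralSubspace_of_eigenvector ha hμ0 hμa h1) hw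
  have hYc : CompleteSpace Y := (Submodule.isClosed_orthogonal _).completeSpace_coe
  obtain ⟨c, hc, hcY⟩ := exists_lower_bound hV Y hDker
  have hDY : ∀ w ∈ Y, D w ∈ Y := fun w hw => by
    rw [hDapp]
    exact Y.sub_mem (Y.neg_mem (hTY _ (hTY _ hw))) (Y.smul_mem _ hw)
  have hDinner : ∀ w, inner ℝ (D w) w = ‖T w‖ ^ 2 - μ * ‖w‖ ^ 2 := fun w => by
    rw [hDapp, inner_sub_left, inner_neg_left, hT.inner_left, neg_neg, inner_smul_left,
      real_inner_self_eq_norm_sq, real_inner_self_eq_norm_sq]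
    rfl
  have hDsymm : ∀ w w', inner ℝ (D w) w' = (inner ℝ w (D w') : ℝ) := fun w w' => by
    rw [hDapp, hDapp, inner_sub_left, inner_sub_right, inner_neg_left, inner_neg_right,
      hT.inner_left, hT.inner_left, inner_smul_left, inner_smul_right]
    simp
  have hpos : (compress Y D).IsPositive := by
    refine ⟨fun w w' => ?_, fun w => ?_⟩
    · change inner ℝ (compress Y D w) w' = inner ℝ w (compress Y D w')
      rw [inner_compress, hDsymm, real_inner_comm _ w, inner_compress, real_inner_comm]
    · change 0 ≤ inner ℝ (compress Y D w) w
      rw [inner_compress, hDinner, sub_nonneg]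
      exact hμY w w.2
  set M := ‖compress Y D‖ + 1 with hM
  have hM0 : 0 < M := by positivity
  have hlow : ∀ w ∈ Y, (μ + c ^ 2 / M) * ‖w‖ ^ 2 ≤ ‖T w‖ ^ 2 := fun w hw => by
    have h1 := hpos.norm_apply_sq_le hM0 (by rw [hM]; linarith) ⟨w, hw⟩
    rw [inner_compress] at h1
    have h2 : ‖compress Y D ⟨w, hw⟩‖ = ‖D w‖ :=
      congrArg norm (coe_compress_apply_of_mem Y (v := ⟨w, hw⟩) (hDY w hw))
    rw [h2] at h1
    change ‖D w‖ ^ 2 ≤ M * inner ℝ (D w) w at h1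
    rw [hDinner] at h1
    have h3 := hcY w hw
    have h4 : (c * ‖w‖) ^ 2 ≤ ‖D w‖ ^ 2 := pow_le_pow_left₀ (by positivity) h3 2
    have h5 := hμY w hw
    have h6 : c ^ 2 / M * ‖w‖ ^ 2 ≤ ‖T w‖ ^ 2 - μ * ‖w‖ ^ 2 := by
      rw [div_mul_eq_mul_div, div_le_iff₀ hM0]
      nlinarith
    linarith
  have h7 : μ + c ^ 2 / M ≤ μ := by
    refine le_csInf hne ?_
    rintro _ ⟨w, ⟨hw, hw1⟩, rfl⟩
    have := hlow w hw
    rwa [hw1, one_pow, mul_one] at this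
  have : 0 < c ^ 2 / M := by positivity
  linarith

end Gap

/-! ### Existence of the data defining the `ℤ₂`-valued spectral flow -/

section Existence

variable {E : Type*} [NormedAddCommGroup E] [InnerProductSpace ℝ E] [CompleteSpace E]

/-- In a spectral gap the spectral subspaces have constant dimension. -/
theorem IsSkewAdjointOp.spectralSubspace_gap {T : E →L[ℝ] E} (hT : IsSkewAdjointOp T)
    {N : Submodule ℝ E} [FiniteDimensional ℝ N] {ε g a : ℝ} (hε : 0 ≤ ε)
    (hN : ∀ v ∈ N, ‖T v‖ ≤ ε * ‖v‖) (hg : ∀ v ∈ Nᗮ, g * ‖v‖ ≤ ‖T v‖) (hεa : ε < a)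
    (hag : a < g) :
    FiniteDimensional ℝ (spectralSubspace T a) ∧
      Module.finrank ℝ (spectralSubspace T a) = Module.finrank ℝ N := by
  set X := spectralSubspace T a with hX
  have ha : 0 < a := hε.trans_lt hεa
  have hzero : ∀ {c d : ℝ} {v : E}, c < d → ‖T v‖ ≤ c * ‖v‖ → d * ‖v‖ ≤ ‖T v‖ → v = 0 := by
    intro c d v hcd h1 h2
    by_contra h0
    have := norm_pos_iff.2 h0
    nlinarith
  -- The projections between N and X are injective both ways: a vector of one space orthogonal to
  -- the other would satisfy incompatible bounds.
  have hi : Function.Injective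
      ((N.orthogonalProjectionOnto ∘L X.subtypeL : X →L[ℝ] N) : X →ₗ[ℝ] N) := by
    rw [injective_iff_map_eq_zero]
    intro v hv
    have h1 : N.starProjection (v : E) = 0 := congrArg Subtype.val hv
    rw [Submodule.starProjection_apply_eq_zero_iff] at h1
    exact Subtype.ext (hzero hag (hT.norm_apply_le_of_mem v.2) (hg _ h1))
  have hi' : Function.Injective
      ((X.orthogonalProjectionOnto ∘L N.subtypeL : N →L[ℝ] X) : N →ₗ[ℝ] X) := by
    rw [injective_iff_map_eq_zero]
    intro v hv
    have h1 : X.starProjection (v : E) = 0 := congrArg Subtype.val hv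
    rw [Submodule.starProjection_apply_eq_zero_iff] at h1
    exact Subtype.ext (hzero hεa (hN _ v.2) (hT.lower_bound_orthogonal hε hN hg ha hag h1))
  have hfin : FiniteDimensional ℝ X := Module.Finite.of_injective _ hi
  exact ⟨hfin, le_antisymm (LinearMap.finrank_le_finrank_of_injective hi)
    (LinearMap.finrank_le_finrank_of_injective hi')⟩

/-- Inclusion and equal dimension. It lets T be bounded by a on the subspace and from below by a' on
its complement, a genuine gap. -/
theorem IsSkewAdjointOp.spectralSubspace_eq {T : E →L[ℝ] E} (hT : IsSkewAdjointOp T)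
    {N : Submodule ℝ E} [FiniteDimensional ℝ N] {ε g a a' : ℝ} (hε : 0 ≤ ε)
    (hN : ∀ v ∈ N, ‖T v‖ ≤ ε * ‖v‖) (hg : ∀ v ∈ Nᗮ, g * ‖v‖ ≤ ‖T v‖) (hεa : ε < a)
    (haa : a ≤ a') (hag : a' < g) : spectralSubspace T a = spectralSubspace T a' := by
  obtain ⟨-, h2⟩ := hT.spectralSubspace_gap hε hN hg hεa (haa.trans_lt hag)
  obtain ⟨h3, h4⟩ := hT.spectralSubspace_gap hε hN hg (hεa.trans_le haa) hag
  exact Submodule.eq_of_le_of_finrank_eq (spectralSubspace_mono T haa) (h2.trans h4.symm)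

/-- An estimate of Davis–Kahan type: W = (1 - P') P satisfies T' W = W T - (1 - P')(T - T') on X,
whence β ‖W‖ ≤ α ‖W‖ + ‖T - T'‖. -/
theorem norm_one_sub_starProjection_mul_le {T T' : E →L[ℝ] E} (hT' : IsSkewAdjointOp T')
    {X X' : Submodule ℝ E} [X.HasOrthogonalProjection] [X'.HasOrthogonalProjection]
    (hTX : ∀ v ∈ X, T v ∈ X) (hTX' : ∀ v ∈ X', T' v ∈ X') {α β : ℝ} (hα : 0 ≤ α) (hαβ : α < β)
    (hX : ∀ v ∈ X, ‖T v‖ ≤ α * ‖v‖) (hX' : ∀ v ∈ X'ᗮ, β * ‖v‖ ≤ ‖T' v‖) :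
    ‖(1 - X'.starProjection) * X.starProjection‖ ≤ ‖T - T'‖ / (β - α) := by
  set W : E →L[ℝ] E := (1 - X'.starProjection) * X.starProjection with hW
  have hβ : 0 < β := hα.trans_lt hαβ
  have hone : ∀ v, ‖(1 - X'.starProjection) v‖ ≤ ‖v‖ := fun v => by
    have h := Submodule.starProjection_orthogonal' X'
    rw [← h]
    exact Submodule.norm_starProjection_apply_le _ v
  have hWapp : ∀ v ∈ X, W v = (1 - X'.starProjection) v := fun v hv => by
    rw [hW, mul_apply_eq_comp, Submodule.starProjection_eq_self_iff.2 hv]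
  have hcomm : ∀ v, T' ((1 - X'.starProjection) v) = (1 - X'.starProjection) (T' v) := fun v => by
    have := starProjection_comm_of_mem X' hTX' (fun _ => hT'.mem_orthogonal hTX') v
    change T' (v - X'.starProjection v) = T' v - X'.starProjection (T' v)
    rw [this, map_sub]
  have hbound : ∀ v ∈ X, β * ‖W v‖ ≤ (‖W‖ * α + ‖T - T'‖) * ‖v‖ := fun v hv => by
    have h1 : W v ∈ X'ᗮ := by
      rw [hWapp v hv]
      exact Submodule.sub_starProjection_mem_orthogonal v
    have h2 : T' (W v) = W (T v) - (1 - X'.starProjection) ((T - T') v) := by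
      rw [hWapp v hv, hcomm, hWapp _ (hTX v hv), sub_apply T, map_sub, sub_sub_cancel]
    refine (hX' _ h1).trans ?_
    rw [h2]
    refine (norm_sub_le _ _).trans ?_
    have h3 : ‖W (T v)‖ ≤ ‖W‖ * (α * ‖v‖) :=
      (W.le_opNorm _).trans (mul_le_mul_of_nonneg_left (hX v hv) (norm_nonneg _))
    have h4 := (hone ((T - T') v)).trans ((T - T').le_opNorm v)
    linarith
  have hle : ‖W‖ ≤ (‖W‖ * α + ‖T - T'‖) / β := by
    refine ContinuousLinearMap.opNorm_le_bound _ (by positivity) fun v => ?_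
    have h1 : W v = W (X.starProjection v) := by
      rw [hW, mul_apply_eq_comp, mul_apply_eq_comp,
        Submodule.starProjection_eq_self_iff.2 (Submodule.starProjection_apply_mem X v)]
    rw [h1, div_mul_eq_mul_div, le_div_iff₀ hβ, mul_comm]
    refine (hbound _ (Submodule.starProjection_apply_mem X v)).trans ?_
    exact mul_le_mul_of_nonneg_left (Submodule.norm_starProjection_apply_le X v) (by positivity)
  rw [le_div_iff₀ hβ] at hle
  rw [le_div_iff₀ (sub_pos.2 hαβ)]
  linarith

theorem norm_starProjection_sub_le {T T' : E →L[ℝ] E} (hT : IsSkewAdjointOp T)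
    (hT' : IsSkewAdjointOp T')
    {X X' : Submodule ℝ E} [X.HasOrthogonalProjection] [X'.HasOrthogonalProjection]
    (hTX : ∀ v ∈ X, T v ∈ X) (hTX' : ∀ v ∈ X', T' v ∈ X') {α β : ℝ} (hα : 0 ≤ α) (hαβ : α < β)
    (hX : ∀ v ∈ X, ‖T v‖ ≤ α * ‖v‖) (hXo : ∀ v ∈ Xᗮ, β * ‖v‖ ≤ ‖T v‖)
    (hX' : ∀ v ∈ X', ‖T' v‖ ≤ α * ‖v‖) (hXo' : ∀ v ∈ X'ᗮ, β * ‖v‖ ≤ ‖T' v‖) :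
    ‖X.starProjection - X'.starProjection‖ ≤ 2 / (β - α) * ‖T - T'‖ := by
  have h1 := norm_one_sub_starProjection_mul_le hT' hTX hTX' hα hαβ hX hXo'
  have h2 := norm_one_sub_starProjection_mul_le hT hTX' hTX hα hαβ hX' hXo
  rw [norm_sub_rev T' T] at h2
  have hsa : ∀ (Y : Submodule ℝ E) [Y.HasOrthogonalProjection],
      star Y.starProjection = Y.starProjection := fun Y _ => isSelfAdjoint_starProjection Y
  have h3 : X'.starProjection * (1 - X.starProjection) =
      star ((1 - X.starProjection) * X'.starProjection) := by
    rw [star_mul, star_sub, star_one, hsa, hsa]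
  have e : X.starProjection - X'.starProjection =
      (1 - X'.starProjection) * X.starProjection - X'.starProjection * (1 - X.starProjection) := by
    rw [sub_mul, mul_sub, one_mul, mul_one]; abel
  rw [e]
  refine (norm_sub_le _ _).trans ?_
  have h4 : ‖star ((1 - X.starProjection) * X'.starProjection)‖ =
      ‖(1 - X.starProjection) * X'.starProjection‖ := ContinuousLinearMap.adjoint.norm_map _
  rw [h3, h4]
  refine (add_le_add h1 h2).trans (le_of_eq ?_)
  ring

/-- Near every parameter value there is a cut-off for which the spectral projections have finite
rank and depend continuously on the parameter. -/
theorem exists_cutoff {T : ℝ → E →L[ℝ] E} (hTc : ContinuousOn T (Icc 0 1))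
    (hTs : ∀ t, IsSkewAdjointOp (T t)) {t₀ : ℝ} (ht₀ : t₀ ∈ Icc (0 : ℝ) 1) {V : E →L[ℝ] E}
    (hV : FinRank (V * T t₀ - 1)) :
    ∃ a > 0, ∃ δ > 0, ∃ C : ℝ, ∀ t ∈ Icc (0 : ℝ) 1, |t - t₀| < δ →
      FiniteDimensional ℝ (spectralSubspace (T t) a) ∧
      ∀ t' ∈ Icc (0 : ℝ) 1, |t' - t₀| < δ →
        ‖spectralProj (T t) a - spectralProj (T t') a‖ ≤ C * ‖T t - T t'‖ ∧
        ‖spectralProj (T t) a - spectralProj (T t') a‖ < 1 := by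
  have hfin := finiteDimensional_ker_of_finRank hV
  set N := (T t₀).ker with hN
  have hNc : CompleteSpace (Nᗮ : Submodule ℝ E) :=
    (Submodule.isClosed_orthogonal _).completeSpace_coe
  obtain ⟨g, hg0, hg⟩ := exists_lower_bound hV Nᗮ fun v hv h0 =>
    Submodule.disjoint_def.1 N.orthogonal_disjoint v h0 hv
  -- For ‖T t - T t₀‖ < ε the operator T t is at most ε on N and at least 7 ε on N⊥. So the cut-offs
  -- 2 ε and 6 ε give the same subspace, with a gap of 4 ε.
  set ε := g / 8 with hε
  have hε0 : 0 < ε := by positivity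
  obtain ⟨δ, hδ, hclose⟩ := exists_norm_sub_lt_of_continuousOn hTc ht₀ hε0
  have hTN : ∀ t ∈ Icc (0 : ℝ) 1, |t - t₀| < δ → ∀ v ∈ N, ‖T t v‖ ≤ ε * ‖v‖ :=
    fun t ht hd v hv => by
    have h1 : T t v = (T t - T t₀) v := by
      have h0 : T t₀ v = 0 := hv
      rw [sub_apply, h0, sub_zero]
    rw [h1]
    exact ((T t - T t₀).le_opNorm v).trans
      (mul_le_mul_of_nonneg_right (hclose t ht hd).le (norm_nonneg v))
  have hTo : ∀ t ∈ Icc (0 : ℝ) 1, |t - t₀| < δ → ∀ v ∈ Nᗮ, 7 * ε * ‖v‖ ≤ ‖T t v‖ :=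
    fun t ht hd v hv => by
    have h1 : T t v = T t₀ v + (T t - T t₀) v := by rw [sub_apply]; abel
    have h2 := ((T t - T t₀).le_opNorm v).trans
      (mul_le_mul_of_nonneg_right (hclose t ht hd).le (norm_nonneg v))
    have h3 := norm_sub_le (T t v) ((T t - T t₀) v)
    have h4 : T t v - (T t - T t₀) v = T t₀ v := by rw [sub_apply]; abel
    rw [h4] at h3
    have h5 := hg v hv
    have h6 : g * ‖v‖ = 8 * ε * ‖v‖ := by rw [hε]; ring
    linarith
  have heq : ∀ t ∈ Icc (0 : ℝ) 1, |t - t₀| < δ →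
      spectralSubspace (T t) (2 * ε) = spectralSubspace (T t) (6 * ε) := fun t ht hd =>
    (hTs t).spectralSubspace_eq hε0.le (hTN t ht hd) (hTo t ht hd) (by linarith) (by linarith)
      (by linarith)
  have hup : ∀ t, ∀ v ∈ spectralSubspace (T t) (2 * ε), ‖T t v‖ ≤ 2 * ε * ‖v‖ := fun t v hv =>
    (hTs t).norm_apply_le_of_mem hv
  have hlow : ∀ t ∈ Icc (0 : ℝ) 1, |t - t₀| < δ → ∀ v ∈ (spectralSubspace (T t) (2 * ε))ᗮ,
      6 * ε * ‖v‖ ≤ ‖T t v‖ := fun t ht hd v hv => by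
    rw [heq t ht hd] at hv
    exact (hTs t).lower_bound_orthogonal hε0.le (hTN t ht hd) (hTo t ht hd) (by positivity)
      (by linarith) hv
  refine ⟨2 * ε, by positivity, δ, hδ, 2 / (6 * ε - 2 * ε), fun t ht hd => ⟨?_, ?_⟩⟩
  · exact ((hTs t).spectralSubspace_gap hε0.le (hTN t ht hd) (hTo t ht hd) (by linarith)
      (by linarith)).1
  · intro t' ht' hd'
    have h1 := norm_starProjection_sub_le (hTs t) (hTs t')
      (fun v hv => apply_mem_spectralSubspace (a := 2 * ε) (T t) hv)
      (fun v hv => apply_mem_spectralSubspace (a := 2 * ε) (T t') hv)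
      (show 0 ≤ 2 * ε by positivity) (show 2 * ε < 6 * ε by linarith) (hup t) (hlow t ht hd)
      (hup t') (hlow t' ht' hd')
    refine ⟨h1, h1.trans_lt ?_⟩
    -- The Lipschitz constant is 2 / (4 ε), so this bound makes the projections differ by less than
    -- 1.
    have h2 : ‖T t - T t'‖ < 2 * ε := by
      have e : T t - T t' = (T t - T t₀) - (T t' - T t₀) := by abel
      rw [e]
      refine (norm_sub_le _ _).trans_lt ?_
      linarith [hclose t ht hd, hclose t' ht' hd']
    rw [div_mul_eq_mul_div, div_lt_one (by linarith)]
    linarith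

/-- A Lebesgue number for the cover of [0, 1] by the balls of radius δ t₀ about t₀. -/
theorem exists_uniform_of_pos (δ : ℝ → ℝ) (hδ : ∀ t ∈ Icc (0 : ℝ) 1, 0 < δ t) :
    ∃ δ₀ > 0, ∀ x ∈ Icc (0 : ℝ) 1, ∃ t₀ ∈ Icc (0 : ℝ) 1, ∀ t, |t - x| < δ₀ → |t - t₀| < δ t₀ := by
  obtain ⟨δ₀, h0, h⟩ := lebesgue_number_lemma_of_metric (s := Icc (0 : ℝ) 1)
    (c := fun i : Icc (0 : ℝ) 1 => Metric.ball (i : ℝ) (δ i)) isCompact_Icc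
    (fun _ => Metric.isOpen_ball)
    (fun x hx => mem_iUnion.2 ⟨⟨x, hx⟩, Metric.mem_ball_self (hδ x hx)⟩)
  refine ⟨δ₀, h0, fun x hx => ?_⟩
  obtain ⟨i, hi⟩ := h x hx
  exact ⟨i, i.2, fun t ht => hi (show dist t x < δ₀ from ht)⟩

/-- The partition into `N + 1` intervals of equal length. -/
noncomputable def uniformPartition (N : ℕ) : UnitPartition where
  N := N + 1
  pt n := n / (N + 1)
  strictMono n m h := by
    have : (n : ℝ) < m := by exact_mod_cast h
    have h0 : (0 : ℝ) < N + 1 := by positivity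
    exact div_lt_div_of_pos_right this h0
  pt_zero := by simp
  pt_last := by
    have h0 : (N : ℝ) + 1 ≠ 0 := by positivity
    simp [h0]

theorem uniformPartition_right_sub_left (N : ℕ) (n : Fin (N + 1)) :
    (uniformPartition N).right n - (uniformPartition N).left n = 1 / (N + 1) := by
  change ((n.succ : Fin (N + 2)) : ℝ) / (N + 1) - ((n.castSucc : Fin (N + 2)) : ℝ) / (N + 1) = _
  rw [← sub_div]
  simp

theorem compressed_eq_fillKernel (T I : E →L[ℝ] E) (a : ℝ) :
    compressed T (I * T.ker.starProjection) a = compress (spectralSubspace T a) (fillKernel T I) :=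
  rfl

theorem isUnit_compressed {T I P : E →L[ℝ] E} (h : IsPolarPair T I P) {a : ℝ} (ha : 0 < a)
    [FiniteDimensional ℝ (spectralSubspace T a)] :
    IsUnit (compressed T (I * T.ker.starProjection) a) := by
  rw [compressed_eq_fillKernel]
  refine isUnit_of_eq_zero fun v hv => ?_
  have h1 : fillKernel T I v ∈ spectralSubspace T a :=
    fillKernel_mem h (fun v hv => apply_mem_spectralSubspace T hv)
      (ker_le_spectralSubspace T ha) v.2
  have h2 := congrArg Subtype.val hv
  rw [coe_compress_apply_of_mem _ h1] at h2
  exact Subtype.ext (h.fillKernel_injective h2)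

theorem nonempty_spectralFlowData {T : ℝ → E →L[ℝ] E} (hTc : ContinuousOn T (Icc 0 1))
    (hTs : ∀ t, IsSkewAdjointOp (T t))
    (hV : ∀ t ∈ Icc (0 : ℝ) 1, ∃ V : E →L[ℝ] E, FinRank (V * T t - 1)) {I : ℝ → E →L[ℝ] E}
    (hI : ∀ t ∈ Icc (0 : ℝ) 1, ∃ P, IsPolarPair (T t) (I t) P) :
    Nonempty (SpectralFlowData T) := by
  -- Membership in [0, 1] is a premise inside the existential, so that `choose` yields functions on
  -- all of ℝ.
  have hcut : ∀ t₀ : ℝ, ∃ a δ C : ℝ, t₀ ∈ Icc (0 : ℝ) 1 → 0 < a ∧ 0 < δ ∧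
      ∀ t ∈ Icc (0 : ℝ) 1, |t - t₀| < δ →
      FiniteDimensional ℝ (spectralSubspace (T t) a) ∧
      ∀ t' ∈ Icc (0 : ℝ) 1, |t' - t₀| < δ →
        ‖spectralProj (T t) a - spectralProj (T t') a‖ ≤ C * ‖T t - T t'‖ ∧
        ‖spectralProj (T t) a - spectralProj (T t') a‖ < 1 := fun t₀ => by
    by_cases ht₀ : t₀ ∈ Icc (0 : ℝ) 1
    · obtain ⟨V, hV⟩ := hV t₀ ht₀
      obtain ⟨a, ha, δ, hδ, C, h⟩ := exists_cutoff hTc hTs ht₀ hV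
      exact ⟨a, δ, C, fun _ => ⟨ha, hδ, h⟩⟩
    · exact ⟨0, 0, 0, fun h => absurd h ht₀⟩
  choose a δ C hcut using hcut
  obtain ⟨δ₀, hδ₀, hleb⟩ := exists_uniform_of_pos δ fun t ht => (hcut t ht).2.1
  obtain ⟨N, hN⟩ := exists_nat_one_div_lt hδ₀
  set p := uniformPartition N with hp
  have hsub : ∀ n : Fin p.N, Icc (p.left n) (p.right n) ⊆ Icc 0 1 := fun n =>
    Icc_subset_Icc (p.pt_mem _).1 (p.pt_mem _).2
  have hlr : ∀ n : Fin p.N, p.left n ≤ p.right n := fun n =>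
    p.strictMono.monotone (Fin.castSucc_lt_succ (i := n)).le
  have hcenter : ∀ n : Fin p.N, ∃ t₀ ∈ Icc (0 : ℝ) 1, ∀ t ∈ Icc (p.left n) (p.right n),
      |t - t₀| < δ t₀ := fun n => by
    obtain ⟨t₀, ht₀, h⟩ := hleb (p.left n) (p.pt_mem _)
    refine ⟨t₀, ht₀, fun t ht => h t ?_⟩
    have h1 : p.right n - p.left n = 1 / (N + 1) := uniformPartition_right_sub_left N n
    rw [abs_of_nonneg (by linarith [ht.1])]
    linarith [ht.2]
  choose c hc hcI using hcenter
  have hfin : ∀ n, ∀ t ∈ Icc (p.left n) (p.right n),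
      FiniteDimensional ℝ (spectralSubspace (T t) (a (c n))) := fun n t ht =>
    ((hcut _ (hc n)).2.2 t (hsub n ht) (hcI n t ht)).1
  refine ⟨{ p with
    a := fun n => a (c n)
    a_pos := fun n => (hcut _ (hc n)).1
    finite_rank := hfin
    continuousOn_proj := fun n => ?_
    proj_close := fun n t ht t' ht' => (((hcut _ (hc n)).2.2 t (hsub n ht) (hcI n t ht)).2 t'
      (hsub n ht') (hcI n t' ht')).2
    -- With this R the sum T + R is `fillKernel T I`, which is injective and preserves the spectral
    -- subspaces.
    R := fun n => I (p.pt n) * (T (p.pt n)).ker.starProjection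
    R_skew := fun n => (hI _ (p.pt_mem n)).choose_spec.skew_mul_starProjection
    R_range := fun n x => (hI _ (p.pt_mem n)).choose_spec.apply_mem_ker
      (Submodule.starProjection_apply_mem _ x)
    isUnit_left := fun n => ?_
    isUnit_right := fun n => ?_ }⟩
  · intro t ht
    have h1 : ContinuousWithinAt (fun s => C (c n) * ‖T s - T t‖) (Icc (p.left n) (p.right n)) t :=
      (((hTc.mono (hsub n)) t ht).sub continuousWithinAt_const).norm.const_mul _
    rw [ContinuousWithinAt, tendsto_iff_norm_sub_tendsto_zero]
    have h2 : Tendsto (fun s => C (c n) * ‖T s - T t‖) (𝓝[Icc (p.left n) (p.right n)] t) (𝓝 0) := by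
      have := h1.tendsto
      rwa [sub_self, norm_zero, mul_zero] at this
    refine squeeze_zero' (Eventually.of_forall fun _ => norm_nonneg _) ?_ h2
    filter_upwards [self_mem_nhdsWithin] with s hs
    exact (((hcut _ (hc n)).2.2 s (hsub n hs) (hcI n s hs)).2 t (hsub n ht) (hcI n t ht)).1
  · have : FiniteDimensional ℝ (spectralSubspace (T (p.pt n.castSucc)) (a (c n))) :=
      hfin n _ (left_mem_Icc.2 (hlr n))
    exact isUnit_compressed (hI _ (p.pt_mem _)).choose_spec (hcut _ (hc n)).1
  · have : FiniteDimensional ℝ (spectralSubspace (T (p.pt n.succ)) (a (c n))) :=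
      hfin n _ (right_mem_Icc.2 (hlr n))
    exact isUnit_compressed (hI _ (p.pt_mem _)).choose_spec (hcut _ (hc n)).1

end Existence

/-! ### Assembling the main theorem -/

theorem neg_one_pow_sum {ι : Type*} (s : Finset ι) (f : ι → ZMod 2) :
    (-1 : ℤˣ) ^ (∑ i ∈ s, f i) = ∏ i ∈ s, (-1 : ℤˣ) ^ f i := by
  classical
  induction s using Finset.induction_on with
  | empty => rw [Finset.sum_empty, Finset.prod_empty, uzpow_zero]
  | insert i s hi ih => rw [Finset.sum_insert hi, Finset.prod_insert hi, uzpow_add, ih]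

/-- Let `B` be an admissible path of Fredholm operators, `T` the associated path of chiral
skew-adjoint operators and `I t` chiral complex structures completing the phase of `T t`. Then the
parity of `B` is well defined and, for every sufficiently fine partition, consecutive `I`'s form
Fredholm pairs and the parity is `(-1)` to the power `∑ PI(I_{t_{n-1}}, I_{t_n}) mod 2`. -/
theorem mainTheorem4 {H : Type*} [NormedAddCommGroup H] [InnerProductSpace ℝ H] [CompleteSpace H]
    (B : ℝ → H →L[ℝ] H) (hB : IsAdmissiblePath B)
    (I : ℝ → WithLp 2 (H × H) →L[ℝ] WithLp 2 (H × H))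
    (hI : ∀ t ∈ Set.Icc (0 : ℝ) 1, CompletesPhase (chiralOp (B t)) (I t)) :
    (∃! s : ℤˣ, HasSF₂ (fun t => chiralOp (B t)) s) ∧
    ∃ δ > 0, ∀ p : UnitPartition, (∀ n : Fin p.N, p.right n - p.left n < δ) →
      (∀ n : Fin p.N, IsFredholmPair (I (p.left n)) (I (p.right n))) ∧
      parity B = (-1 : ℤˣ) ^ (∑ n : Fin p.N, pairIndex (I (p.left n)) (I (p.right n))) := by
  obtain ⟨P, hP⟩ : ∃ P : ℝ → WithLp 2 (H × H) →L[ℝ] WithLp 2 (H × H), ∀ t ∈ Icc (0 : ℝ) 1,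
      IsPolarPair (chiralOp (B t)) (I t) (P t) := by
    have := fun t : Icc (0 : ℝ) 1 => (hI t t.2).exists_isPolarPair
    choose P hP using this
    refine ⟨fun t => if h : t ∈ Icc (0 : ℝ) 1 then P ⟨t, h⟩ else 0, fun t ht => ?_⟩
    simp only [dif_pos ht]
    exact hP ⟨t, ht⟩
  have hg : ∀ t ∈ Icc (0 : ℝ) 1, IsUnit (upperRight (fillKernel (chiralOp (B t)) (I t))) ∧
      FinRank (upperRight (fillKernel (chiralOp (B t)) (I t)) - B t) := fun t ht => by
    obtain ⟨V, hV⟩ := exists_finRank_mul_chiralOp_sub_one (hB.isFredholm t ht)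
    have := finiteDimensional_ker_of_finRank hV
    refine ⟨(IsPolarPair.odd_fillKernel (isOddOp_chiralOp _)
      (hI t ht).1.isOddOp).isUnit_upperRight ((hP t ht).isUnit_fillKernel hV), ?_⟩
    have h1 : FinRank (fillKernel (chiralOp (B t)) (I t) - chiralOp (B t)) :=
      IsPolarPair.finRank_fillKernel_sub
    have h2 := h1.upperRight
    rwa [upperRight_sub, upperRight_chiralOp] at h2
  -- K is the continuous reference against which all signs are measured; the completions I t
  -- themselves need not be continuous in t.
  obtain ⟨K, hKc, hK⟩ := exists_continuousOn_isUnit_finRank hB.continuousOn hg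
  set o : ℝ → ℤˣ := fun t => relSign (K t) (upperRight (fillKernel (chiralOp (B t)) (I t))) with ho
  have hval : ∀ s, HasSF₂ (fun t => chiralOp (B t)) s → s = o 0 * o 1 := by
    rintro s ⟨d, rfl⟩
    exact d.value_eq hB hI hKc hK
  have hTc : ContinuousOn (fun t => chiralOp (B t)) (Icc 0 1) :=
    continuous_chiralOp.comp_continuousOn hB.continuousOn
  obtain ⟨d⟩ := nonempty_spectralFlowData hTc (fun t => isSkewAdjointOp_chiralOp (B t))
    (fun t ht => exists_finRank_mul_chiralOp_sub_one (hB.isFredholm t ht))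
    (fun t ht => ⟨P t, hP t ht⟩)
  -- `SF₂` is an `epsilon`, so one datum must exist before it is known to be an actual value.
  have hpar : parity B = o 0 * o 1 :=
    hval _ (Classical.epsilon_spec (p := HasSF₂ fun t => chiralOp (B t)) ⟨d.value, d, rfl⟩)
  refine ⟨⟨d.value, ⟨d, rfl⟩, fun s hs => (hval s hs).trans (hval _ ⟨d, rfl⟩).symm⟩, ?_⟩
  have hloc : ∀ t₀ : ℝ, ∃ δ : ℝ, t₀ ∈ Icc (0 : ℝ) 1 → 0 < δ ∧ ∀ t ∈ Icc (0 : ℝ) 1,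
      ∀ t' ∈ Icc (0 : ℝ) 1, |t - t₀| < δ → |t' - t₀| < δ →
      ‖calkinMk (I t - I t')‖ < 2 ∧ (-1 : ℤˣ) ^ pairIndex (I t) (I t') = o t * o t' := fun t₀ => by
    by_cases ht₀ : t₀ ∈ Icc (0 : ℝ) 1
    · obtain ⟨δ, hδ, h⟩ := exists_pairIndex_eq hB hI hKc hK ht₀
      exact ⟨δ, fun _ => ⟨hδ, h⟩⟩
    · exact ⟨0, fun h => absurd h ht₀⟩
  choose δ hδ using hloc
  obtain ⟨δ₀, hδ₀, hleb⟩ := exists_uniform_of_pos δ fun t ht => (hδ t ht).1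
  refine ⟨δ₀, hδ₀, fun p hp => ?_⟩
  have hpair : ∀ n : Fin p.N, ‖calkinMk (I (p.left n) - I (p.right n))‖ < 2 ∧
      (-1 : ℤˣ) ^ pairIndex (I (p.left n)) (I (p.right n)) = o (p.left n) * o (p.right n) :=
    fun n => by
      obtain ⟨t₀, ht₀, h⟩ := hleb (p.left n) (p.pt_mem _)
      refine (hδ t₀ ht₀).2 _ (p.pt_mem _) _ (p.pt_mem _) (h (p.left n) (by simpa using hδ₀))
        (h _ ?_)
      have hlr : p.left n ≤ p.right n := p.strictMono.monotone (Fin.castSucc_lt_succ (i := n)).le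
      rw [abs_of_nonneg (sub_nonneg.2 hlr)]
      exact hp n
  refine ⟨fun n => ⟨(hI _ (p.pt_mem _)).1, (hI _ (p.pt_mem _)).1, (hpair n).1⟩, ?_⟩
  rw [hpar, neg_one_pow_sum, Finset.prod_congr rfl fun n _ => (hpair n).2]
  -- The index product telescopes to `o 0 * o 1`, the value already found for the parity.
  have := prod_telescope Int.units_mul_self p.N fun n => o (p.pt n)
  simp only [p.pt_zero, p.pt_last] at this
  exact this.symm
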